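/- Let $Z\in\mathbb R$, $\mu\in\mathbb C$, $\alpha,\beta\in[0,\pi)$. For $k\in\mathbb C\setminus\{0\}$ consider the radial equation $$\big((x+1)u'(x)\big)'+\Big[\tfrac{k^2}{4}\big(x+1+2(x+1)^{-1}+(x+1)^{-3}\big)+\tfrac{Z}{2}\big(1+(x+1)^{-2}\big)-\tfrac{\mu}{x+1}\Big]u(x)=0,\qquad x\in\mathbb C\setminus(-\infty,-1],$$ which is $v''(\xi)+(k^2\cosh^2\xi+Z\cosh\xi-\mu)v(\xi)=0$ in the variable $x=e^\xi-1$, and the Wronskian $W(f,g)=(x+1)(fg'-f'g)$. *Phase function.* A global phase function is a function $\phi(\xi,k)$ ($\xi\in\mathbb R$, $k\in\mathbb C\setminus\{0\}$) with $\phi(\xi,-k)=-\phi(\xi,k)$ such that for every integer $j\ge1$ there are a real function $l_j\in C^2((0,\infty))$ with $|l_j|\le 1/j$, with $l_j(\tau)=-Z/\sqrt{1+\tau^2}$ for all large $\tau$ and with $\frac{\mu}{1+\tau^2}-\frac{Z}{\sqrt{1+\tau^2}}-l_j(\tau)\in L^1((0,\infty))$, and an analytic function $g_j$ on $\Omega_j=\{|k|^2>1/j\}$,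 with $$\phi(\xi,k)=\int_0^{\sinh\xi}\sqrt{k^2-l_j(\tau)}\,d\tau+g_j(k)$$ for all $k\in\Omega_j$ and all $\xi$ larger than a constant depending only on $j$; here $\sqrt{k^2-l}:=k\sqrt{1-l/k^2}$ with the principal root. Fix a global phase function. For each $k\neq0$ the function $x\mapsto\phi(\log(x+1),k)$, $x$ real and large, continues analytically to $\{x\in\mathbb C\setminus(-\infty,0]:|x|>R\}$ for some $R=R(k)>0$; write $\phi(x,k)$ for the continuation. *Solutions.* Let $\tilde v_0(\cdot,k)$ be the solution with $\tilde v_0(0,k)=1$, $\tilde v_0'(0,k)=0$. Let $D_\pm(\alpha,\beta)=\{k\ne0:-\beta<\arg(\pm k)<\pi+\alpha\}$, considered as a (possibly two-sheeted) domain on the Riemann surface of the logarithm of $\pm k$. For $k\in D_\pm(\alpha,\beta)$ with $0\le\arg(\pm k)\le\pi$ let $\tilde v_\pm(\cdot,k)$ be the solution with $$\tilde v_\pm(x,k)=\frac{1}{\sqrt{x+1}}\,e^{\pm i\phi(x,k)}(1+o(1))\qquad(x\to+\infty).$$ Then $\tilde v_0$ and $\tilde v_\pm$ exist and are analytic in $x\in\mathbb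 C\setminus(-\infty,-1]$; $\tilde v_\pm(x,\cdot)$ extends to an analytic family of solutions for $k\in D_\pm(\alpha,\beta)$; and the Jost functions $$f_\pm(k):=W\big(\tilde v_\pm(\cdot,k),\tilde v_0(\cdot,k)\big)$$ (which do not depend on $x$) are analytic on $D_\pm(\alpha,\beta)$. Moreover, for every $k\in D_\pm(\alpha,\beta)$ and every $\gamma\in(-\alpha,\beta)$ with $0<\gamma+\arg(\pm k)<\pi$, $$f_\pm(k)=\mp\, ik\lim_{x\to+\infty}e^{i\gamma/2}\sqrt{x}\;\exp\!\big(\pm i\phi(e^{i\gamma}x,k)\big)\,\tilde v_0(e^{i\gamma}x,k).$$ -/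

import Mathlib

open Filter Topology

noncomputable section

namespace TwoCenters

/-- The slit plane `ℂ ∖ (-∞, -1]`, on which the coefficients of the radial equation, in the
variable `x = exp ξ - 1`, are analytic. -/
def radialDomain : Set ℂ := {x | x + 1 ∈ Complex.slitPlane}

/-- The potential `q(x, k, Z, μ)` of the radial equation in the variable `x = exp ξ - 1`. -/
def radialPotential (Z : ℝ) (μ k x : ℂ) : ℂ :=
  k ^ 2 / 4 * (x + 1 + 2 * (x + 1)⁻¹ + ((x + 1) ^ 3)⁻¹)
    + (Z : ℂ) / 2 * (1 + ((x + 1) ^ 2)⁻¹) - μ / (x + 1)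

/-- `u` is an analytic solution on `ℂ ∖ (-∞, -1]` of the radial equation
`((x + 1) u')' + q(x, k, Z, μ) u = 0`. -/
structure IsRadialSolution (Z : ℝ) (μ k : ℂ) (u : ℂ → ℂ) : Prop where
  analytic : AnalyticOnNhd ℂ u radialDomain
  ode : ∀ x ∈ radialDomain,
    deriv (fun y => (y + 1) * deriv u y) x + radialPotential Z μ k x * u x = 0

/-- The regular solution: `u(0) = 1`, `u'(0) = 0`. -/
structure IsRegularSolution (Z : ℝ) (μ k : ℂ) (u : ℂ → ℂ) : Prop where
  solution : IsRadialSolution Z μ k u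
  value_zero : u 0 = 1
  deriv_zero : deriv u 0 = 0

/-- The generalised Wronskian `W_x(f, g) = (x + 1) (f(x) g'(x) - f'(x) g(x))` of the radial
equation. -/
def wronskian (f g : ℂ → ℂ) (x : ℂ) : ℂ :=
  (x + 1) * (f x * deriv g x - deriv f x * g x)

/-- The exterior region `Ω_j = {k ∈ ℂ : |k|² > 1/j}`. -/
def phaseRegion (j : ℕ) : Set ℂ := {k | 1 / (j : ℝ) < ‖k‖ ^ 2}

/-- `l` is an admissible long range part, at level `j`, of
`q(τ) = μ / (1 + τ²) - Z / √(1 + τ²)`. -/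
structure IsLongRangePart (Z : ℝ) (μ : ℂ) (j : ℕ) (l : ℝ → ℝ) : Prop where
  contDiffOn : ContDiffOn ℝ 2 l (Set.Ioi 0)
  bound : ∀ τ > 0, |l τ| ≤ 1 / (j : ℝ)
  eq_far : ∃ R : ℝ, ∀ τ > R, l τ = -Z / √(1 + τ ^ 2)
  short_integrable : MeasureTheory.IntegrableOn
    (fun τ : ℝ => μ / (1 + (τ : ℂ) ^ 2) - ((Z / √(1 + τ ^ 2) : ℝ) : ℂ) - (l τ : ℂ)) (Set.Ioi 0)

/-- The local phase function `∫₀^{sinh ξ} √(k² - l(τ)) dτ`. The branch of `√(k² - l)` is the one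
that is analytic in `{|k|² > sup |l|}` and asymptotic to `k` for large `k`, that is
`k √(1 - l / k²)` with the principal square root. -/
def localPhase (l : ℝ → ℝ) (ξ : ℝ) (k : ℂ) : ℂ :=
  ∫ τ in (0 : ℝ)..Real.sinh ξ, k * (1 - (l τ : ℂ) / k ^ 2) ^ (1 / 2 : ℂ)

/-- `φ(ξ, k)` is a global phase function: it is odd in `k` and, for every `j ≥ 1`, for all large
`ξ` it differs on `Ω_j` from a local phase function of level `j` by an analytic function of `k`
alone. -/
structure IsGlobalPhase (Z : ℝ) (μ : ℂ) (φ : ℝ → ℂ → ℂ) : Prop where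
  eq_local : ∀ j : ℕ, 1 ≤ j → ∃ (l : ℝ → ℝ) (g : ℂ → ℂ) (R : ℝ),
    IsLongRangePart Z μ j l ∧ AnalyticOnNhd ℂ g (phaseRegion j) ∧
    ∀ ξ > R, ∀ k ∈ phaseRegion j, φ ξ k = localPhase l ξ k + g k
  odd : ∀ ξ : ℝ, ∀ k : ℂ, k ≠ 0 → φ ξ (-k) = -φ ξ k

/-- `Φ(x, k)` is, for every `k ≠ 0`, the analytic continuation in `x` of the germ at `+∞` of
`x ↦ φ(log(x + 1), k)` to a neighbourhood of infinity in the plane slit along the negative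
half-line. -/
def IsPhaseContinuation (φ : ℝ → ℂ → ℂ) (Φ : ℂ → ℂ → ℂ) : Prop :=
  ∀ k : ℂ, k ≠ 0 → ∃ R > 0,
    AnalyticOnNhd ℂ (fun x => Φ x k) {x | x ∈ Complex.slitPlane ∧ R < ‖x‖} ∧
    ∀ x : ℝ, R < x → Φ (x : ℂ) k = φ (Real.log (x + 1)) k

/-- The possibly two-sheeted domain `D_±(α, β) = {-β < arg(± k) < π + α}` in the logarithmic
coordinate `κ = log(± k)`, that is `k = ± exp κ` and `arg(± k) = Im κ`. As `exp` is a local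
biholomorphism, analyticity on `D_±(α, β)` is analyticity in `κ`. -/
def jostDomain (α β : ℝ) : Set ℂ := {κ | -β < κ.im ∧ κ.im < Real.pi + α}

/-- For `σ = 1` (`σ = -1`): `v κ` is the outgoing solution `ṽ₊(·, k)` (incoming solution
`ṽ₋(·, k)`) at the point `k = σ exp κ`. On the closed upper (lower) half-plane, `0 ≤ Im κ ≤ π`,
it is the solution of the radial equation with the asymptotics
`(x + 1)^{-1/2} exp(± i φ) (1 + o(1))` as `x → +∞`, and elsewhere it is the analytic continuation
in `k` of that family. -/
structure IsJostSolution (Z : ℝ) (μ : ℂ) (φ : ℝ → ℂ → ℂ) (α β : ℝ) (σ : ℂ)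
    (v : ℂ → ℂ → ℂ) : Prop where
  solution : ∀ κ ∈ jostDomain α β, IsRadialSolution Z μ (σ * Complex.exp κ) (v κ)
  analytic : ∀ x ∈ radialDomain, AnalyticOnNhd ℂ (fun κ => v κ x) (jostDomain α β)
  asymptotics : ∀ κ ∈ jostDomain α β, 0 ≤ κ.im → κ.im ≤ Real.pi →
    Tendsto (fun x : ℝ => (√(x + 1) : ℂ)
        * Complex.exp (-(σ * Complex.I * φ (Real.log (x + 1)) (σ * Complex.exp κ))) * v κ x)
      atTop (𝓝 1)

end TwoCenters

end

namespace TwoCenters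

/-! The phase is made explicit first. Substituting `τ = sinh ξ` and `s = exp (-ξ)`, the local phase
equals `k sinh ξ + Zξ/(2k)`, plus a function of `s` holomorphic near `s = 0`, plus a function `c(k)`
for large `ξ` (`localPhase_eq`). The functions `c` of different levels agree on overlaps, so `c` is
analytic and odd on `k ≠ 0` (`exists_phase_constant`). With `s = 1/(x+1)` this also continues the
phase in `x`. At infinity it differs by `o(1)` from `c(k) + Θ`, where `Θ = k(x+1)/2 + (Z/2k)
log(x+1)` is `leadingPhase`.

In the variable `z = k(x+1) = exp κ (x+1)` the decaying solution is sought as `exp(iz/2) z^(ia-1/2)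
m(z)` with `a = Z/(2k)`. The amplitude then satisfies `m'' + (i + 2ia/z) m' + V m = 0` with `V =
O(1/z²)`. This is solved by a Volterra equation integrated from `i∞` along vertical rays, where the
kernel decays like `exp(-s)` wherever `z` lies. The Neumann series therefore converges on a region
containing the far part of every ray `0 ≤ arg z ≤ π`, boundary rays included, and `m → 1` there
(`exists_jost_amplitude`). One wave thus has the Jost asymptotics on all rays `arg x = γ` with `0 ≤
γ + arg k ≤ π` at once, and this gives the continuation in `k` across the real axis.

Expanded in the entire solutions in `ξ` with fixed data at `0`, the wave has coefficients that are
Wronskians at one base point, hence holomorphic in `κ` (`exists_local_jost`). A solution with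
decaying leading behaviour is unique (`eq_of_decaying`), so the local families glue over the strip
`-π < Im κ < 2π`, and the Jost solutions coincide with the glued family.

The limit formula comes from `tendsto_ray_of_decaying`. If `u` decays and `s` is another solution,
then `(s/u)' = W(u,s)/((x+1)u²)`, and a l'Hôpital argument recovers `W(u,s)` from the growth of `s`
on the ray. The signs `±` are treated together because the equation depends on `k²` and the phase is
odd. -/

open MeasureTheory Set Metric

/-! ### Holomorphic dependence of integrals on parameters -/

/-- Differentiation under the integral sign for a dominated family of holomorphic functions. -/
theorem hasDerivAt_integral_of_dominated {A : Type*} [MeasurableSpace A] {ν : Measure A}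
    {F : ℂ → A → ℂ} {z₀ : ℂ} {r : ℝ} (hr : 0 < r) {bound : A → ℝ}
    (hd : ∀ᵐ a ∂ν, DifferentiableOn ℂ (fun z => F z a) (ball z₀ r))
    (hm : ∀ z ∈ ball z₀ r, AEStronglyMeasurable (F z) ν)
    (hb : ∀ᵐ a ∂ν, ∀ z ∈ ball z₀ r, ‖F z a‖ ≤ bound a) (hi : Integrable bound ν) :
    Integrable (fun a => deriv (fun z => F z a) z₀) ν ∧
      HasDerivAt (fun z => ∫ a, F z a ∂ν) (∫ a, deriv (fun z => F z a) z₀ ∂ν) z₀ := by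
  have hz₀ : z₀ ∈ ball z₀ r := mem_ball_self hr
  have hmeas : AEStronglyMeasurable (fun a => deriv (fun z => F z a) z₀) ν := by
    -- The derivative is measurable as a pointwise limit of difference quotients. The shift by 2
    -- keeps already the step `n = 0` strictly inside the ball.
    obtain ⟨u, hu⟩ : ∃ u : ℕ → ℂ, ∀ n, u n = ((r / (n + 2) : ℝ) : ℂ) := ⟨_, fun _ => rfl⟩
    have hu0 : ∀ n, u n ≠ 0 := fun n => by
      rw [hu]; exact_mod_cast (by positivity : (r / (n + 2) : ℝ) ≠ 0)
    have hub : ∀ n, z₀ + u n ∈ ball z₀ r := fun n => by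
      rw [mem_ball_iff_norm, add_sub_cancel_left, hu, Complex.norm_real, Real.norm_eq_abs,
        abs_of_pos (by positivity), div_lt_iff₀ (by positivity)]
      nlinarith [(Nat.cast_nonneg n : (0 : ℝ) ≤ n)]
    have hlim : Tendsto u atTop (𝓝 0) := by
      have h1 : Tendsto (fun n : ℕ => r / ((n : ℝ) + 2)) atTop (𝓝 0) :=
        tendsto_const_nhds.div_atTop
          (tendsto_atTop_add_const_right _ _ tendsto_natCast_atTop_atTop)
      have h2 := (Complex.continuous_ofReal.tendsto 0).comp h1
      simpa [Function.comp_def, hu, funext hu] using h2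
    refine aestronglyMeasurable_of_tendsto_ae atTop
      (f := fun n a => (u n)⁻¹ * (F (z₀ + u n) a - F z₀ a)) (fun n => ?_) ?_
    · exact ((hm _ (hub n)).sub (hm _ hz₀)).const_mul _
    · filter_upwards [hd] with a ha
      have h1 := ((ha z₀ hz₀).differentiableAt (isOpen_ball.mem_nhds hz₀)).hasDerivAt
      have h2 := h1.tendsto_slope_zero
      have h3 : Tendsto u atTop (𝓝[≠] 0) :=
        tendsto_nhdsWithin_iff.2 ⟨hlim, Eventually.of_forall hu0⟩
      simpa [Function.comp_def] using h2.comp h3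
  have hsub : ∀ z ∈ ball z₀ (r / 2), ball z (r / 2) ⊆ ball z₀ r := fun z hz =>
    ball_subset_ball' (by rw [mem_ball] at hz; linarith)
  have hsub' : ball z₀ (r / 2) ⊆ ball z₀ r := ball_subset_ball (by linarith)
  refine hasDerivAt_integral_of_dominated_loc_of_deriv_le (s := ball z₀ (r / 2))
    (F' := fun z a => deriv (fun z => F z a) z) (bound := fun a => bound a / (r / 4))
    (ball_mem_nhds _ (by positivity)) ?_ ?_ hmeas ?_ (hi.div_const _) ?_
  · exact eventually_of_mem (ball_mem_nhds _ hr) hm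
  · exact hi.mono' (hm _ hz₀) (hb.mono fun a ha => ha _ hz₀)
  · filter_upwards [hd, hb] with a ha hba z hz
    -- Cauchy's estimate on circles of radius `r/4` turns the bound on the functions into one on
    -- their derivatives, so no hypothesis on the derivatives is needed.
    have hcb : closedBall z (r / 4) ⊆ ball z₀ r :=
      (closedBall_subset_ball (by linarith)).trans (hsub z hz)
    refine Complex.norm_deriv_le_of_forall_mem_sphere_norm_le (by positivity) ?_ fun w hw =>
      hba w (hcb (sphere_subset_closedBall hw))
    exact (ha.mono hcb).diffContOnCl_ball subset_rfl
  · filter_upwards [hd] with a ha z hz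
    exact ((ha z (hsub' hz)).differentiableAt (isOpen_ball.mem_nhds (hsub' hz))).hasDerivAt

theorem differentiableAt_integral_of_dominated {A : Type*} [MeasurableSpace A] {ν : Measure A}
    {F : ℂ → A → ℂ} {z₀ : ℂ} {r : ℝ} (hr : 0 < r) {bound : A → ℝ}
    (hd : ∀ᵐ a ∂ν, DifferentiableOn ℂ (fun z => F z a) (ball z₀ r))
    (hm : ∀ z ∈ ball z₀ r, AEStronglyMeasurable (F z) ν)
    (hb : ∀ᵐ a ∂ν, ∀ z ∈ ball z₀ r, ‖F z a‖ ≤ bound a) (hi : Integrable bound ν) :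
    DifferentiableAt ℂ (fun z => ∫ a, F z a ∂ν) z₀ :=
  (hasDerivAt_integral_of_dominated hr hd hm hb hi).2.differentiableAt

/-- Composition with a moving point: a locally bounded, separately holomorphic function and its
partial derivative are holomorphic along holomorphic graphs. -/
theorem differentiableAt_comp_graph {F : ℂ → ℂ → ℂ} {ψ : ℂ → ℂ} {t₀ : ℂ} {r M : ℝ} (hr : 0 < r)
    (hF₁ : ∀ z ∈ closedBall (ψ t₀) r, DifferentiableOn ℂ (fun t => F t z) (ball t₀ r))
    (hF₂ : ∀ t ∈ ball t₀ r, DifferentiableOn ℂ (F t) (closedBall (ψ t₀) r))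
    (hM : ∀ t ∈ ball t₀ r, ∀ z ∈ closedBall (ψ t₀) r, ‖F t z‖ ≤ M)
    (hψ : ∀ᶠ t in 𝓝 t₀, DifferentiableAt ℂ ψ t) :
    DifferentiableAt ℂ (fun t => F t (ψ t)) t₀ ∧
      DifferentiableAt ℂ (fun t => deriv (F t) (ψ t)) t₀ := by
  obtain ⟨d, hd, hdr, hd'⟩ : ∃ d > 0, d ≤ r ∧ ∀ t ∈ ball t₀ d, DifferentiableAt ℂ ψ t ∧
      ψ t ∈ ball (ψ t₀) (r / 2) := by
    have h1 : ∀ᶠ t in 𝓝 t₀, ψ t ∈ ball (ψ t₀) (r / 2) :=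
      hψ.self_of_nhds.continuousAt (ball_mem_nhds _ (by positivity))
    obtain ⟨d, hd, h⟩ := Metric.eventually_nhds_iff_ball.1 (hψ.and h1)
    exact ⟨min d r, lt_min hd hr, min_le_right _ _,
      fun t ht => h t (ball_subset_ball (min_le_left _ _) ht)⟩
  -- The moving point stays within `r/2` of the centre, so the circle of radius `3r/4` keeps
  -- distance `r/4` from it while lying inside the closed ball of radius `r`.
  obtain ⟨q, hqdef⟩ : ∃ q, q = 3 * r / 4 := ⟨_, rfl⟩
  have hq : 0 < q := by linarith
  have hqr : closedBall (ψ t₀) q ⊆ closedBall (ψ t₀) r := closedBall_subset_closedBall (by linarith)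
  have hqr' : closedBall (ψ t₀) q ⊆ ball (ψ t₀) r := closedBall_subset_ball (by linarith)
  have hsph : ∀ θ : ℝ, circleMap (ψ t₀) q θ ∈ sphere (ψ t₀) q :=
    fun θ => circleMap_mem_sphere _ hq.le θ
  have hlow : ∀ t ∈ ball t₀ d, ∀ θ : ℝ, r / 4 ≤ ‖circleMap (ψ t₀) q θ - ψ t‖ := fun t ht θ => by
    have h1 := (hd' t ht).2
    rw [mem_ball_iff_norm] at h1
    have h2 := hsph θ
    rw [mem_sphere_iff_norm] at h2
    have h3 := norm_sub_norm_le (circleMap (ψ t₀) q θ - ψ t₀) (ψ t - ψ t₀)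
    rw [sub_sub_sub_cancel_right] at h3
    linarith
  have hne : ∀ t ∈ ball t₀ d, ∀ θ : ℝ, circleMap (ψ t₀) q θ - ψ t ≠ 0 := fun t ht θ =>
    norm_pos_iff.1 (lt_of_lt_of_le (by positivity) (hlow t ht θ))
  have hM0 : 0 ≤ M := (norm_nonneg _).trans
    (hM t₀ (mem_ball_self hr) _ (mem_closedBall_self hr.le))
  -- Cauchy's formula replaces `F t (ψ t)` (for `n = 1`) and its `z`-derivative (for `n = 2`) by
  -- integrals over a fixed circle. There only separate holomorphy and boundedness are used, so
  -- Hartogs' theorem is not needed.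
  have key : ∀ n : ℕ, DifferentiableAt ℂ (fun t => ∮ z in C(ψ t₀, q),
      ((z - ψ t) ^ n)⁻¹ • F t z) t₀ := by
    intro n
    unfold circleIntegral
    simp only [intervalIntegral.integral_of_le Real.two_pi_pos.le]
    refine differentiableAt_integral_of_dominated hd
      (bound := fun _ => q * (((r / 4) ^ n)⁻¹ * M)) ?_ ?_ ?_ ?_
    · refine Eventually.of_forall fun θ => ?_
      simp only [smul_eq_mul]
      refine DifferentiableOn.const_mul (DifferentiableOn.mul ?_ ?_) _
      · refine DifferentiableOn.inv ((DifferentiableOn.sub (differentiableOn_const _)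
          fun t ht => (hd' t ht).1.differentiableWithinAt).pow n) fun t ht =>
            pow_ne_zero _ (hne t ht θ)
      · exact (hF₁ _ (hqr (sphere_subset_closedBall (hsph θ)))).mono (ball_subset_ball hdr)
    · intro t ht
      refine Continuous.aestronglyMeasurable ?_
      have h1 : Continuous fun θ : ℝ => F t (circleMap (ψ t₀) q θ) :=
        (hF₂ t (ball_subset_ball hdr ht)).continuousOn.comp_continuous
          (continuous_circleMap _ _) fun θ => hqr (sphere_subset_closedBall (hsph θ))
      have h2 : Continuous fun θ : ℝ => ((circleMap (ψ t₀) q θ - ψ t) ^ n)⁻¹ :=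
        ((((continuous_circleMap _ _).sub continuous_const).pow n)).inv₀ fun θ =>
          pow_ne_zero _ (hne t ht θ)
      have h3 : Continuous fun θ : ℝ => deriv (circleMap (ψ t₀) q) θ := by
        simp only [deriv_circleMap]
        exact (continuous_circleMap _ _).mul continuous_const
      exact h3.smul (h2.smul h1)
    · refine Eventually.of_forall fun θ t ht => ?_
      rw [norm_smul, norm_smul, deriv_circleMap, norm_mul, Complex.norm_I, mul_one,
        norm_circleMap_zero, abs_of_pos hq, norm_inv, norm_pow]
      have := hM t (ball_subset_ball hdr ht) _ (hqr (sphere_subset_closedBall (hsph θ)))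
      have h4 := hlow t ht θ
      gcongr
    · exact integrableOn_const (by simp [ENNReal.mul_eq_top])
  have hin : ∀ t ∈ ball t₀ d, ψ t ∈ ball (ψ t₀) q := fun t ht =>
    ball_subset_ball (by linarith) (hd' t ht).2
  have hdF : ∀ t ∈ ball t₀ d, DifferentiableOn ℂ (F t) (ball (ψ t₀) r) := fun t ht =>
    (hF₂ t (ball_subset_ball hdr ht)).mono ball_subset_closedBall
  constructor
  · refine ((key 1).const_smul (2 * Real.pi * Complex.I : ℂ)⁻¹).congr_of_eventuallyEq ?_
    filter_upwards [ball_mem_nhds t₀ hd] with t ht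
    have := ((hdF t ht).diffContOnCl_ball hqr').two_pi_i_inv_smul_circleIntegral_sub_inv_smul
      (hin t ht)
    simpa using this.symm
  · refine ((key 2).const_smul (2 * Real.pi * Complex.I : ℂ)⁻¹).congr_of_eventuallyEq ?_
    filter_upwards [ball_mem_nhds t₀ hd] with t ht
    exact (Complex.two_pi_I_inv_smul_circleIntegral_sub_sq_inv_smul_of_differentiable
      isOpen_ball hqr' (hdF t ht) (hin t ht)).symm

/-! ### Laplace transforms along vertical rays -/

/-- The Laplace transform of `F` along the upward vertical ray from `z`. -/
noncomputable def verticalIntegral (l : ℝ) (F : ℂ → ℂ) (z : ℂ) : ℂ :=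
  ∫ s in Ioi (0 : ℝ), Complex.exp (-(l * s)) * F (z + s * Complex.I)

/-- On a vertical ray `d/ds = i d/dz`, so the differentiated integral can be integrated by parts in
`s`. The bound has the form `c z * b s` with `c` continuous, which makes it locally uniform in `z`.
-/
theorem hasDerivAt_verticalIntegral {U : Set ℂ} (hU : IsOpen U)
    (hup : ∀ z ∈ U, ∀ s : ℝ, 0 ≤ s → z + s * Complex.I ∈ U) {F : ℂ → ℂ}
    (hF : DifferentiableOn ℂ F U) (l : ℝ) {c : ℂ → ℝ} (hc : ContinuousOn c U) {b : ℝ → ℝ}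
    (hb : IntegrableOn b (Ioi 0)) (hb₀ : ∀ s, 0 ≤ s → 0 ≤ b s) (hbt : Tendsto b atTop (𝓝 0))
    (hbd : ∀ z ∈ U, ∀ s : ℝ, 0 ≤ s →
      ‖Complex.exp (-(l * s)) * F (z + s * Complex.I)‖ ≤ c z * b s) {z : ℂ} (hz : z ∈ U) :
    HasDerivAt (verticalIntegral l F)
      (Complex.I * F z - Complex.I * l * verticalIntegral l F z) z := by
  unfold verticalIntegral
  have hcont : ∀ z ∈ U, ContinuousOn
      (fun s : ℝ => Complex.exp (-(l * s)) * F (z + s * Complex.I)) (Ici 0) := fun z hz => by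
    refine ContinuousOn.mul (by fun_prop) ?_
    exact hF.continuousOn.comp (by fun_prop) fun s hs => hup z hz s hs
  obtain ⟨r, hr, hrU⟩ : ∃ r > 0, ∀ y ∈ ball z r, y ∈ U ∧ c y ≤ c z + 1 := by
    have h1 : ∀ᶠ y in 𝓝 z, c y < c z + 1 :=
      (hc.continuousAt (hU.mem_nhds hz)).eventually_lt continuousAt_const (by linarith)
    obtain ⟨r, hr, h⟩ := Metric.eventually_nhds_iff_ball.1 ((hU.eventually_mem hz).and h1)
    exact ⟨r, hr, fun y hy => ⟨(h y hy).1, (h y hy).2.le⟩⟩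
  have hmeas : ∀ z ∈ U, AEStronglyMeasurable
      (fun s : ℝ => Complex.exp (-(l * s)) * F (z + s * Complex.I)) (volume.restrict (Ioi 0)) :=
    fun z hz => ((hcont z hz).mono Ioi_subset_Ici_self).aestronglyMeasurable measurableSet_Ioi
  have hint : IntegrableOn
      (fun s : ℝ => Complex.exp (-(l * s)) * F (z + s * Complex.I)) (Ioi 0) := by
    refine (hb.const_mul (c z)).mono' (hmeas z hz) ?_
    exact (ae_restrict_mem measurableSet_Ioi).mono fun s hs => hbd z hz s (le_of_lt hs)
  have hdz : ∀ y ∈ U, ∀ s : ℝ, 0 ≤ s →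
      HasDerivAt (fun y => Complex.exp (-(l * s)) * F (y + s * Complex.I))
        (Complex.exp (-(l * s)) * deriv F (y + s * Complex.I)) y := fun y hy s hs => by
    have h1 := (hF.differentiableAt (hU.mem_nhds (hup y hy s hs))).hasDerivAt
    exact (h1.comp_add_const y _).const_mul _
  obtain ⟨hi', hD⟩ := hasDerivAt_integral_of_dominated (ν := volume.restrict (Ioi (0 : ℝ)))
    (F := fun z s => Complex.exp (-(l * s)) * F (z + s * Complex.I)) hr
    (bound := fun s => (c z + 1) * b s)
    ((ae_restrict_mem measurableSet_Ioi).mono fun s hs y hy =>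
      (hdz y (hrU y hy).1 s (le_of_lt hs)).differentiableAt.differentiableWithinAt)
    (fun y hy => hmeas y (hrU y hy).1)
    ((ae_restrict_mem measurableSet_Ioi).mono fun s hs y hy =>
      (hbd y (hrU y hy).1 s (le_of_lt hs)).trans
        (mul_le_mul_of_nonneg_right (hrU y hy).2 (hb₀ s (le_of_lt hs))))
    (hb.const_mul _)
  convert hD using 1
  have hds : ∀ s ∈ Ioi (0 : ℝ), HasDerivAt
      (fun s : ℝ => Complex.exp (-(l * s)) * F (z + s * Complex.I))
      (-l * (Complex.exp (-(l * s)) * F (z + s * Complex.I)) +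
        Complex.I * deriv (fun y => Complex.exp (-(l * s)) * F (y + s * Complex.I)) z) s := by
    intro s hs
    have hs0 : 0 ≤ s := le_of_lt hs
    have h1 := (hF.differentiableAt (hU.mem_nhds (hup z hz s hs0))).hasDerivAt
    have h2 : HasDerivAt (fun s : ℝ => z + s * Complex.I) Complex.I s := by
      simpa using ((Complex.ofRealCLM.hasDerivAt (x := s)).mul_const Complex.I).const_add z
    have h3 : HasDerivAt (fun s : ℝ => Complex.exp (-((l : ℂ) * s)))
        (Complex.exp (-((l : ℂ) * s)) * (-l)) s := by
      have : HasDerivAt (fun s : ℝ => -((l : ℂ) * s)) (-l) s := by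
        simpa using ((Complex.ofRealCLM.hasDerivAt (x := s)).const_mul (l : ℂ)).fun_neg
      exact this.cexp
    rw [(hdz z hz s hs0).deriv]
    refine (h3.fun_mul (h1.scomp s h2)).congr_deriv ?_
    simp only [smul_eq_mul, Function.comp]
    ring
  -- The total `s`-derivative of the integrand integrates to minus its value at `s = 0`. Solving
  -- this relation for the integral of the `z`-derivative gives the formula.
  have hFTC := integral_Ioi_of_hasDerivAt_of_tendsto (m := 0)
    (hcont z hz 0 self_mem_Ici) hds ((hint.const_mul _).add (hi'.const_mul _)) ?_
  · rw [integral_add (hint.const_mul _) (hi'.const_mul _), integral_const_mul,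
      integral_const_mul] at hFTC
    simp only [Complex.ofReal_zero, mul_zero, neg_zero, Complex.exp_zero, zero_mul, add_zero,
      one_mul, zero_sub] at hFTC
    linear_combination (Complex.I) * hFTC -
      (∫ s in Ioi (0 : ℝ), deriv (fun y => Complex.exp (-(l * s)) * F (y + s * Complex.I)) z) *
        Complex.I_mul_I
  · refine squeeze_zero_norm' (a := fun s => c z * b s) ?_ (by simpa using hbt.const_mul (c z))
    exact (eventually_ge_atTop 0).mono fun s hs => hbd z hz s hs

/-! ### Primitives along rays from the origin -/

/-- The primitive along rays from the origin. -/
theorem hasDerivAt_radial_primitive {R : ℝ} {F : ℂ → ℂ} (hF : DifferentiableOn ℂ F (ball 0 R))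
    {z : ℂ} (hz : z ∈ ball (0 : ℂ) R) :
    HasDerivAt (fun z => z * ∫ t in (0 : ℝ)..1, F (t * z)) (F z) z := by
  simp only [intervalIntegral.integral_of_le zero_le_one]
  have hstar : ∀ R' : ℝ, ∀ y ∈ closedBall (0 : ℂ) R', ∀ t ∈ Ioc (0 : ℝ) 1,
      (t : ℂ) * y ∈ closedBall (0 : ℂ) R' := fun R' y hy t ht => by
    rw [mem_closedBall_zero_iff] at hy ⊢
    rw [norm_mul, Complex.norm_real, Real.norm_eq_abs, abs_of_pos ht.1]
    nlinarith [ht.1, ht.2, norm_nonneg y]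
  have hzR : ‖z‖ < R := by simpa using hz
  obtain ⟨r, hr⟩ : ∃ r, r = (R - ‖z‖) / 2 := ⟨_, rfl⟩
  have hr0 : 0 < r := by linarith
  have hsub : closedBall (0 : ℂ) (R - r) ⊆ ball 0 R := closedBall_subset_ball (by linarith)
  have hball : ball z r ⊆ closedBall 0 (R - r) := fun y hy => by
    rw [mem_ball_iff_norm] at hy
    rw [mem_closedBall_zero_iff]
    have := norm_le_norm_add_norm_sub' y z
    linarith
  obtain ⟨M, hM⟩ := (isCompact_closedBall (0 : ℂ) (R - r)).exists_bound_of_continuousOn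
    (hF.continuousOn.mono hsub)
  have hcont : ∀ y ∈ ball z r, ContinuousOn (fun t : ℝ => F (t * y)) (Icc 0 1) := fun y hy =>
    hF.continuousOn.comp (by fun_prop) fun t ht => hsub (by
      rcases ht.1.eq_or_lt with rfl | h
      · have := hball hy
        rw [mem_closedBall_zero_iff] at this
        simpa using (norm_nonneg y).trans this
      · exact hstar _ y (hball hy) t ⟨h, ht.2⟩)
  have hdz : ∀ y ∈ ball z r, ∀ t ∈ Ioc (0 : ℝ) 1,
      HasDerivAt (fun y : ℂ => F (t * y)) (t * deriv F (t * y)) y := fun y hy t ht => by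
    have h1 := (hF.differentiableAt
      (isOpen_ball.mem_nhds (hsub (hstar _ y (hball hy) t ht)))).hasDerivAt
    have h2 : HasDerivAt (fun y : ℂ => (t : ℂ) * y) t y := by
      simpa using (hasDerivAt_id y).const_mul (t : ℂ)
    exact (h1.comp y h2).congr_deriv (mul_comm _ _)
  have hzb : z ∈ ball z r := mem_ball_self hr0
  obtain ⟨hi', hD⟩ := hasDerivAt_integral_of_dominated
    (ν := volume.restrict (Ioc (0 : ℝ) 1)) (F := fun z t => F (t * z)) hr0 (bound := fun _ => M)
    ((ae_restrict_mem measurableSet_Ioc).mono fun t ht y hy =>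
      (hdz y hy t ht).differentiableAt.differentiableWithinAt)
    (fun y hy => ((hcont y hy).mono Ioc_subset_Icc_self).aestronglyMeasurable measurableSet_Ioc)
    ((ae_restrict_mem measurableSet_Ioc).mono fun t ht y hy => hM _ (hstar _ y (hball hy) t ht))
    (integrableOn_const (by simp))
  refine ((hasDerivAt_id z).fun_mul hD).congr_deriv ?_
  have hint : IntegrableOn (fun t : ℝ => F (t * z)) (Ioc 0 1) :=
    ((hcont z hzb).integrableOn_Icc).mono_set Ioc_subset_Icc_self
  -- The product rule yields the integral of `F(tz) + tz F'(tz)`, which is the `t`-derivative of `t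
  -- F(tz)`.
  have hFTC := intervalIntegral.integral_eq_sub_of_hasDeriv_right_of_le zero_le_one
    (f := fun t : ℝ => t * F (t * z))
    (f' := fun t : ℝ => F (t * z) + z * deriv (fun y : ℂ => F (t * y)) z)
    ((Complex.continuous_ofReal.continuousOn).mul (hcont z hzb)) (fun t ht => ?_)
    ((intervalIntegrable_iff_integrableOn_Ioc_of_le zero_le_one).2
      (hint.add (hi'.const_mul _)))
  · rw [intervalIntegral.integral_of_le zero_le_one, integral_add hint (hi'.const_mul _),
      integral_const_mul] at hFTC
    simpa using hFTC
  · have ht' : t ∈ Ioc (0 : ℝ) 1 := ⟨ht.1, ht.2.le⟩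
    have h1 := (hF.differentiableAt
      (isOpen_ball.mem_nhds (hsub (hstar _ z (hball hzb) t ht')))).hasDerivAt
    have h2 : HasDerivAt (fun t : ℝ => (t : ℂ) * z) z t := by
      simpa using (Complex.ofRealCLM.hasDerivAt (x := t)).mul_const z
    have h3 : HasDerivAt (fun t : ℝ => (t : ℂ)) 1 t := Complex.ofRealCLM.hasDerivAt
    rw [(hdz z hzb t ht').deriv]
    refine ((h3.fun_mul (h1.scomp t h2)).congr_deriv ?_).hasDerivWithinAt
    simp only [smul_eq_mul, Function.comp]
    ring

/-- The primitive of `F` vanishing at the origin, as an integral along rays. -/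
noncomputable def radialPrimitive (F : ℂ → ℂ) (z : ℂ) : ℂ := z * ∫ t in (0 : ℝ)..1, F (t * z)

theorem hasDerivAt_radialPrimitive {F : ℂ → ℂ} (hF : Differentiable ℂ F) (z : ℂ) :
    HasDerivAt (radialPrimitive F) (F z) z :=
  hasDerivAt_radial_primitive (R := ‖z‖ + 1) hF.differentiableOn (by simp)

theorem radialPrimitive_zero (F : ℂ → ℂ) : radialPrimitive F 0 = 0 := by simp [radialPrimitive]

/-- Integrating `t ^ m` over `[0, 1]` supplies the factor `1/(m+1)`. This is the source of the
factorials that make the Picard series converge everywhere. -/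
theorem norm_radialPrimitive_le {F : ℂ → ℂ} {z : ℂ} {A : ℝ} {m : ℕ}
    (hF : ∀ y, ‖y‖ ≤ ‖z‖ → ‖F y‖ ≤ A * (‖y‖ ^ m / m.factorial)) :
    ‖radialPrimitive F z‖ ≤ A * (‖z‖ ^ (m + 1) / (m + 1).factorial) := by
  have h1 : ‖∫ t in (0 : ℝ)..1, F (t * z)‖ ≤
      ∫ t in (0 : ℝ)..1, t ^ m * (A * (‖z‖ ^ m / m.factorial)) := by
    refine intervalIntegral.norm_integral_le_of_norm_le zero_le_one
      (Eventually.of_forall fun t ht => ?_) (Continuous.intervalIntegrable (by fun_prop) _ _)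
    have hn : ‖(t : ℂ) * z‖ = t * ‖z‖ := by
      rw [norm_mul, Complex.norm_real, Real.norm_eq_abs, abs_of_pos ht.1]
    refine (hF _ (by rw [hn]; nlinarith [ht.2, norm_nonneg z])).trans_eq ?_
    rw [hn]; ring
  rw [intervalIntegral.integral_mul_const, integral_pow] at h1
  rw [radialPrimitive, norm_mul]
  refine (mul_le_mul_of_nonneg_left h1 (norm_nonneg z)).trans_eq ?_
  rw [Nat.factorial_succ]
  push_cast
  have : (m.factorial : ℝ) ≠ 0 := by positivity
  have : (m : ℝ) + 1 ≠ 0 := by positivity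
  simp
  field_simp
  ring

theorem differentiable_radialPrimitive_param {F : ℂ → ℂ → ℂ} (hF₁ : ∀ k, Continuous (F k))
    (hF₂ : ∀ z, Differentiable ℂ fun k => F k z)
    (hF₃ : ∀ r : ℝ, ∃ M : ℝ, ∀ k z : ℂ, ‖k‖ ≤ r → ‖z‖ ≤ r → ‖F k z‖ ≤ M) (z : ℂ) :
    Differentiable ℂ fun k => radialPrimitive (F k) z := by
  intro k₀
  obtain ⟨M, hM⟩ := hF₃ (‖k₀‖ + 1 + ‖z‖)
  refine DifferentiableAt.const_mul ?_ z
  simp only [intervalIntegral.integral_of_le zero_le_one]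
  refine differentiableAt_integral_of_dominated one_pos (bound := fun _ => M)
    (Eventually.of_forall fun t => (hF₂ _).differentiableOn)
    (fun k _ => Continuous.aestronglyMeasurable ((hF₁ k).comp (by fun_prop)))
    ((ae_restrict_mem measurableSet_Ioc).mono fun t ht k hk => hM _ _ ?_ ?_)
    (integrableOn_const (by simp))
  · rw [mem_ball_iff_norm] at hk
    have := norm_le_norm_add_norm_sub' k k₀
    linarith [norm_nonneg z]
  · rw [norm_mul, Complex.norm_real, Real.norm_eq_abs, abs_of_pos ht.1]
    nlinarith [ht.2, norm_nonneg z, norm_nonneg k₀]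

/-! ### Entire solutions by Picard iteration -/

/-- The Picard iterates for `v'' = -q v`. -/
noncomputable def picardTerm (q : ℂ → ℂ → ℂ) (f : ℂ → ℂ) : ℕ → ℂ → ℂ → ℂ
  | 0, _ => f
  | n + 1, k => fun z =>
      -radialPrimitive (radialPrimitive fun y => q k y * picardTerm q f n k y) z

section Picard

variable {q : ℂ → ℂ → ℂ} {f : ℂ → ℂ}

theorem differentiable_picardTerm (hq : ∀ k, Differentiable ℂ (q k)) (hf : Differentiable ℂ f)
    (n : ℕ) (k : ℂ) : Differentiable ℂ (picardTerm q f n k) := by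
  induction n with
  | zero => exact hf
  | succ n ih =>
    have h1 : Differentiable ℂ (radialPrimitive fun y => q k y * picardTerm q f n k y) :=
      fun z => (hasDerivAt_radialPrimitive ((hq k).mul ih) z).differentiableAt
    exact fun z => (hasDerivAt_radialPrimitive h1 z).neg.differentiableAt

theorem hasDerivAt_picardTerm_succ (hq : ∀ k, Differentiable ℂ (q k)) (hf : Differentiable ℂ f)
    (n : ℕ) (k z : ℂ) : HasDerivAt (picardTerm q f (n + 1) k)
      (-radialPrimitive (fun y => q k y * picardTerm q f n k y) z) z := by
  have h1 : Differentiable ℂ (radialPrimitive fun y => q k y * picardTerm q f n k y) :=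
    fun z => (hasDerivAt_radialPrimitive
      ((hq k).mul (differentiable_picardTerm hq hf n k)) z).differentiableAt
  exact (hasDerivAt_radialPrimitive h1 z).neg

/-- Every iterate integrates twice along rays and multiplies once by `q`, hence `N ^ n` against `(2
* n)!`. -/
theorem norm_picardTerm_le {r N A : ℝ} {k : ℂ} (hN : ∀ z, ‖z‖ ≤ r → ‖q k z‖ ≤ N)
    (hA : ∀ z, ‖z‖ ≤ r → ‖f z‖ ≤ A) (hN₀ : 0 ≤ N) (n : ℕ) (z : ℂ) (hz : ‖z‖ ≤ r) :
    ‖picardTerm q f n k z‖ ≤ A * N ^ n * (‖z‖ ^ (2 * n) / (2 * n).factorial) := by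
  induction n generalizing z with
  | zero => simpa [picardTerm] using hA z hz
  | succ n ih =>
    rw [picardTerm, norm_neg]
    refine norm_radialPrimitive_le fun y hy => norm_radialPrimitive_le fun x hx => ?_
    have hxr : ‖x‖ ≤ r := hx.trans (hy.trans hz)
    rw [norm_mul]
    calc ‖q k x‖ * ‖picardTerm q f n k x‖ ≤ N * (A * N ^ n * (‖x‖ ^ (2 * n) / (2 * n).factorial)) :=
          mul_le_mul (hN x hxr) (ih x hxr) (norm_nonneg _) hN₀
      _ = _ := by simp only [Nat.mul_eq]; ring

/-- These are, up to the factor `A`, the even terms of the exponential series at `√N * r`. -/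
theorem summable_picard_bound (A N r : ℝ) (hN : 0 ≤ N) :
    Summable fun n : ℕ => A * N ^ n * (r ^ (2 * n) / (2 * n).factorial) := by
  have h1 := (Real.summable_pow_div_factorial (√N * r)).comp_injective
    (i := fun n : ℕ => 2 * n) (fun a b h => by simpa using h)
  refine (h1.mul_left A).congr fun n => ?_
  simp only [Function.comp, mul_pow, pow_mul, Real.sq_sqrt hN]
  ring

theorem differentiable_picardTerm_param (hq : ∀ k, Differentiable ℂ (q k))
    (hq' : ∀ z, Differentiable ℂ fun k => q k z)
    (hqb : ∀ r : ℝ, ∃ M : ℝ, ∀ k z : ℂ, ‖k‖ ≤ r → ‖z‖ ≤ r → ‖q k z‖ ≤ M)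
    (hf : Differentiable ℂ f) (n : ℕ) (z : ℂ) :
    Differentiable ℂ fun k => picardTerm q f n k z := by
  have hfb : ∀ r : ℝ, ∃ A : ℝ, ∀ z, ‖z‖ ≤ r → ‖f z‖ ≤ A := fun r => by
    obtain ⟨A, hA⟩ := (isCompact_closedBall (0 : ℂ) r).exists_bound_of_continuousOn
      hf.continuous.continuousOn
    exact ⟨A, fun z hz => hA z (by simpa using hz)⟩
  induction n generalizing z with
  | zero => exact differentiable_const _
  | succ n ih =>
    have hb : ∀ r : ℝ, ∃ M : ℝ, ∀ k z : ℂ, ‖k‖ ≤ r → ‖z‖ ≤ r →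
        ‖q k z * picardTerm q f n k z‖ ≤ M * (‖z‖ ^ 0 / (0).factorial) := fun r => by
      obtain ⟨M, hM⟩ := hqb r
      obtain ⟨A, hA⟩ := hfb r
      refine ⟨|M| * (|A| * |M| ^ n * (|r| ^ (2 * n) / (2 * n).factorial)), fun k z hk hz => ?_⟩
      have h1 := norm_picardTerm_le (f := f) (q := q) (k := k) (N := |M|) (A := |A|)
        (fun z hz => (hM k z hk hz).trans (le_abs_self _))
        (fun z hz => (hA z hz).trans (le_abs_self _)) (abs_nonneg _) n z hz
      have h2 := (hM k z hk hz).trans (le_abs_self _)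
      have h3 := hz.trans (le_abs_self _)
      rw [norm_mul]
      simp only [pow_zero, Nat.factorial_zero, Nat.cast_one, div_one, mul_one]
      refine mul_le_mul h2 (h1.trans ?_) (norm_nonneg _) (abs_nonneg _)
      gcongr
    have hd : ∀ k, Differentiable ℂ fun y => q k y * picardTerm q f n k y := fun k =>
      (hq k).mul (differentiable_picardTerm hq hf n k)
    have h1 : ∀ z, Differentiable ℂ fun k =>
        radialPrimitive (fun y => q k y * picardTerm q f n k y) z :=
      differentiable_radialPrimitive_param (F := fun k y => q k y * picardTerm q f n k y)
        (fun k => (hd k).continuous) (fun z => (hq' z).mul (ih z)) (by simpa using hb)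
    refine (differentiable_radialPrimitive_param
      (F := fun k => radialPrimitive fun y => q k y * picardTerm q f n k y)
      (fun k => ?_) h1 (fun r => ?_) z).neg
    · exact Differentiable.continuous (𝕜 := ℂ)
        fun z => (hasDerivAt_radialPrimitive (hd k) z).differentiableAt
    · obtain ⟨M, hM⟩ := hb r
      refine ⟨|M| * |r|, fun k z hk hz => (norm_radialPrimitive_le
        fun y hy => hM k y hk (hy.trans hz)).trans ?_⟩
      simp only [zero_add, pow_one, Nat.factorial_one, Nat.cast_one, div_one]
      have := le_abs_self M
      have := hz.trans (le_abs_self r)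
      gcongr

/-- Weierstrass' theorem applied twice: locally uniform convergence of holomorphic functions passes
to derivatives. -/
theorem hasSum_deriv_deriv_of_summable_norm {F : ℕ → ℂ → ℂ} {U : Set ℂ} {u : ℕ → ℝ}
    (hu : Summable u) (hF : ∀ n, DifferentiableOn ℂ (F n) U) (hU : IsOpen U)
    (hb : ∀ n, ∀ z ∈ U, ‖F n z‖ ≤ u n) {z : ℂ} (hz : z ∈ U) :
    HasSum (fun n => deriv (deriv (F n)) z) (deriv (deriv fun w => ∑' n, F n w) z) := by
  have hc := (tendstoUniformlyOn_tsum hu hb).tendstoLocallyUniformlyOn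
  have hd : ∀ s : Finset ℕ, DifferentiableOn ℂ (fun w => ∑ n ∈ s, F n w) U :=
    fun s => DifferentiableOn.fun_sum fun n _ => hF n
  have h1 := (hc.deriv (Eventually.of_forall hd) hU).deriv
    (Eventually.of_forall fun s => (hd s).deriv hU) hU
  refine (h1.tendsto_at hz).congr fun s => ?_
  have h2 : ∀ y ∈ U, deriv (fun w => ∑ n ∈ s, F n w) y = ∑ n ∈ s, deriv (F n) y := fun y hy =>
    deriv_fun_sum fun n _ => (hF n).differentiableAt (hU.mem_nhds hy)
  have h3 : deriv (fun w => ∑ n ∈ s, F n w) =ᶠ[𝓝 z] fun y => ∑ n ∈ s, deriv (F n) y :=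
    eventually_of_mem (hU.mem_nhds hz) h2
  simp only [Function.comp]
  rw [h3.deriv_eq]
  exact deriv_fun_sum fun n _ => ((hF n).deriv hU).differentiableAt (hU.mem_nhds hz)

/-- The Picard series is dominated uniformly for bounded `k` and `z`, so it is holomorphic in each
variable separately and bounded on bounded sets. These are the properties that
`differentiableAt_comp_graph` requires later. -/
theorem exists_entire_solution (hq : ∀ k, Differentiable ℂ (q k))
    (hq' : ∀ z, Differentiable ℂ fun k => q k z)
    (hqb : ∀ r : ℝ, ∃ M : ℝ, ∀ k z : ℂ, ‖k‖ ≤ r → ‖z‖ ≤ r → ‖q k z‖ ≤ M) (a b : ℂ) :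
    ∃ v : ℂ → ℂ → ℂ, (∀ k, Differentiable ℂ (v k)) ∧ (∀ z, Differentiable ℂ fun k => v k z) ∧
      (∀ r : ℝ, ∃ M : ℝ, ∀ k z : ℂ, ‖k‖ ≤ r → ‖z‖ ≤ r → ‖v k z‖ ≤ M) ∧
      (∀ k z, deriv (deriv (v k)) z = -(q k z * v k z)) ∧
      ∀ k, v k 0 = a ∧ deriv (v k) 0 = b := by
  obtain ⟨f, hf⟩ : ∃ f : ℂ → ℂ, f = fun z => a + b * z := ⟨_, rfl⟩
  have hfd : Differentiable ℂ f := by rw [hf]; fun_prop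
  have hfd' : ∀ z, deriv f z = b := fun z => by
    rw [hf]; simp
  have hbound : ∀ r : ℝ, ∃ u : ℕ → ℝ, Summable u ∧ ∀ n k z, ‖k‖ ≤ r → ‖z‖ ≤ r →
      ‖picardTerm q f n k z‖ ≤ u n := fun r => by
    obtain ⟨M, hM⟩ := hqb r
    obtain ⟨A, hA⟩ := (isCompact_closedBall (0 : ℂ) r).exists_bound_of_continuousOn
      hfd.continuous.continuousOn
    refine ⟨_, summable_picard_bound |A| |M| |r| (abs_nonneg _), fun n k z hk hz => ?_⟩
    refine (norm_picardTerm_le (N := |M|) (A := |A|)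
      (fun z hz => (hM k z hk hz).trans (le_abs_self _))
      (fun z hz => (hA z (by simpa using hz)).trans (le_abs_self _)) (abs_nonneg _) n z hz).trans ?_
    have := hz.trans (le_abs_self r)
    gcongr
  have hdt : ∀ n k, Differentiable ℂ (picardTerm q f n k) := differentiable_picardTerm hq hfd
  have hball : ∀ k z : ℂ, z ∈ ball (0 : ℂ) (‖k‖ + ‖z‖ + 1) := fun k z => by
    rw [mem_ball_zero_iff]; linarith [norm_nonneg k]
  have hts : ∀ k z, HasSum (fun n => picardTerm q f n k z) (∑' n, picardTerm q f n k z) :=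
    fun k z => by
    obtain ⟨u, hu, hu'⟩ := hbound (‖k‖ + ‖z‖)
    exact (hu.of_norm_bounded fun n => hu' n k z (by linarith [norm_nonneg z])
      (by linarith [norm_nonneg k])).hasSum
  refine ⟨fun k z => ∑' n, picardTerm q f n k z, fun k z => ?_, fun z k => ?_, fun r => ?_,
    fun k z => ?_, fun k => ⟨?_, ?_⟩⟩
  · obtain ⟨u, hu, hu'⟩ := hbound (‖k‖ + ‖z‖ + 1)
    refine (Complex.differentiableOn_tsum_of_summable_norm hu
      (U := ball 0 (‖k‖ + ‖z‖ + 1)) (fun n => (hdt n k).differentiableOn) isOpen_ball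
      fun n y hy => hu' n k y (by linarith [norm_nonneg z])
        (mem_ball_zero_iff.1 hy).le).differentiableAt (isOpen_ball.mem_nhds (hball k z))
  · obtain ⟨u, hu, hu'⟩ := hbound (‖z‖ + ‖k‖ + 1)
    refine (Complex.differentiableOn_tsum_of_summable_norm hu
      (U := ball 0 (‖z‖ + ‖k‖ + 1)) (F := fun n k => picardTerm q f n k z)
      (fun n => (differentiable_picardTerm_param hq hq' hqb hfd n z).differentiableOn) isOpen_ball
      fun n y hy => hu' n y z (mem_ball_zero_iff.1 hy).le
        (by linarith [norm_nonneg k])).differentiableAt (isOpen_ball.mem_nhds (hball z k))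
  · obtain ⟨u, hu, hu'⟩ := hbound r
    exact ⟨∑' n, u n, fun k z hk hz => tsum_of_norm_bounded hu.hasSum fun n => hu' n k z hk hz⟩
  · obtain ⟨u, hu, hu'⟩ := hbound (‖k‖ + ‖z‖ + 1)
    have h1 := hasSum_deriv_deriv_of_summable_norm hu (F := fun n => picardTerm q f n k)
      (U := ball 0 (‖k‖ + ‖z‖ + 1)) (fun n => (hdt n k).differentiableOn) isOpen_ball
      (fun n y hy => hu' n k y (by linarith [norm_nonneg z]) (mem_ball_zero_iff.1 hy).le)
      (hball k z)
    have h2 : HasSum (fun n => deriv (deriv (picardTerm q f (n + 1) k)) z)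
        (-(q k z * ∑' n, picardTerm q f n k z)) := by
      refine ((hts k z).mul_left (q k z)).neg.congr_fun fun n => ?_
      rw [funext fun y => (hasDerivAt_picardTerm_succ hq hfd n k y).deriv]
      exact (hasDerivAt_radialPrimitive ((hq k).mul (hdt n k)) z).neg.deriv
    -- Each second derivative reproduces the preceding iterate up to the factor `-q`. The shift by
    -- one loses nothing because the first iterate is affine.
    have h3 := (hasSum_nat_add_iff
      (f := fun n => deriv (deriv (picardTerm q f n k)) z) 1).1 h2
    have h4 : deriv (deriv (picardTerm q f 0 k)) z = 0 := by
      have : deriv (picardTerm q f 0 k) = fun _ => b := funext hfd'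
      rw [this, deriv_const]
    rw [Finset.sum_range_one, h4, add_zero] at h3
    exact h1.unique h3
  · show ∑' n, picardTerm q f n k 0 = a
    rw [tsum_eq_single 0]
    · simp [picardTerm, hf]
    · intro n hn
      obtain ⟨m, rfl⟩ := Nat.exists_eq_succ_of_ne_zero hn
      simp [picardTerm, radialPrimitive_zero]
  · obtain ⟨u, hu, hu'⟩ := hbound (‖k‖ + ‖(0 : ℂ)‖ + 1)
    have h1 := Complex.hasSum_deriv_of_summable_norm hu (F := fun n => picardTerm q f n k)
      (U := ball 0 (‖k‖ + ‖(0 : ℂ)‖ + 1)) (fun n => (hdt n k).differentiableOn) isOpen_ball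
      (fun n y hy => hu' n k y (by simp) (mem_ball_zero_iff.1 hy).le) (hball k 0)
    refine h1.unique ?_
    convert hasSum_single 0 ?_ using 1
    · exact (hfd' 0).symm
    · intro n hn
      obtain ⟨m, rfl⟩ := Nat.exists_eq_succ_of_ne_zero hn
      rw [(hasDerivAt_picardTerm_succ hq hfd m k 0).deriv, radialPrimitive_zero, neg_zero]

end Picard

/-! ### The region above a wedge and its logarithm -/

/-- The height `Im z + |Re z|`, which grows at unit speed in the upward direction. -/
def height (z : ℂ) : ℝ := z.im + |z.re|

/-- The region above a wedge, stable under upward translations. -/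
def aboveWedge (R : ℝ) : Set ℂ := {z | R < height z}

theorem continuous_height : Continuous height := by unfold height; fun_prop

theorem isOpen_aboveWedge (R : ℝ) : IsOpen (aboveWedge R) :=
  isOpen_lt continuous_const continuous_height

theorem height_add (z : ℂ) (s : ℝ) : height (z + s * Complex.I) = height z + s := by
  simp [height]; ring

theorem add_mem_aboveWedge {R : ℝ} (z : ℂ) (hz : z ∈ aboveWedge R) (s : ℝ) (hs : 0 ≤ s) :
    z + s * Complex.I ∈ aboveWedge R := by
  have h : R < height z := hz
  show R < height _
  rw [height_add]; linarith

theorem height_le_norm (z : ℂ) : height z ≤ 2 * ‖z‖ := by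
  have h1 := Complex.abs_re_le_norm z
  have h2 := (le_abs_self _).trans (Complex.abs_im_le_norm z)
  unfold height; linarith

theorem ne_zero_of_height_pos {z : ℂ} (hz : 0 < height z) : z ≠ 0 := by
  rintro rfl; simp [height] at hz

/-- The branch of the logarithm on the plane slit along the negative imaginary half-line. -/
noncomputable def upperLog (z : ℂ) : ℂ := Complex.log (-Complex.I * z) + Real.pi / 2 * Complex.I

theorem neg_I_mul_mem_slitPlane {z : ℂ} (hz : 0 < height z) :
    -Complex.I * z ∈ Complex.slitPlane := by
  rw [Complex.mem_slitPlane_iff]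
  simp only [height] at hz
  by_cases h : 0 < z.im
  · left; simpa using h
  · right
    intro h0
    have : z.re = 0 := by simpa using h0
    rw [this, abs_zero] at hz
    linarith

theorem hasDerivAt_upperLog {z : ℂ} (hz : 0 < height z) : HasDerivAt upperLog z⁻¹ z := by
  have h1 : HasDerivAt (fun z : ℂ => -Complex.I * z) (-Complex.I) z := by
    simpa using (hasDerivAt_id z).const_mul (-Complex.I)
  refine ((h1.clog (neg_I_mul_mem_slitPlane hz)).add_const _).congr_deriv ?_
  have := ne_zero_of_height_pos hz
  have := Complex.I_ne_zero
  field_simp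

theorem exp_upperLog {z : ℂ} (hz : z ≠ 0) : Complex.exp (upperLog z) = z := by
  rw [upperLog, Complex.exp_add, Complex.exp_log (by simpa using hz), Complex.exp_mul_I]
  rw [← Complex.ofReal_ofNat, ← Complex.ofReal_div, ← Complex.ofReal_cos, ← Complex.ofReal_sin]
  simp
  linear_combination -z * Complex.I_mul_I

/-- This range of imaginary parts contains `[0, π]` with a margin on both sides, enough for `Im κ +
arg(x+1)` along the rays considered. -/
theorem upperLog_exp {ζ : ℂ} (h₁ : -(Real.pi / 2) < ζ.im) (h₂ : ζ.im ≤ 3 * Real.pi / 2) :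
    upperLog (Complex.exp ζ) = ζ := by
  have h : -Complex.I * Complex.exp ζ = Complex.exp (ζ - Real.pi / 2 * Complex.I) := by
    rw [Complex.exp_sub, Complex.exp_mul_I]
    rw [← Complex.ofReal_ofNat, ← Complex.ofReal_div, ← Complex.ofReal_cos, ← Complex.ofReal_sin]
    simp
    ring
  have him : (ζ - Real.pi / 2 * Complex.I).im = ζ.im - Real.pi / 2 := by
    rw [← Complex.ofReal_ofNat, ← Complex.ofReal_div, Complex.sub_im, Complex.im_ofReal_mul]
    simp
  rw [upperLog, h, Complex.log_exp (by rw [him]; linarith) (by rw [him]; linarith)]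
  ring

/-- Mean value inequality for the derivative `1/y`: all points `y` on the ray above `z` satisfy `‖y‖
≥ height z / 2`. -/
theorem norm_upperLog_sub_le {z : ℂ} (hz : 0 < height z) {s : ℝ} (hs : 0 ≤ s) :
    ‖upperLog (z + s * Complex.I) - upperLog z‖ ≤ 2 / height z * s := by
  have hd : ∀ t ∈ Icc 0 s, HasDerivWithinAt (fun t : ℝ => upperLog (z + t * Complex.I))
      (Complex.I * (z + t * Complex.I)⁻¹) (Icc 0 s) t := fun t ht => by
    have h2 : HasDerivAt (fun s : ℝ => z + s * Complex.I) Complex.I t := by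
      simpa using ((Complex.ofRealCLM.hasDerivAt (x := t)).mul_const Complex.I).const_add z
    have h1 : HasDerivAt upperLog (z + t * Complex.I)⁻¹ (z + t * Complex.I) :=
      hasDerivAt_upperLog (by rw [height_add]; linarith [ht.1])
    exact (h1.scomp t h2).hasDerivWithinAt
  have := norm_image_sub_le_of_norm_deriv_le_segment' hd (C := 2 / height z) (fun t ht => ?_) s
    (right_mem_Icc.2 hs)
  · simpa using this
  · have h1 := height_le_norm (z + t * Complex.I)
    rw [height_add] at h1
    have h3 : 0 < ‖z + t * Complex.I‖ := by linarith [ht.1]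
    rw [norm_mul, Complex.norm_I, one_mul, norm_inv, inv_eq_one_div, div_le_div_iff₀ h3 hz]
    linarith [ht.1]

/-! ### The Volterra operator for the Jost amplitude -/

theorem integrable_inv_add_sq {r : ℝ} (hr : 0 < r) :
    IntegrableOn (fun s : ℝ => ((r + s) ^ 2)⁻¹) (Ioi 0) ∧
      ∫ s in Ioi (0 : ℝ), ((r + s) ^ 2)⁻¹ = r⁻¹ := by
  have hd : ∀ s ∈ Ici (0 : ℝ), HasDerivAt (fun s : ℝ => -(r + s)⁻¹) ((r + s) ^ 2)⁻¹ s :=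
    fun s hs => by
    have h0 : r + s ≠ 0 := by have := mem_Ici.1 hs; positivity
    refine (((hasDerivAt_id s).const_add r).inv h0).neg.congr_deriv ?_
    simp [neg_div]
  have ht : Tendsto (fun s : ℝ => -(r + s)⁻¹) atTop (𝓝 0) := by
    simpa using (tendsto_inv_atTop_zero.comp (tendsto_atTop_add_const_left _ r tendsto_id)).neg
  refine ⟨integrableOn_Ioi_deriv_of_nonneg' hd (fun s _ => by positivity) ht, ?_⟩
  rw [integral_Ioi_of_hasDerivAt_of_nonneg' hd (fun s _ => by positivity) ht]
  simp

theorem integral_exp_neg_half :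
    IntegrableOn (fun s : ℝ => Real.exp (-(1 / 2) * s)) (Ioi 0) ∧
      ∫ s in Ioi (0 : ℝ), Real.exp (-(1 / 2) * s) = 2 :=
  ⟨integrableOn_exp_mul_Ioi (by norm_num) 0, by
    rw [integral_exp_mul_Ioi (by norm_num)]; norm_num⟩

theorem norm_verticalIntegral_le {l : ℝ} {F : ℂ → ℂ} {z : ℂ} {b : ℝ → ℝ} {c : ℝ}
    (hb : IntegrableOn b (Ioi 0))
    (h : ∀ s : ℝ, 0 ≤ s → ‖Complex.exp (-(l * s)) * F (z + s * Complex.I)‖ ≤ c * b s) :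
    ‖verticalIntegral l F z‖ ≤ c * ∫ s in Ioi (0 : ℝ), b s := by
  rw [← integral_const_mul]
  exact norm_integral_le_of_norm_le (hb.const_mul c)
    ((ae_restrict_mem measurableSet_Ioi).mono fun s hs => h s (le_of_lt hs))

/-- The derivative of `jostStep`. -/
noncomputable def jostStepDeriv (a : ℂ) (V m : ℂ → ℂ) (z : ℂ) : ℂ :=
  Complex.I * (Complex.exp (-(2 * Complex.I * a * upperLog z)) *
    verticalIntegral 1 (fun y => Complex.exp (2 * Complex.I * a * upperLog y) * (V y * m y)) z)

/-- The Volterra operator whose fixed points, up to the constant `1`, solve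
`m'' + (i + 2ia/z) m' + V m = 0`. -/
noncomputable def jostStep (a : ℂ) (V m : ℂ → ℂ) (z : ℂ) : ℂ :=
  -Complex.I * verticalIntegral 0 (jostStepDeriv a V m) z

section JostStep

variable {a : ℂ} {V m : ℂ → ℂ} {B R N : ℝ}

/-- Going up by `s` changes the exponent by at most `(4B/height z) s`, and `8B ≤ R` makes this at
most `s/2`. Half of the decay of `exp(-s)` in the kernel therefore survives the power `z^(2ia)`. -/
theorem norm_exp_upperLog_le (hB : 0 ≤ B) (hR : 0 < R) (hBR : 8 * B ≤ R) (ha : ‖a‖ ≤ B)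
    {z : ℂ} (hz : z ∈ aboveWedge R) {s : ℝ} (hs : 0 ≤ s) :
    ‖Complex.exp (2 * Complex.I * a * upperLog (z + s * Complex.I))‖ ≤
      ‖Complex.exp (2 * Complex.I * a * upperLog z)‖ * Real.exp (1 / 2 * s) := by
  have hz' : R < height z := hz
  have hz0 : 0 < height z := hR.trans hz'
  have h1 : 2 * Complex.I * a * upperLog (z + s * Complex.I) = 2 * Complex.I * a * upperLog z +
    2 * Complex.I * a * (upperLog (z + s * Complex.I) - upperLog z) := by ring
  rw [h1, Complex.exp_add, norm_mul]
  refine mul_le_mul_of_nonneg_left ((Complex.norm_exp_le_exp_norm _).trans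
    (Real.exp_le_exp.2 ?_)) (norm_nonneg _)
  simp only [norm_mul, Complex.norm_I, Complex.norm_ofNat, mul_one]
  calc 2 * ‖a‖ * ‖upperLog (z + s * Complex.I) - upperLog z‖
      ≤ 2 * B * (2 / height z * s) := by
        have := norm_upperLog_sub_le hz0 hs
        gcongr
    _ = (4 * B / height z) * s := by ring
    _ ≤ 1 / 2 * s := by
        refine mul_le_mul_of_nonneg_right ?_ hs
        rw [div_le_div_iff₀ hz0 two_pos]
        linarith

theorem norm_jostStepDeriv_integrand_le (hB : 0 ≤ B) (hR : 0 < R) (hBR : 8 * B ≤ R)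
    (ha : ‖a‖ ≤ B) (hVb : ∀ z ∈ aboveWedge R, ‖V z‖ ≤ B / height z ^ 2)
    (hmb : ∀ z ∈ aboveWedge R, ‖m z‖ ≤ N) {z : ℂ} (hz : z ∈ aboveWedge R) {s : ℝ} (hs : 0 ≤ s) :
    ‖Complex.exp (-((1 : ℝ) * s)) * (Complex.exp (2 * Complex.I * a *
        upperLog (z + s * Complex.I)) * (V (z + s * Complex.I) * m (z + s * Complex.I)))‖ ≤
      ‖Complex.exp (2 * Complex.I * a * upperLog z)‖ * (B * N / height z ^ 2) *
        Real.exp (-(1 / 2) * s) := by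
  have hz' : R < height z := hz
  have hz0 : 0 < height z := hR.trans hz'
  have hzs := add_mem_aboveWedge z hz s hs
  have h1 := norm_exp_upperLog_le hB hR hBR ha hz hs
  have h2 : ‖V (z + s * Complex.I)‖ ≤ B / height z ^ 2 := by
    refine (hVb _ hzs).trans ?_
    rw [height_add]
    gcongr
    linarith
  have h3 := hmb _ hzs
  have h4 : ‖Complex.exp (-(((1 : ℝ) : ℂ) * s))‖ = Real.exp (-s) := by
    rw [Complex.norm_exp]; simp
  rw [norm_mul, norm_mul, norm_mul, h4]
  calc _ ≤ Real.exp (-s) * (‖Complex.exp (2 * Complex.I * a * upperLog z)‖ *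
        Real.exp (1 / 2 * s) * (B / height z ^ 2 * N)) := by gcongr
    _ = ‖Complex.exp (2 * Complex.I * a * upperLog z)‖ * (B * N / height z ^ 2) *
        (Real.exp (-s) * Real.exp (1 / 2 * s)) := by ring
    _ = _ := by rw [← Real.exp_add]; ring_nf

theorem differentiableOn_exp_upperLog (hR : 0 < R) (b : ℂ) :
    DifferentiableOn ℂ (fun z => Complex.exp (b * upperLog z)) (aboveWedge R) := fun _ hz =>
  (((hasDerivAt_upperLog (hR.trans hz)).const_mul b).cexp).differentiableAt.differentiableWithinAt

/-- `exp(iz) z^(2ia)` is the integrating factor of the first order equation for `m'`. Integrating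
from `i∞` cancels `exp(iz)` against its value on the ray and leaves `exp(-s)`, a Laplace transform
with `l = 1`. -/
theorem hasDerivAt_jostStepDeriv (hB : 0 ≤ B) (hR : 0 < R) (hBR : 8 * B ≤ R)
    (ha : ‖a‖ ≤ B) (hV : DifferentiableOn ℂ V (aboveWedge R))
    (hVb : ∀ z ∈ aboveWedge R, ‖V z‖ ≤ B / height z ^ 2)
    (hm : DifferentiableOn ℂ m (aboveWedge R))
    (hmb : ∀ z ∈ aboveWedge R, ‖m z‖ ≤ N) {z : ℂ} (hz : z ∈ aboveWedge R) :
    HasDerivAt (jostStepDeriv a V m)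
      (-(Complex.I + 2 * Complex.I * a / z) * jostStepDeriv a V m z - V z * m z) z := by
  have hz0 : ∀ z ∈ aboveWedge R, height z ≠ 0 := fun z hz => (hR.trans hz).ne'
  have h1 := hasDerivAt_verticalIntegral
    (isOpen_aboveWedge R) add_mem_aboveWedge
    (F := fun y => Complex.exp (2 * Complex.I * a * upperLog y) * (V y * m y))
    ((differentiableOn_exp_upperLog hR _).mul (hV.mul hm)) 1
    (c := fun z => ‖Complex.exp (2 * Complex.I * a * upperLog z)‖ * (B * N / height z ^ 2))
    (b := fun s => Real.exp (-(1 / 2) * s))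
    ((differentiableOn_exp_upperLog hR _).continuousOn.norm.mul
      (continuousOn_const.div (continuous_height.continuousOn.pow 2)
        fun z hz => pow_ne_zero 2 (hz0 z hz)))
    integral_exp_neg_half.1 (fun s _ => (Real.exp_pos _).le)
    (Real.tendsto_exp_atBot.comp (tendsto_id.const_mul_atTop_of_neg (by norm_num)))
    (fun z hz s hs => norm_jostStepDeriv_integrand_le hB hR hBR ha hVb hmb hz hs) hz
  have h2 := ((hasDerivAt_upperLog (hR.trans hz)).const_mul (2 * Complex.I * a)).fun_neg.cexp
  refine ((h2.fun_mul h1).const_mul Complex.I).congr_deriv ?_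
  have h3 : Complex.exp (-(2 * Complex.I * a * upperLog z)) *
      Complex.exp (2 * Complex.I * a * upperLog z) = 1 := by
    rw [← Complex.exp_add, neg_add_cancel, Complex.exp_zero]
  simp only [jostStepDeriv, Complex.ofReal_one]
  linear_combination (Complex.I * Complex.I * (V z * m z)) * h3 + V z * m z * Complex.I_mul_I

theorem norm_jostStepDeriv_le (hB : 0 ≤ B) (hR : 0 < R) (hBR : 8 * B ≤ R)
    (ha : ‖a‖ ≤ B) (hVb : ∀ z ∈ aboveWedge R, ‖V z‖ ≤ B / height z ^ 2)
    (hmb : ∀ z ∈ aboveWedge R, ‖m z‖ ≤ N) {z : ℂ} (hz : z ∈ aboveWedge R) :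
    ‖jostStepDeriv a V m z‖ ≤ 2 * B * N / height z ^ 2 := by
  have h1 := norm_verticalIntegral_le (l := 1) (z := z)
    (F := fun y => Complex.exp (2 * Complex.I * a * upperLog y) * (V y * m y))
    (c := ‖Complex.exp (2 * Complex.I * a * upperLog z)‖ * (B * N / height z ^ 2))
    (b := fun s => Real.exp (-(1 / 2) * s)) integral_exp_neg_half.1
    (fun s hs => norm_jostStepDeriv_integrand_le hB hR hBR ha hVb hmb hz hs)
  rw [integral_exp_neg_half.2] at h1
  have h3 : ‖Complex.exp (-(2 * Complex.I * a * upperLog z))‖ *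
      ‖Complex.exp (2 * Complex.I * a * upperLog z)‖ = 1 := by
    rw [← norm_mul, ← Complex.exp_add, neg_add_cancel, Complex.exp_zero, norm_one]
  rw [jostStepDeriv, norm_mul, norm_mul, Complex.norm_I, one_mul]
  calc _ ≤ ‖Complex.exp (-(2 * Complex.I * a * upperLog z))‖ *
        (‖Complex.exp (2 * Complex.I * a * upperLog z)‖ * (B * N / height z ^ 2) * 2) :=
        mul_le_mul_of_nonneg_left h1 (norm_nonneg _)
    _ = (‖Complex.exp (-(2 * Complex.I * a * upperLog z))‖ *
        ‖Complex.exp (2 * Complex.I * a * upperLog z)‖) * (2 * B * N / height z ^ 2) := by ring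
    _ = _ := by rw [h3, one_mul]

theorem norm_jostStep_integrand_le (hB : 0 ≤ B) (hR : 0 < R) (hBR : 8 * B ≤ R)
    (ha : ‖a‖ ≤ B) (hVb : ∀ z ∈ aboveWedge R, ‖V z‖ ≤ B / height z ^ 2)
    (hmb : ∀ z ∈ aboveWedge R, ‖m z‖ ≤ N) {z : ℂ} (hz : z ∈ aboveWedge R) {s : ℝ} (hs : 0 ≤ s) :
    ‖Complex.exp (-((0 : ℝ) * s)) * jostStepDeriv a V m (z + s * Complex.I)‖ ≤
      2 * B * N * ((height z + s) ^ 2)⁻¹ := by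
  have := norm_jostStepDeriv_le hB hR hBR ha hVb hmb (add_mem_aboveWedge z hz s hs)
  rw [height_add] at this
  simpa [div_eq_mul_inv] using this

/-- A Laplace transform with `l = 0` is integration from `i∞`. It converges because the derivative
is bounded by a multiple of `1/height²` and the height grows at unit speed. -/
theorem hasDerivAt_jostStep (hB : 0 ≤ B) (hR : 0 < R) (hBR : 8 * B ≤ R)
    (ha : ‖a‖ ≤ B) (hV : DifferentiableOn ℂ V (aboveWedge R))
    (hVb : ∀ z ∈ aboveWedge R, ‖V z‖ ≤ B / height z ^ 2)
    (hm : DifferentiableOn ℂ m (aboveWedge R)) (hN : 0 ≤ N)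
    (hmb : ∀ z ∈ aboveWedge R, ‖m z‖ ≤ N) {z : ℂ} (hz : z ∈ aboveWedge R) :
    HasDerivAt (jostStep a V m) (jostStepDeriv a V m z) z := by
  have h1 := hasDerivAt_verticalIntegral
    (isOpen_aboveWedge R) add_mem_aboveWedge (F := jostStepDeriv a V m)
    (fun z hz => (hasDerivAt_jostStepDeriv hB hR hBR ha hV hVb hm hmb
      hz).differentiableAt.differentiableWithinAt) 0
    (c := fun _ => 2 * B * N) (b := fun s => ((R + s) ^ 2)⁻¹) continuousOn_const
    (integrable_inv_add_sq hR).1 (fun s _ => by positivity)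
    (tendsto_inv_atTop_zero.comp ((tendsto_pow_atTop two_ne_zero).comp
      (tendsto_atTop_add_const_left _ R tendsto_id)))
    (fun z hz s hs => (norm_jostStep_integrand_le hB hR hBR ha hVb hmb hz hs).trans (by
      have : R < height z := hz
      gcongr)) hz
  refine (h1.const_mul (-Complex.I)).congr_deriv ?_
  simp only [Complex.ofReal_zero]
  linear_combination -jostStepDeriv a V m z * Complex.I_mul_I

theorem norm_jostStep_le (hB : 0 ≤ B) (hR : 0 < R) (hBR : 8 * B ≤ R)
    (ha : ‖a‖ ≤ B) (hVb : ∀ z ∈ aboveWedge R, ‖V z‖ ≤ B / height z ^ 2)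
    (hmb : ∀ z ∈ aboveWedge R, ‖m z‖ ≤ N) {z : ℂ} (hz : z ∈ aboveWedge R) :
    ‖jostStep a V m z‖ ≤ 2 * B * N / height z := by
  have hz0 : 0 < height z := hR.trans hz
  have h1 := norm_verticalIntegral_le (l := 0) (integrable_inv_add_sq hz0).1
    (fun s hs => norm_jostStep_integrand_le hB hR hBR ha hVb hmb hz hs)
  rw [(integrable_inv_add_sq hz0).2] at h1
  rw [jostStep, norm_mul, norm_neg, Complex.norm_I, one_mul]
  exact h1

/-- Transfers holomorphy in `κ` through one vertical integration. The majorant is uniform in `κ`,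
and `z` stays fixed. -/
theorem differentiableOn_verticalIntegral_param {K : Set ℂ} (hK : IsOpen K) {l : ℝ}
    {F : ℂ → ℂ → ℂ} {z : ℂ} {c : ℝ} {b : ℝ → ℝ} (hb : IntegrableOn b (Ioi 0))
    (hF₁ : ∀ κ ∈ K, ContinuousOn (fun s : ℝ => F κ (z + s * Complex.I)) (Ioi 0))
    (hF₂ : ∀ s : ℝ, 0 ≤ s → DifferentiableOn ℂ (fun κ => F κ (z + s * Complex.I)) K)
    (h : ∀ κ ∈ K, ∀ s : ℝ, 0 ≤ s →
      ‖Complex.exp (-(l * s)) * F κ (z + s * Complex.I)‖ ≤ c * b s) :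
    DifferentiableOn ℂ (fun κ => verticalIntegral l (F κ) z) K := by
  intro κ₀ hκ₀
  obtain ⟨r, hr, hrK⟩ := Metric.isOpen_iff.1 hK κ₀ hκ₀
  refine (differentiableAt_integral_of_dominated hr (bound := fun s => c * b s)
    ((ae_restrict_mem measurableSet_Ioi).mono fun s hs =>
      ((hF₂ s (le_of_lt hs)).mono hrK).const_mul _)
    (fun κ hκ => ?_)
    ((ae_restrict_mem measurableSet_Ioi).mono fun s hs κ hκ => h κ (hrK hκ) s (le_of_lt hs))
    (hb.const_mul c)).differentiableWithinAt
  exact (ContinuousOn.mul (by fun_prop) (hF₁ κ (hrK hκ))).aestronglyMeasurable measurableSet_Ioi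

end JostStep

/-! ### Neumann series and the amplitude -/

/-- The Neumann series of the Volterra equation. -/
noncomputable def jostTerm (a : ℂ) (V : ℂ → ℂ) : ℕ → ℂ → ℂ
  | 0 => fun _ => 1
  | n + 1 => jostStep a V (jostTerm a V n)

section JostSeries

variable {B R : ℝ}

/-- The operator has norm at most `2B/R ≤ 1/4`, so it contracts by `1/2`. The last clause keeps one
factor `2B/height z` unspent, which later gives `m → 1`. -/
theorem jostTerm_bound {a : ℂ} {V : ℂ → ℂ} (hB : 0 ≤ B) (hR : 0 < R) (hBR : 8 * B ≤ R)
    (ha : ‖a‖ ≤ B) (hV : DifferentiableOn ℂ V (aboveWedge R))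
    (hVb : ∀ z ∈ aboveWedge R, ‖V z‖ ≤ B / height z ^ 2) (n : ℕ) :
    DifferentiableOn ℂ (jostTerm a V n) (aboveWedge R) ∧
      (∀ z ∈ aboveWedge R, ‖jostTerm a V n z‖ ≤ (1 / 2) ^ n) ∧
      ∀ z ∈ aboveWedge R, ‖jostTerm a V (n + 1) z‖ ≤ 2 * B / height z * (1 / 2) ^ n := by
  have hstep : ∀ m : ℂ → ℂ, (∀ z ∈ aboveWedge R, ‖m z‖ ≤ (1 / 2) ^ n) →
      ∀ z ∈ aboveWedge R, ‖jostStep a V m z‖ ≤ 2 * B / height z * (1 / 2) ^ n :=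
    fun m hm z hz => (norm_jostStep_le hB hR hBR ha hVb hm hz).trans_eq (by ring)
  induction n with
  | zero =>
    have h0 : ∀ z ∈ aboveWedge R, ‖jostTerm a V 0 z‖ ≤ (1 / 2) ^ 0 := fun z _ => by
      simp [jostTerm]
    exact ⟨differentiableOn_const _, h0, hstep _ h0⟩
  | succ n ih =>
    obtain ⟨h1, h2, h3⟩ := ih fun m hm z hz =>
      (norm_jostStep_le hB hR hBR ha hVb hm hz).trans_eq (by ring)
    have h4 : ∀ z ∈ aboveWedge R, ‖jostTerm a V (n + 1) z‖ ≤ (1 / 2) ^ (n + 1) := fun z hz => by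
      refine (h3 z hz).trans ?_
      rw [pow_succ' (1 / 2 : ℝ) n]
      refine mul_le_mul_of_nonneg_right ?_ (by positivity)
      have hz' : R < height z := hz
      rw [div_le_div_iff₀ (hR.trans hz') two_pos]
      linarith
    exact ⟨fun z hz => (hasDerivAt_jostStep hB hR hBR ha hV hVb h1 (by positivity) h2
      hz).differentiableAt.differentiableWithinAt, h4, hstep _ h4⟩

theorem differentiableOn_jostTerm_param {K : Set ℂ} (hK : IsOpen K) {a : ℂ → ℂ} {V : ℂ → ℂ → ℂ}
    (hB : 0 ≤ B) (hR : 0 < R) (hBR : 8 * B ≤ R) (hab : ∀ κ ∈ K, ‖a κ‖ ≤ B)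
    (ha : DifferentiableOn ℂ a K) (hV₁ : ∀ κ ∈ K, DifferentiableOn ℂ (V κ) (aboveWedge R))
    (hV₂ : ∀ z ∈ aboveWedge R, DifferentiableOn ℂ (fun κ => V κ z) K)
    (hVb : ∀ κ ∈ K, ∀ z ∈ aboveWedge R, ‖V κ z‖ ≤ B / height z ^ 2) (n : ℕ) (z : ℂ)
    (hz : z ∈ aboveWedge R) : DifferentiableOn ℂ (fun κ => jostTerm (a κ) (V κ) n z) K := by
  induction n generalizing z with
  | zero => exact differentiableOn_const _
  | succ n ih =>
    have hterm := fun κ hκ => jostTerm_bound hB hR hBR (hab κ hκ) (hV₁ κ hκ) (hVb κ hκ) n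
    have hcomp : ∀ f : ℂ → ℂ, DifferentiableOn ℂ f (aboveWedge R) → ∀ z ∈ aboveWedge R,
        ContinuousOn (fun s : ℝ => f (z + s * Complex.I)) (Ioi 0) := fun f hf z hz =>
      hf.continuousOn.comp (by fun_prop) fun s hs => add_mem_aboveWedge z hz s (le_of_lt hs)
    have h1 : ∀ z ∈ aboveWedge R, DifferentiableOn ℂ
        (fun κ => jostStepDeriv (a κ) (V κ) (jostTerm (a κ) (V κ) n) z) K := by
      intro z hz
      refine DifferentiableOn.const_mul (DifferentiableOn.mul ?_ ?_) _
      · exact ((ha.const_mul _).mul_const _).fun_neg.cexp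
      · refine differentiableOn_verticalIntegral_param hK
          (F := fun κ y => Complex.exp (2 * Complex.I * a κ * upperLog y) *
            (V κ y * jostTerm (a κ) (V κ) n y))
          (c := Real.exp (2 * B * ‖upperLog z‖) * (B * (1 / 2) ^ n / height z ^ 2))
          (b := fun s => Real.exp (-(1 / 2) * s)) integral_exp_neg_half.1 (fun κ hκ => ?_)
          (fun s hs => ?_) (fun κ hκ s hs => ?_)
        · exact hcomp _ ((differentiableOn_exp_upperLog hR _).mul
            ((hV₁ κ hκ).mul (hterm κ hκ).1)) z hz
        · have hzs := add_mem_aboveWedge z hz s hs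
          exact (((ha.const_mul _).mul_const _).cexp).mul ((hV₂ _ hzs).mul (ih _ hzs))
        · refine (norm_jostStepDeriv_integrand_le hB hR hBR (hab κ hκ) (hVb κ hκ)
            (hterm κ hκ).2.1 hz hs).trans ?_
          gcongr
          refine (Complex.norm_exp_le_exp_norm _).trans (Real.exp_le_exp.2 ?_)
          have := hab κ hκ
          simp only [norm_mul, Complex.norm_I, Complex.norm_ofNat, mul_one]
          gcongr
    refine DifferentiableOn.const_mul ?_ _
    refine differentiableOn_verticalIntegral_param hK
      (F := fun κ => jostStepDeriv (a κ) (V κ) (jostTerm (a κ) (V κ) n))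
      (c := 2 * B * (1 / 2) ^ n) (b := fun s => ((height z + s) ^ 2)⁻¹)
      (integrable_inv_add_sq (hR.trans hz)).1 (fun κ hκ => ?_) (fun s hs => ?_)
      (fun κ hκ s hs => ?_)
    · exact hcomp _ (fun y hy => (hasDerivAt_jostStepDeriv hB hR hBR (hab κ hκ) (hV₁ κ hκ)
        (hVb κ hκ) (hterm κ hκ).1 (hterm κ hκ).2.1 hy).differentiableAt.differentiableWithinAt)
        z hz
    · exact h1 _ (add_mem_aboveWedge z hz s hs)
    · exact norm_jostStep_integrand_le hB hR hBR (hab κ hκ) (hVb κ hκ) (hterm κ hκ).2.1 hz hs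

/-- The amplitude is the sum of the Neumann series. Its zeroth term is the constant `1`, and the
remaining terms are dominated by `2B/height z` times a geometric series of sum 2. -/
theorem exists_jost_amplitude {K : Set ℂ} (hK : IsOpen K) {a : ℂ → ℂ} {V : ℂ → ℂ → ℂ}
    (hB : 0 ≤ B) (hR : 0 < R) (hBR : 8 * B ≤ R) (hab : ∀ κ ∈ K, ‖a κ‖ ≤ B)
    (ha : DifferentiableOn ℂ a K) (hV₁ : ∀ κ ∈ K, DifferentiableOn ℂ (V κ) (aboveWedge R))
    (hV₂ : ∀ z ∈ aboveWedge R, DifferentiableOn ℂ (fun κ => V κ z) K)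
    (hVb : ∀ κ ∈ K, ∀ z ∈ aboveWedge R, ‖V κ z‖ ≤ B / height z ^ 2) :
    ∃ m : ℂ → ℂ → ℂ, (∀ κ ∈ K, DifferentiableOn ℂ (m κ) (aboveWedge R)) ∧
      (∀ z ∈ aboveWedge R, DifferentiableOn ℂ (fun κ => m κ z) K) ∧
      (∀ κ ∈ K, ∀ z ∈ aboveWedge R, ‖m κ z‖ ≤ 2) ∧
      (∀ κ ∈ K, ∀ z ∈ aboveWedge R, ‖m κ z - 1‖ ≤ 4 * B / height z) ∧
      ∀ κ ∈ K, ∀ z ∈ aboveWedge R, deriv (deriv (m κ)) z =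
        -(Complex.I + 2 * Complex.I * a κ / z) * deriv (m κ) z - V κ z * m κ z := by
  have hterm := fun κ hκ => jostTerm_bound hB hR hBR (hab κ hκ) (hV₁ κ hκ) (hVb κ hκ)
  have hsum : HasSum (fun n : ℕ => ((1 : ℝ) / 2) ^ n) 2 := hasSum_geometric_two
  have hU := isOpen_aboveWedge R
  have hts : ∀ κ ∈ K, ∀ z ∈ aboveWedge R, HasSum (fun n => jostTerm (a κ) (V κ) n z)
      (∑' n, jostTerm (a κ) (V κ) n z) := fun κ hκ z hz =>
    (hsum.summable.of_norm_bounded fun n => (hterm κ hκ n).2.1 z hz).hasSum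
  refine ⟨fun κ z => ∑' n, jostTerm (a κ) (V κ) n z, fun κ hκ => ?_, fun z hz => ?_,
    fun κ hκ z hz => ?_, fun κ hκ z hz => ?_, fun κ hκ z hz => ?_⟩
  · exact Complex.differentiableOn_tsum_of_summable_norm hsum.summable
      (fun n => (hterm κ hκ n).1) hU fun n z hz => (hterm κ hκ n).2.1 z hz
  · exact Complex.differentiableOn_tsum_of_summable_norm hsum.summable
      (F := fun n κ => jostTerm (a κ) (V κ) n z)
      (fun n => differentiableOn_jostTerm_param hK hB hR hBR hab ha hV₁ hV₂ hVb n z hz) hK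
      fun n κ hκ => (hterm κ hκ n).2.1 z hz
  · exact tsum_of_norm_bounded hsum fun n => (hterm κ hκ n).2.1 z hz
  · have h1 : (∑' n, jostTerm (a κ) (V κ) n z) - 1 = ∑' n, jostTerm (a κ) (V κ) (n + 1) z := by
      rw [(hts κ hκ z hz).summable.tsum_eq_zero_add]
      simp [jostTerm]
    rw [h1]
    refine (tsum_of_norm_bounded (hsum.mul_left (2 * B / height z))
      fun n => (hterm κ hκ n).2.2 z hz).trans_eq (by ring)
  · have hd := fun n => (hterm κ hκ n).1
    have hb := fun n => (hterm κ hκ n).2.1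
    have h1 := Complex.hasSum_deriv_of_summable_norm hsum.summable hd hU hb hz
    have h2 := hasSum_deriv_deriv_of_summable_norm hsum.summable hd hU hb hz
    have hS : ∀ n, ∀ y ∈ aboveWedge R, deriv (jostTerm (a κ) (V κ) (n + 1)) y =
        jostStepDeriv (a κ) (V κ) (jostTerm (a κ) (V κ) n) y := fun n y hy =>
      (hasDerivAt_jostStep hB hR hBR (hab κ hκ) (hV₁ κ hκ) (hVb κ hκ) (hd n) (by positivity)
        (hb n) hy).deriv
    have h3 : ∀ n, deriv (deriv (jostTerm (a κ) (V κ) (n + 1))) z =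
        -(Complex.I + 2 * Complex.I * a κ / z) * deriv (jostTerm (a κ) (V κ) (n + 1)) z -
          V κ z * jostTerm (a κ) (V κ) n z := fun n => by
      have h4 : deriv (jostTerm (a κ) (V κ) (n + 1)) =ᶠ[𝓝 z]
          jostStepDeriv (a κ) (V κ) (jostTerm (a κ) (V κ) n) :=
        eventually_of_mem (hU.mem_nhds hz) (hS n)
      rw [h4.deriv_eq, hS n z hz]
      exact (hasDerivAt_jostStepDeriv hB hR hBR (hab κ hκ) (hV₁ κ hκ) (hVb κ hκ) (hd n)
        (hb n) hz).deriv
    have h5 : deriv (jostTerm (a κ) (V κ) 0) = fun _ => 0 := by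
      funext y; simp [jostTerm]
    have h1' := (hasSum_nat_add_iff' (f := fun n => deriv (jostTerm (a κ) (V κ) n) z) 1).2 h1
    have h2' := (hasSum_nat_add_iff'
      (f := fun n => deriv (deriv (jostTerm (a κ) (V κ) n)) z) 1).2 h2
    simp only [Finset.sum_range_one, h5, deriv_const, sub_zero] at h1' h2'
    refine h2'.unique ?_
    exact ((h1'.mul_left _).sub ((hts κ hκ z hz).mul_left _)).congr_fun h3

end JostSeries

/-! ### The square root in the phase and the decaying tail -/

section Sqrt

variable {u : ℂ}

theorem one_sub_mem_slitPlane (hu : ‖u‖ < 1) : 1 - u ∈ Complex.slitPlane :=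
  Complex.mem_slitPlane_iff.2 (Or.inl (by
    have := (Complex.re_le_norm u).trans_lt hu
    simpa using this))

theorem sqrt_one_sub_sq (u : ℂ) : ((1 - u) ^ (1 / 2 : ℂ)) ^ 2 = 1 - u := by
  have := Complex.cpow_nat_inv_pow (1 - u) two_ne_zero
  simpa only [one_div, Nat.cast_ofNat] using this

theorem re_sqrt_pos {w : ℂ} (hw : w ∈ Complex.slitPlane) : 0 < (w ^ (1 / 2 : ℂ)).re := by
  rw [Complex.cpow_def_of_ne_zero (Complex.slitPlane_ne_zero hw), Complex.exp_re]
  refine mul_pos (Real.exp_pos _) (Real.cos_pos_of_mem_Ioo ?_)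
  have h1 : (Complex.log w * (1 / 2)).im = w.arg / 2 := by
    have : Complex.log w * (1 / 2) = Complex.log w / 2 := by ring
    rw [this, Complex.div_ofNat_im, Complex.log_im]
  have h2 := Complex.neg_pi_lt_arg w
  have h3 := (Complex.arg_le_pi w).lt_of_ne (Complex.mem_slitPlane_iff_arg.1 hw).1
  rw [h1]
  constructor <;> linarith

theorem one_le_norm_one_add_sqrt (hu : ‖u‖ < 1) : 1 ≤ ‖1 + (1 - u) ^ (1 / 2 : ℂ)‖ := by
  have h1 := re_sqrt_pos (one_sub_mem_slitPlane hu)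
  have h2 := Complex.re_le_norm (1 + (1 - u) ^ (1 / 2 : ℂ))
  rw [Complex.add_re, Complex.one_re] at h2
  linarith

theorem norm_sqrt_one_sub_le (hu : ‖u‖ < 1) : ‖(1 - u) ^ (1 / 2 : ℂ)‖ ≤ 2 := by
  have h1 := congrArg norm (sqrt_one_sub_sq u)
  rw [norm_pow] at h1
  have h2 := norm_sub_le (1 : ℂ) u
  rw [norm_one] at h2
  nlinarith [norm_nonneg ((1 - u) ^ (1 / 2 : ℂ))]

end Sqrt

/-- The ratio `l / k²` for the far part of the potential, in the variable `s = exp (-ξ)`. -/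
noncomputable def farRatio (Z : ℝ) (k s : ℂ) : ℂ := -(2 * Z * s) / (k ^ 2 * (1 + s ^ 2))

/-- With `u = farRatio` and `r = √(1-u)`, one has `1 - u/2 - r = (1-r)²/2` and `1 - r = u/(1+r)`.
Subtracting the two leading terms from `k cosh ξ · r` hence leaves `-s` times this expression, where
`-s` is `ds/dξ`. In this form no cancellation is left and the function is visibly holomorphic at `s
= 0`. -/
noncomputable def phaseTailDeriv (Z : ℝ) (k s : ℂ) : ℂ :=
  Z ^ 2 / (k ^ 3 * (1 + s ^ 2) * (1 + (1 - farRatio Z k s) ^ (1 / 2 : ℂ)) ^ 2)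

/-- The decaying part of the phase, in the variable `s = exp (-ξ)`. -/
noncomputable def phaseTail (Z : ℝ) (k : ℂ) : ℂ → ℂ := radialPrimitive (phaseTailDeriv Z k)

/-- The radius below which `phaseTailDeriv` is holomorphic for `k` in `phaseRegion j`. -/
noncomputable def tailRadius (Z : ℝ) (j : ℕ) : ℝ := 1 / (4 * (|Z| + 1) * j)

section Tail

variable {Z : ℝ} {j : ℕ} {k s : ℂ}

theorem ne_zero_of_mem_phaseRegion (hk : k ∈ phaseRegion j) : k ≠ 0 := by
  rintro rfl
  have h : 1 / (j : ℝ) < ‖(0 : ℂ)‖ ^ 2 := hk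
  have : (0 : ℝ) ≤ 1 / (j : ℝ) := by positivity
  simp at h
  linarith

theorem isOpen_phaseRegion (j : ℕ) : IsOpen (phaseRegion j) :=
  isOpen_lt continuous_const (by fun_prop)

theorem tailRadius_pos (hj : 1 ≤ j) : 0 < tailRadius Z j := by
  have : (0 : ℝ) < j := by exact_mod_cast hj
  unfold tailRadius; positivity

/-- The choice of `tailRadius` gives `‖s‖ ≤ 1/4` and `2|Z|‖s‖j < 1/2`, while `‖k‖² j > 1`. -/
theorem farRatio_bound (hj : 1 ≤ j) (hk : k ∈ phaseRegion j) (hs : s ∈ ball 0 (tailRadius Z j)) :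
    1 / 2 ≤ ‖1 + s ^ 2‖ ∧ ‖farRatio Z k s‖ < 1 := by
  have hj' : (1 : ℝ) ≤ j := by exact_mod_cast hj
  have hs' : ‖s‖ < 1 / (4 * (|Z| + 1) * j) := by simpa [tailRadius] using hs
  have hZ := abs_nonneg Z
  rw [lt_div_iff₀ (by positivity)] at hs'
  have hk' : 1 / (j : ℝ) < ‖k‖ ^ 2 := hk
  rw [div_lt_iff₀ (by positivity)] at hk'
  have hs4 : ‖s‖ ≤ 1 / 4 := by
    by_contra! h
    have : 1 / 4 * (4 * 1 * 1) < ‖s‖ * (4 * (|Z| + 1) * j) := by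
      refine mul_lt_mul_of_lt_of_le_of_nonneg_of_pos h ?_ (by norm_num) (by positivity)
      gcongr; linarith
    linarith
  have h1 : 1 / 2 ≤ ‖1 + s ^ 2‖ := by
    have h2 := norm_sub_le_norm_add (1 : ℂ) (s ^ 2)
    rw [norm_one, norm_pow] at h2
    nlinarith [norm_nonneg s]
  refine ⟨h1, ?_⟩
  have hk0 : 0 < ‖k‖ := norm_pos_iff.2 (ne_zero_of_mem_phaseRegion hk)
  rw [farRatio, norm_div, norm_neg, norm_mul, norm_mul, norm_mul, norm_pow, Complex.norm_ofNat,
    Complex.norm_real, Real.norm_eq_abs, div_lt_one (by positivity)]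
  have h3 : 2 * |Z| * ‖s‖ * j < 1 / 2 := by nlinarith [norm_nonneg s]
  have h4 : 1 / 2 ≤ ‖k‖ ^ 2 * j * ‖1 + s ^ 2‖ := by nlinarith
  by_contra! h
  nlinarith

theorem phaseTailDeriv_denominator_ne_zero (hj : 1 ≤ j) (hk : k ∈ phaseRegion j)
    (hs : s ∈ ball 0 (tailRadius Z j)) :
    k ^ 3 * (1 + s ^ 2) * (1 + (1 - farRatio Z k s) ^ (1 / 2 : ℂ)) ^ 2 ≠ 0 := by
  obtain ⟨h1, h2⟩ := farRatio_bound hj hk hs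
  have h3 := one_le_norm_one_add_sqrt h2
  refine mul_ne_zero (mul_ne_zero (pow_ne_zero _ (ne_zero_of_mem_phaseRegion hk)) ?_)
    (pow_ne_zero _ ?_) <;> exact norm_pos_iff.1 (by linarith)

theorem differentiableOn_phaseTailDeriv (hj : 1 ≤ j) (hk : k ∈ phaseRegion j) :
    DifferentiableOn ℂ (phaseTailDeriv Z k) (ball 0 (tailRadius Z j)) := by
  intro s hs
  obtain ⟨h1, h2⟩ := farRatio_bound hj hk hs
  have hk0 := ne_zero_of_mem_phaseRegion hk
  have h3 : 1 + s ^ 2 ≠ 0 := norm_pos_iff.1 (by linarith)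
  have h4 : DifferentiableAt ℂ (farRatio Z k) s := by
    unfold farRatio
    refine DifferentiableAt.div (by fun_prop) (by fun_prop) (mul_ne_zero (by positivity) h3)
  have h5 : DifferentiableAt ℂ (fun s => (1 - farRatio Z k s) ^ (1 / 2 : ℂ)) s :=
    (h4.const_sub 1).cpow (differentiableAt_const _) (one_sub_mem_slitPlane h2)
  have h6 : DifferentiableAt ℂ (fun s => k ^ 3 * (1 + s ^ 2) *
      (1 + (1 - farRatio Z k s) ^ (1 / 2 : ℂ)) ^ 2) s :=
    (DifferentiableAt.fun_mul (by fun_prop) (by fun_prop)).fun_mul ((h5.const_add 1).fun_pow 2)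
  exact ((differentiableAt_const ((Z : ℂ) ^ 2)).fun_div h6
    (phaseTailDeriv_denominator_ne_zero hj hk hs)).differentiableWithinAt

theorem differentiableOn_phaseTailDeriv_param (hj : 1 ≤ j) (hs : s ∈ ball 0 (tailRadius Z j)) :
    DifferentiableOn ℂ (fun k => phaseTailDeriv Z k s) (phaseRegion j) := by
  intro k hk
  obtain ⟨h1, h2⟩ := farRatio_bound hj hk hs
  have hk0 := ne_zero_of_mem_phaseRegion hk
  have h3 : 1 + s ^ 2 ≠ 0 := norm_pos_iff.1 (by linarith)
  have h4 : DifferentiableAt ℂ (fun k => farRatio Z k s) k := by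
    unfold farRatio
    refine DifferentiableAt.div (by fun_prop) (by fun_prop) (mul_ne_zero (by positivity) h3)
  have h5 : DifferentiableAt ℂ (fun k => (1 - farRatio Z k s) ^ (1 / 2 : ℂ)) k :=
    (h4.const_sub 1).cpow (differentiableAt_const _) (one_sub_mem_slitPlane h2)
  have h6 : DifferentiableAt ℂ (fun k => k ^ 3 * (1 + s ^ 2) *
      (1 + (1 - farRatio Z k s) ^ (1 / 2 : ℂ)) ^ 2) k :=
    (DifferentiableAt.fun_mul (by fun_prop) (by fun_prop)).fun_mul ((h5.const_add 1).fun_pow 2)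
  exact ((differentiableAt_const ((Z : ℂ) ^ 2)).fun_div h6
    (phaseTailDeriv_denominator_ne_zero hj hk hs)).differentiableWithinAt

theorem norm_phaseTailDeriv_le (hj : 1 ≤ j) (hk : k ∈ phaseRegion j)
    (hs : s ∈ ball 0 (tailRadius Z j)) : ‖phaseTailDeriv Z k s‖ ≤ 2 * Z ^ 2 / ‖k‖ ^ 3 := by
  obtain ⟨h1, h2⟩ := farRatio_bound hj hk hs
  have h3 := one_le_norm_one_add_sqrt h2
  have hk0 : 0 < ‖k‖ := norm_pos_iff.2 (ne_zero_of_mem_phaseRegion hk)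
  simp only [phaseTailDeriv, norm_div, norm_mul, norm_pow, Complex.norm_real, Real.norm_eq_abs,
    sq_abs]
  have h4 : ‖k‖ ^ 3 * (1 / 2) * 1 ^ 2 ≤
      ‖k‖ ^ 3 * ‖1 + s ^ 2‖ * ‖1 + (1 - farRatio Z k s) ^ (1 / 2 : ℂ)‖ ^ 2 := by gcongr
  calc _ ≤ Z ^ 2 / (‖k‖ ^ 3 * (1 / 2) * 1 ^ 2) := by gcongr
    _ = _ := by field_simp

theorem hasDerivAt_phaseTail (hj : 1 ≤ j) (hk : k ∈ phaseRegion j)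
    (hs : s ∈ ball 0 (tailRadius Z j)) :
    HasDerivAt (phaseTail Z k) (phaseTailDeriv Z k s) s :=
  hasDerivAt_radial_primitive (differentiableOn_phaseTailDeriv hj hk) hs

theorem phaseTail_zero : phaseTail Z k 0 = 0 := radialPrimitive_zero _

/-- `farRatio` is even in `k`, and the prefactor `k⁻³` is odd. -/
theorem phaseTail_neg : phaseTail Z (-k) s = -phaseTail Z k s := by
  have h : ∀ y, phaseTailDeriv Z (-k) y = -phaseTailDeriv Z k y := fun y => by
    simp only [phaseTailDeriv, farRatio, neg_sq, Odd.neg_pow (by decide : Odd 3), neg_mul, div_neg]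
  simp only [phaseTail, radialPrimitive, h, intervalIntegral.integral_neg, mul_neg]

theorem exists_norm_bounds (k₀ : ℂ) (hk₀ : k₀ ∈ phaseRegion j) : ∃ r > 0, ∀ k ∈ ball k₀ r,
    k ∈ phaseRegion j ∧ ‖k₀‖ / 2 ≤ ‖k‖ ∧ ‖k‖ ≤ ‖k₀‖ + 1 := by
  have h0 : 0 < ‖k₀‖ := norm_pos_iff.2 (ne_zero_of_mem_phaseRegion hk₀)
  have h1 : ∀ᶠ k in 𝓝 k₀, ‖k₀‖ / 2 < ‖k‖ :=
    continuous_norm.continuousAt.eventually (lt_mem_nhds (by linarith))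
  have h2 : ∀ᶠ k in 𝓝 k₀, ‖k‖ < ‖k₀‖ + 1 :=
    continuous_norm.continuousAt.eventually (gt_mem_nhds (by linarith))
  obtain ⟨r, hr, h⟩ := Metric.eventually_nhds_iff_ball.1
    (((isOpen_phaseRegion j).eventually_mem hk₀).and (h1.and h2))
  exact ⟨r, hr, fun k hk => ⟨(h k hk).1, (h k hk).2.1.le, (h k hk).2.2.le⟩⟩

theorem differentiableOn_phaseTail_param (hj : 1 ≤ j) (hs : s ∈ ball 0 (tailRadius Z j)) :
    DifferentiableOn ℂ (fun k => phaseTail Z k s) (phaseRegion j) := by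
  intro k₀ hk₀
  obtain ⟨r, hr, h⟩ := exists_norm_bounds k₀ hk₀
  have hk0 : 0 < ‖k₀‖ := norm_pos_iff.2 (ne_zero_of_mem_phaseRegion hk₀)
  refine DifferentiableAt.differentiableWithinAt (DifferentiableAt.const_mul ?_ s)
  simp only [intervalIntegral.integral_of_le zero_le_one]
  have hts : ∀ t ∈ Ioc (0 : ℝ) 1, (t : ℂ) * s ∈ ball 0 (tailRadius Z j) := fun t ht => by
    rw [mem_ball_zero_iff] at hs ⊢
    rw [norm_mul, Complex.norm_real, Real.norm_eq_abs, abs_of_pos ht.1]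
    nlinarith [ht.2, norm_nonneg s]
  refine differentiableAt_integral_of_dominated hr
    (bound := fun _ => 2 * Z ^ 2 / (‖k₀‖ / 2) ^ 3)
    ((ae_restrict_mem measurableSet_Ioc).mono fun t ht =>
      (differentiableOn_phaseTailDeriv_param hj (hts t ht)).mono fun k hk => (h k hk).1)
    (fun k hk => ?_)
    ((ae_restrict_mem measurableSet_Ioc).mono fun t ht k hk =>
      (norm_phaseTailDeriv_le hj (h k hk).1 (hts t ht)).trans (by
        have := (h k hk).2.1
        gcongr))
    (integrableOn_const (by simp))
  exact ((differentiableOn_phaseTailDeriv hj (h k hk).1).continuousOn.comp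
    (by fun_prop) hts).aestronglyMeasurable measurableSet_Ioc

end Tail

/-! ### Normal form of the phase on the real axis -/

/-- The normal form of the phase, up to a constant, for large `ξ`. -/
noncomputable def normalPhase (Z : ℝ) (k : ℂ) (ξ : ℝ) : ℂ :=
  k * Complex.sinh ξ + Z * ξ / (2 * k) + phaseTail Z k (Complex.exp (-ξ))

section NormalPhase

variable {Z : ℝ} {j : ℕ} {k : ℂ}

theorem exp_neg_mem_ball {δ ξ : ℝ} (hξ : Real.exp (-ξ) < δ) :
    Complex.exp (-ξ) ∈ ball (0 : ℂ) δ := by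
  rw [mem_ball_zero_iff, Complex.norm_exp]
  simpa using hξ

theorem farRatio_exp_neg (hk : k ≠ 0) (ξ : ℝ) :
    farRatio Z k (Complex.exp (-ξ)) = ((-Z / Real.cosh ξ : ℝ) : ℂ) / k ^ 2 := by
  have h1 : Complex.exp (-ξ) * Complex.exp ξ = 1 := by
    rw [← Complex.exp_add, neg_add_cancel, Complex.exp_zero]
  have h2 : (Complex.cosh ξ) = (Complex.exp ξ + Complex.exp (-ξ)) / 2 := rfl
  have hc : Complex.cosh ξ ≠ 0 := by exact_mod_cast (Real.cosh_pos ξ).ne'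
  have hE := Complex.exp_ne_zero (ξ : ℂ)
  have h3 : 1 + Complex.exp (-ξ) ^ 2 = 2 * Complex.cosh ξ * Complex.exp (-ξ) := by
    rw [h2]; linear_combination -h1
  have hE' := Complex.exp_ne_zero (-ξ : ℂ)
  rw [farRatio, h3]
  push_cast
  field_simp

/-- The hypothesis says that `1 - r²` is the far ratio. Here `(s⁻¹ + s)/2` stands for `cosh ξ`, and
`r` is kept as an unknown so that only polynomial identities remain. -/
theorem normalPhase_deriv_algebra {s r z : ℂ} (hk : k ≠ 0) (hs : s ≠ 0) (hq : 1 + s ^ 2 ≠ 0)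
    (hr : 1 + r ≠ 0) (h : k ^ 2 * (1 + s ^ 2) * (1 - r ^ 2) + 2 * z * s = 0) :
    k * ((s⁻¹ + s) / 2) + z / (2 * k) - s * (z ^ 2 / (k ^ 3 * (1 + s ^ 2) * (1 + r) ^ 2)) =
      (s⁻¹ + s) / 2 * (k * r) := by
  have h1 : z ^ 2 / (k ^ 3 * (1 + s ^ 2) * (1 + r) ^ 2) =
      k * (1 + s ^ 2) * (1 - r) ^ 2 / (4 * s ^ 2) := by
    rw [div_eq_div_iff
      (mul_ne_zero (mul_ne_zero (pow_ne_zero 3 hk) hq) (pow_ne_zero 2 hr))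
      (mul_ne_zero (by norm_num : (4 : ℂ) ≠ 0) (pow_ne_zero 2 hs))]
    linear_combination (2 * z * s - k ^ 2 * (1 + s ^ 2) * (1 - r ^ 2)) * h
  have h2 : z / (2 * k) = -(k * (1 + s ^ 2) * (1 - r ^ 2)) / (4 * s) := by
    rw [div_eq_div_iff (mul_ne_zero two_ne_zero hk) (mul_ne_zero (by norm_num : (4 : ℂ) ≠ 0) hs)]
    linear_combination 2 * h
  rw [h1, h2]
  field_simp
  ring

theorem hasDerivAt_normalPhase (hj : 1 ≤ j) (hk : k ∈ phaseRegion j) {ξ : ℝ}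
    (hξ : Real.exp (-ξ) < tailRadius Z j) :
    HasDerivAt (normalPhase Z k) (Complex.cosh ξ *
      (k * (1 - ((-Z / Real.cosh ξ : ℝ) : ℂ) / k ^ 2) ^ (1 / 2 : ℂ))) ξ := by
  have hk0 := ne_zero_of_mem_phaseRegion hk
  have hs := exp_neg_mem_ball hξ
  have hid : HasDerivAt (fun ξ : ℝ => (ξ : ℂ)) 1 ξ := Complex.ofRealCLM.hasDerivAt
  have h1 : HasDerivAt (fun ξ : ℝ => Complex.sinh ξ) (Complex.cosh ξ * 1) ξ :=
    (Complex.hasDerivAt_sinh _).comp_ofReal.congr_deriv (by ring)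
  have h2 : HasDerivAt (fun ξ : ℝ => Complex.exp (-ξ)) (Complex.exp (-ξ) * -1) ξ :=
    hid.fun_neg.cexp
  have h3 := (hasDerivAt_phaseTail hj hk hs).scomp ξ h2
  refine (((h1.const_mul k).fun_add ((hid.const_mul (Z : ℂ)).div_const (2 * k))).fun_add
    h3).congr_deriv ?_
  obtain ⟨hb1, hb2⟩ := farRatio_bound hj hk hs
  have hden := phaseTailDeriv_denominator_ne_zero hj hk hs
  have hr2 := sqrt_one_sub_sq (farRatio Z k (Complex.exp (-ξ)))
  rw [← farRatio_exp_neg hk0]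
  simp only [smul_eq_mul, phaseTailDeriv]
  obtain ⟨r, hr⟩ : ∃ r, r = (1 - farRatio Z k (Complex.exp (-ξ))) ^ (1 / 2 : ℂ) := ⟨_, rfl⟩
  rw [← hr] at hden hr2 ⊢
  have hE : Complex.exp (-ξ) * Complex.exp ξ = 1 := by
    rw [← Complex.exp_add, neg_add_cancel, Complex.exp_zero]
  have hc : Complex.cosh ξ = (Complex.exp ξ + Complex.exp (-ξ)) / 2 := rfl
  have hE' := Complex.exp_ne_zero (-ξ : ℂ)
  have hexp : Complex.exp ξ = (Complex.exp (-ξ))⁻¹ := eq_inv_of_mul_eq_one_right hE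
  have hq : 1 + Complex.exp (-ξ) ^ 2 ≠ 0 := norm_pos_iff.1 (by linarith)
  have hr1 : 1 + r ≠ 0 := fun h => hden (by rw [h]; ring)
  have hk2 : k ^ 2 * (1 + Complex.exp (-ξ) ^ 2) ≠ 0 :=
    mul_ne_zero (pow_ne_zero 2 hk0) hq
  rw [farRatio] at hr2
  rw [hc, hexp]
  rw [← normalPhase_deriv_algebra hk0 hE' hq hr1 (z := Z) ?_]
  · ring
  · rw [hr2]
    field_simp
    ring

theorem differentiableOn_normalPhase_param (hj : 1 ≤ j) {ξ : ℝ}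
    (hξ : Real.exp (-ξ) < tailRadius Z j) :
    DifferentiableOn ℂ (fun k => normalPhase Z k ξ) (phaseRegion j) := by
  refine DifferentiableOn.fun_add (DifferentiableOn.fun_add (by fun_prop) ?_)
    (differentiableOn_phaseTail_param hj (exp_neg_mem_ball hξ))
  exact (differentiableOn_const _).div (by fun_prop) fun k hk =>
    mul_ne_zero two_ne_zero (ne_zero_of_mem_phaseRegion hk)

theorem normalPhase_neg (ξ : ℝ) : normalPhase Z (-k) ξ = -normalPhase Z k ξ := by
  simp only [normalPhase, phaseTail_neg, mul_neg, div_neg]; ring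

theorem norm_div_sq_lt (hk : k ∈ phaseRegion j) {l : ℝ} (hl : |l| ≤ 1 / (j : ℝ)) :
    ‖(l : ℂ) / k ^ 2‖ < 1 := by
  have hk0 : 0 < ‖k‖ := norm_pos_iff.2 (ne_zero_of_mem_phaseRegion hk)
  have hk' : 1 / (j : ℝ) < ‖k‖ ^ 2 := hk
  rw [norm_div, norm_pow, Complex.norm_real, Real.norm_eq_abs, div_lt_one (by positivity)]
  linarith

/-- The integral splits at `sinh X`. The inner part does not depend on `ξ` and is analytic in `k`.
In the outer part `l` is explicit, and the normal form is a primitive. -/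
theorem localPhase_eq (hj : 1 ≤ j) {μ : ℂ} {l : ℝ → ℝ} (hl : IsLongRangePart Z μ j l) :
    ∃ (X : ℝ) (d : ℂ → ℂ), DifferentiableOn ℂ d (phaseRegion j) ∧
      ∀ k ∈ phaseRegion j, ∀ ξ > X, localPhase l ξ k = d k + normalPhase Z k ξ := by
  obtain ⟨R₀, hR₀⟩ := hl.eq_far
  have hδ := tailRadius_pos (Z := Z) hj
  -- Beyond `X` the long range part has its explicit form and `exp (-ξ)` lies in the disc where the
  -- tail is holomorphic.
  obtain ⟨X, hX₁, hX₂, hX₃⟩ : ∃ X : ℝ, 0 < X ∧ R₀ < Real.sinh X ∧ Real.exp (-X) < tailRadius Z j := by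
    have h1 : Tendsto (fun X : ℝ => Real.exp (-X)) atTop (𝓝 0) :=
      Real.tendsto_exp_atBot.comp tendsto_neg_atTop_atBot
    have h2 : Tendsto Real.sinh atTop atTop := tendsto_atTop_mono'  _
      ((eventually_ge_atTop 0).mono fun x hx => Real.self_le_sinh_iff.2 hx) tendsto_id
    exact ((eventually_gt_atTop 0).and ((h2.eventually_gt_atTop R₀).and
      (h1.eventually (gt_mem_nhds hδ)))).exists
  have hS : 0 < Real.sinh X := Real.sinh_pos_iff.2 hX₁
  have hfar : ∀ k ∈ phaseRegion j, ∀ ξ > X, IntervalIntegrable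
        (fun τ => k * (1 - (l τ : ℂ) / k ^ 2) ^ (1 / 2 : ℂ)) volume (Real.sinh X) (Real.sinh ξ) ∧
      ∫ τ in Real.sinh X..Real.sinh ξ, k * (1 - (l τ : ℂ) / k ^ 2) ^ (1 / 2 : ℂ) =
        normalPhase Z k ξ - normalPhase Z k X := by
    intro k hk ξ hξ
    have hle : Real.sinh X ≤ Real.sinh ξ := Real.sinh_le_sinh.2 hξ.le
    have hcont : ContinuousOn (fun τ => k * (1 - (l τ : ℂ) / k ^ 2) ^ (1 / 2 : ℂ))
        (uIcc (Real.sinh X) (Real.sinh ξ)) := by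
      rw [uIcc_of_le hle]
      refine continuousOn_const.mul (ContinuousOn.cpow ?_ continuousOn_const fun τ hτ =>
        one_sub_mem_slitPlane (norm_div_sq_lt hk (hl.bound τ (hS.trans_le hτ.1))))
      refine continuousOn_const.sub (ContinuousOn.div_const ?_ _)
      exact Complex.continuous_ofReal.comp_continuousOn
        (hl.contDiffOn.continuousOn.mono fun τ hτ => hS.trans_le hτ.1)
    refine ⟨hcont.intervalIntegrable, ?_⟩
    -- Under `ξ = arsinh τ` the factor `cosh ξ` in the derivative of the normal form cancels against
    -- `dξ/dτ`.
    have := intervalIntegral.integral_eq_sub_of_hasDerivAt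
      (f := fun τ => normalPhase Z k (Real.arsinh τ)) (fun τ hτ => ?_) hcont.intervalIntegrable
    · simpa only [Real.arsinh_sinh] using this
    · rw [uIcc_of_le hle] at hτ
      have hτX : X ≤ Real.arsinh τ := by
        rw [← Real.arsinh_sinh X]; exact Real.arsinh_le_arsinh.2 hτ.1
      have hd := hasDerivAt_normalPhase hj hk (ξ := Real.arsinh τ)
        ((Real.exp_le_exp.2 (neg_le_neg hτX)).trans_lt hX₃)
      refine (hd.scomp τ (Real.hasDerivAt_arsinh τ)).congr_deriv ?_
      have hc : (0 : ℝ) < √(1 + τ ^ 2) := by positivity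
      rw [← Complex.ofReal_cosh, Real.cosh_arsinh, hR₀ τ (hX₂.trans_le hτ.1), Complex.real_smul,
        ← mul_assoc, ← Complex.ofReal_mul, inv_mul_cancel₀ hc.ne', Complex.ofReal_one, one_mul]
  have hIoc : Ioc 0 (Real.sinh X) ⊆ Ioi 0 := fun τ hτ => hτ.1
  have hmeas : ∀ k ∈ phaseRegion j, AEStronglyMeasurable
      (fun τ => k * (1 - (l τ : ℂ) / k ^ 2) ^ (1 / 2 : ℂ))
      (volume.restrict (Ioc 0 (Real.sinh X))) := fun k hk => by
    refine ContinuousOn.aestronglyMeasurable ?_ measurableSet_Ioc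
    refine continuousOn_const.mul (ContinuousOn.cpow ?_ continuousOn_const fun τ hτ =>
      one_sub_mem_slitPlane (norm_div_sq_lt hk (hl.bound τ hτ.1)))
    refine continuousOn_const.sub (ContinuousOn.div_const ?_ _)
    exact Complex.continuous_ofReal.comp_continuousOn (hl.contDiffOn.continuousOn.mono hIoc)
  have hbound : ∀ k ∈ phaseRegion j, ∀ τ > 0,
      ‖k * (1 - (l τ : ℂ) / k ^ 2) ^ (1 / 2 : ℂ)‖ ≤ ‖k‖ * 2 := fun k hk τ hτ => by
    rw [norm_mul]
    exact mul_le_mul_of_nonneg_left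
      (norm_sqrt_one_sub_le (norm_div_sq_lt hk (hl.bound τ hτ))) (norm_nonneg _)
  have hnear : ∀ k ∈ phaseRegion j, IntervalIntegrable
      (fun τ => k * (1 - (l τ : ℂ) / k ^ 2) ^ (1 / 2 : ℂ)) volume 0 (Real.sinh X) := fun k hk => by
    rw [intervalIntegrable_iff_integrableOn_Ioc_of_le hS.le]
    exact (integrableOn_const (C := ‖k‖ * 2) (by simp)).mono' (hmeas k hk)
      ((ae_restrict_mem measurableSet_Ioc).mono fun τ hτ => hbound k hk τ hτ.1)
  refine ⟨X, fun k => (∫ τ in (0 : ℝ)..Real.sinh X, k * (1 - (l τ : ℂ) / k ^ 2) ^ (1 / 2 : ℂ)) -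
    normalPhase Z k X, ?_, fun k hk ξ hξ => ?_⟩
  · refine DifferentiableOn.fun_sub (fun k₀ hk₀ => ?_) (differentiableOn_normalPhase_param hj hX₃)
    obtain ⟨r, hr, h⟩ := exists_norm_bounds k₀ hk₀
    simp only [intervalIntegral.integral_of_le hS.le]
    refine (differentiableAt_integral_of_dominated hr (bound := fun _ => (‖k₀‖ + 1) * 2)
      ((ae_restrict_mem measurableSet_Ioc).mono fun τ hτ k hk => ?_)
      (fun k hk => hmeas k (h k hk).1)
      ((ae_restrict_mem measurableSet_Ioc).mono fun τ hτ k hk =>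
        (hbound k (h k hk).1 τ hτ.1).trans
          (mul_le_mul_of_nonneg_right (h k hk).2.2 zero_le_two))
      (integrableOn_const (by simp))).differentiableWithinAt
    have hk' := (h k hk).1
    have h5 : DifferentiableAt ℂ (fun k : ℂ => (l τ : ℂ) / k ^ 2) k :=
      (differentiableAt_const _).fun_div (by fun_prop)
        (pow_ne_zero 2 (ne_zero_of_mem_phaseRegion hk'))
    exact (differentiableAt_id.fun_mul ((h5.const_sub 1).cpow (differentiableAt_const _)
      (one_sub_mem_slitPlane (norm_div_sq_lt hk' (hl.bound τ hτ.1))))).differentiableWithinAt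
  · rw [localPhase, ← intervalIntegral.integral_add_adjacent_intervals (hnear k hk)
      (hfar k hk ξ hξ).1, (hfar k hk ξ hξ).2]
    ring

/-- A global phase function agrees for large `ξ` with the normal form, up to an odd analytic
function of `k`. -/
theorem exists_phase_constant {φ : ℝ → ℂ → ℂ} {μ : ℂ} (hφ : IsGlobalPhase Z μ φ) :
    ∃ c : ℂ → ℂ, (∀ k ≠ 0, DifferentiableAt ℂ c k) ∧ (∀ k ≠ 0, c (-k) = -c k) ∧
      ∀ k ≠ 0, ∃ X : ℝ, ∀ ξ > X, φ ξ k = c k + normalPhase Z k ξ := by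
  have hlevel : ∀ j : ℕ, ∃ (X : ℝ) (d : ℂ → ℂ), 1 ≤ j → DifferentiableOn ℂ d (phaseRegion j) ∧
      ∀ k ∈ phaseRegion j, ∀ ξ > X, φ ξ k = d k + normalPhase Z k ξ := fun j => by
    by_cases hj : 1 ≤ j
    · obtain ⟨l, g, R, hl, hg, h⟩ := hφ.eq_local j hj
      obtain ⟨X, d, hd, h'⟩ := localPhase_eq hj hl
      refine ⟨max R X, fun k => d k + g k, fun _ => ⟨hd.fun_add hg.differentiableOn,
        fun k hk ξ hξ => ?_⟩⟩
      rw [h ξ ((le_max_left _ _).trans_lt hξ) k hk, h' k hk ξ ((le_max_right _ _).trans_lt hξ)]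
      ring
    · exact ⟨0, 0, fun h => absurd h hj⟩
  choose X d hXd using hlevel
  have hex : ∀ k : ℂ, ∃ j : ℕ, k ≠ 0 → 1 ≤ j ∧ k ∈ phaseRegion j := fun k => by
    by_cases hk : k = 0
    · exact ⟨0, fun h => absurd hk h⟩
    · have h0 : 0 < ‖k‖ ^ 2 := by have := norm_pos_iff.2 hk; positivity
      obtain ⟨n, hn⟩ := exists_nat_one_div_lt h0
      exact ⟨n + 1, fun _ => ⟨by omega, by simpa [phaseRegion] using hn⟩⟩
  choose J hJ using hex
  -- Both levels express the same `φ ξ k` through the same normal form at a common large `ξ`, so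
  -- their constants agree. This gives one function of `k` despite the arbitrary choice of level.
  have hc : ∀ j, 1 ≤ j → ∀ k ∈ phaseRegion j, d (J k) k = d j k := fun j hj k hk => by
    have hk0 := ne_zero_of_mem_phaseRegion hk
    obtain ⟨ξ, hξ₁, hξ₂⟩ := ((eventually_gt_atTop (X j)).and
      (eventually_gt_atTop (X (J k)))).exists
    have h1 := (hXd j hj).2 k hk ξ hξ₁
    have h2 := (hXd _ (hJ k hk0).1).2 k (hJ k hk0).2 ξ hξ₂
    exact add_right_cancel (h2.symm.trans h1)
  refine ⟨fun k => d (J k) k, fun k hk => ?_, fun k hk => ?_, fun k hk =>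
    ⟨X (J k), (hXd _ (hJ k hk).1).2 k (hJ k hk).2⟩⟩
  · obtain ⟨hj, hkj⟩ := hJ k hk
    refine (((hXd _ hj).1.differentiableAt
      ((isOpen_phaseRegion _).mem_nhds hkj)).congr_of_eventuallyEq ?_)
    exact eventually_of_mem ((isOpen_phaseRegion _).mem_nhds hkj) (hc _ hj)
  · obtain ⟨ξ, hξ₁, hξ₂⟩ := ((eventually_gt_atTop (X (J (-k)))).and
      (eventually_gt_atTop (X (J k)))).exists
    have h1 := (hXd _ (hJ k hk).1).2 k (hJ k hk).2 ξ hξ₂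
    have h2 := (hXd _ (hJ (-k) (neg_ne_zero.2 hk)).1).2 (-k) (hJ (-k) (neg_ne_zero.2 hk)).2 ξ hξ₁
    rw [hφ.odd ξ k hk, h1, normalPhase_neg] at h2
    linear_combination -h2

end NormalPhase

/-! ### Analytic continuation of the phase -/

/-- The normal form of the phase in the variable `x = exp ξ - 1`. -/
noncomputable def normalPhaseC (Z : ℝ) (k x : ℂ) : ℂ :=
  k * ((x + 1 - (x + 1)⁻¹) / 2) + Z * Complex.log (x + 1) / (2 * k) + phaseTail Z k (x + 1)⁻¹

/-- The slit plane minus a disc. -/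
def slitExterior (R : ℝ) : Set ℂ := {x | x ∈ Complex.slitPlane ∧ R < ‖x‖}

theorem isOpen_slitExterior (R : ℝ) : IsOpen (slitExterior R) :=
  Complex.isOpen_slitPlane.inter (isOpen_lt continuous_const continuous_norm)

/-- It is the image of a convex half-strip under `exp`. Connectedness is what the identity theorem
needs for uniqueness of the continuation. -/
theorem isPreconnected_slitExterior {R : ℝ} (hR : 0 < R) : IsPreconnected (slitExterior R) := by
  have h : slitExterior R = Complex.exp ''
      ({ζ | Real.log R < ζ.re} ∩ ({ζ | -Real.pi < ζ.im} ∩ {ζ | ζ.im < Real.pi})) := by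
    ext x
    constructor
    · rintro ⟨hx, hRx⟩
      have hx0 := Complex.slitPlane_ne_zero hx
      refine ⟨Complex.log x, ⟨?_, ?_, ?_⟩, Complex.exp_log hx0⟩
      · show Real.log R < (Complex.log x).re
        rw [Complex.log_re]; exact Real.log_lt_log hR hRx
      · exact Complex.neg_pi_lt_log_im x
      · show (Complex.log x).im < _
        rw [Complex.log_im]
        exact (Complex.arg_le_pi x).lt_of_ne (Complex.mem_slitPlane_iff_arg.1 hx).1
    · rintro ⟨ζ, ⟨h1, h2, h3⟩, rfl⟩
      have h2' : -Real.pi < ζ.im := h2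
      have h3' : ζ.im < Real.pi := h3
      have h1' : Real.log R < ζ.re := h1
      refine ⟨?_, ?_⟩
      · rw [Complex.mem_slitPlane_iff_arg, ← Complex.log_im,
          Complex.log_exp h2' h3'.le]
        exact ⟨h3'.ne, Complex.exp_ne_zero _⟩
      · rw [Complex.norm_exp]; exact (Real.log_lt_iff_lt_exp hR).1 h1'
  rw [h]
  refine IsPreconnected.image (Convex.isPreconnected ?_) _ Complex.continuous_exp.continuousOn
  exact (convex_halfSpace_re_gt _).inter ((convex_halfSpace_im_gt _).inter
    (convex_halfSpace_im_lt _))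

theorem add_one_mem_slitPlane {x : ℂ} (hx : x ∈ Complex.slitPlane) :
    x + 1 ∈ Complex.slitPlane := by
  rw [Complex.mem_slitPlane_iff] at hx ⊢
  rcases hx with h | h
  · left; simp; linarith
  · right; simpa using h

section Continuation

variable {Z : ℝ} {k : ℂ}

theorem exists_level (hk : k ≠ 0) : ∃ j : ℕ, 1 ≤ j ∧ k ∈ phaseRegion j := by
  have h0 : 0 < ‖k‖ ^ 2 := by have := norm_pos_iff.2 hk; positivity
  obtain ⟨n, hn⟩ := exists_nat_one_div_lt h0
  exact ⟨n + 1, by omega, by simpa [phaseRegion] using hn⟩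

theorem exists_analyticOnNhd_normalPhaseC (Z : ℝ) (hk : k ≠ 0) :
    ∃ R > 0, AnalyticOnNhd ℂ (normalPhaseC Z k) (slitExterior R) := by
  obtain ⟨j, hj, hkj⟩ := exists_level hk
  have hδ := tailRadius_pos (Z := Z) hj
  refine ⟨1 + (tailRadius Z j)⁻¹, by positivity, DifferentiableOn.analyticOnNhd
    (fun x hx => DifferentiableAt.differentiableWithinAt ?_) (isOpen_slitExterior _)⟩
  have hw := add_one_mem_slitPlane hx.1
  have hw0 := Complex.slitPlane_ne_zero hw
  have hwn : (tailRadius Z j)⁻¹ < ‖x + 1‖ := by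
    have h1 := hx.2
    have h2 := norm_sub_le (x + 1) 1
    rw [add_sub_cancel_right, norm_one] at h2
    linarith
  have hs : (x + 1)⁻¹ ∈ ball (0 : ℂ) (tailRadius Z j) := by
    rw [mem_ball_zero_iff, norm_inv]
    exact inv_lt_of_inv_lt₀ hδ hwn
  have h0 : DifferentiableAt ℂ (fun x : ℂ => x + 1) x := by fun_prop
  have h1 : DifferentiableAt ℂ (fun x : ℂ => (x + 1)⁻¹) x := h0.fun_inv hw0
  have h2 : DifferentiableAt ℂ (fun x : ℂ => phaseTail Z k (x + 1)⁻¹) x :=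
    (hasDerivAt_phaseTail hj hkj hs).differentiableAt.comp x h1
  exact ((((h0.fun_sub h1).div_const 2).const_mul k).fun_add
    (((h0.clog hw).const_mul (Z : ℂ)).div_const (2 * k))).fun_add h2

theorem normalPhaseC_ofReal {x : ℝ} (hx : -1 < x) :
    normalPhaseC Z k x = normalPhase Z k (Real.log (x + 1)) := by
  have h0 : 0 < x + 1 := by linarith
  have h1 : ((x : ℂ) + 1) = ((x + 1 : ℝ) : ℂ) := by push_cast; rfl
  have h2 : Complex.exp (-(Real.log (x + 1) : ℝ)) = ((x : ℂ) + 1)⁻¹ := by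
    rw [h1, ← Complex.ofReal_neg, ← Complex.ofReal_exp, Real.exp_neg, Real.exp_log h0,
      Complex.ofReal_inv]
  rw [normalPhaseC, normalPhase, h2, ← Complex.ofReal_sinh, Real.sinh_log h0, h1,
    Complex.ofReal_log h0.le]
  push_cast
  ring

variable {φ : ℝ → ℂ → ℂ} {c : ℂ → ℂ}

theorem isPhaseContinuation_normalPhaseC
    (h : ∀ k ≠ 0, ∃ X : ℝ, ∀ ξ > X, φ ξ k = c k + normalPhase Z k ξ) :
    IsPhaseContinuation φ fun x k => c k + normalPhaseC Z k x := by
  intro k hk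
  obtain ⟨X, hX⟩ := h k hk
  obtain ⟨R, hR, hRa⟩ := exists_analyticOnNhd_normalPhaseC Z hk
  refine ⟨max R (Real.exp X), lt_max_of_lt_left hR, fun x hx =>
    analyticAt_const.fun_add (hRa x ⟨hx.1, (le_max_left _ _).trans_lt hx.2⟩), fun x hx => ?_⟩
  have hxX : Real.exp X < x := (le_max_right _ _).trans_lt hx
  have hx0 := (Real.exp_pos X).trans hxX
  show c k + normalPhaseC Z k x = _
  rw [hX _ ((Real.lt_log_iff_exp_lt (by linarith)).2 (by linarith)),
    normalPhaseC_ofReal (by linarith)]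

/-- Two continuations agree on a real half-line, hence on the connected exterior of a common disc.
Any admissible `Φ` may therefore be replaced by the explicit form. -/
theorem IsPhaseContinuation.eq_normalPhaseC {Φ : ℂ → ℂ → ℂ} (hΦ : IsPhaseContinuation φ Φ)
    (h : ∀ k ≠ 0, ∃ X : ℝ, ∀ ξ > X, φ ξ k = c k + normalPhase Z k ξ) (hk : k ≠ 0) :
    ∃ R : ℝ, ∀ x ∈ slitExterior R, Φ x k = c k + normalPhaseC Z k x := by
  obtain ⟨R₁, hR₁, ha₁, he₁⟩ := hΦ k hk
  obtain ⟨R₂, hR₂, ha₂, he₂⟩ := isPhaseContinuation_normalPhaseC h k hk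
  obtain ⟨R, hR⟩ : ∃ R, R = max R₁ R₂ := ⟨_, rfl⟩
  have h1 : R₁ ≤ R := hR ▸ le_max_left _ _
  have h2 : R₂ ≤ R := hR ▸ le_max_right _ _
  have hR0 : 0 < R := hR₁.trans_le h1
  have hx₀ : ((R + 1 : ℝ) : ℂ) ∈ slitExterior R := by
    refine ⟨Complex.ofReal_mem_slitPlane.2 (by linarith), ?_⟩
    rw [Complex.norm_real, Real.norm_eq_abs, abs_of_pos (by linarith)]; linarith
  refine ⟨R, AnalyticOnNhd.eqOn_of_preconnected_of_frequently_eq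
    (fun x hx => ha₁ x ⟨hx.1, h1.trans_lt hx.2⟩) (fun x hx => ha₂ x ⟨hx.1, h2.trans_lt hx.2⟩)
    (isPreconnected_slitExterior hR0) hx₀ ?_⟩
  have hlim : Tendsto (fun t : ℝ => (t : ℂ)) (𝓝[>] (R + 1)) (𝓝[≠] ((R + 1 : ℝ) : ℂ)) := by
    refine tendsto_nhdsWithin_iff.2 ⟨(Complex.continuous_ofReal.tendsto _).mono_left
      nhdsWithin_le_nhds, ?_⟩
    filter_upwards [self_mem_nhdsWithin] with t ht
    have : R + 1 < t := ht
    show (t : ℂ) ≠ _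
    exact_mod_cast this.ne'
  refine hlim.frequently (Eventually.frequently ?_)
  filter_upwards [self_mem_nhdsWithin] with t ht
  have : R + 1 < t := ht
  rw [he₁ t (by linarith), ← he₂ t (by linarith)]

end Continuation

/-- The leading part of the phase at infinity. -/
noncomputable def leadingPhase (Z : ℝ) (k x : ℂ) : ℂ :=
  k * (x + 1) / 2 + Z / (2 * k) * Complex.log (x + 1)

theorem tendsto_add_one_cobounded :
    Tendsto (fun x : ℂ => (x + 1)⁻¹) (Bornology.cobounded ℂ) (𝓝 0) :=
  tendsto_inv₀_cobounded.comp (by simp)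

/-- The difference is `-k/(2(x+1))` plus the tail at `1/(x+1)`, and the tail vanishes at `0`. The
limit holds in all directions at once. -/
theorem tendsto_normalPhaseC_sub {Z : ℝ} {k : ℂ} (hk : k ≠ 0) :
    Tendsto (fun x => normalPhaseC Z k x - leadingPhase Z k x) (Bornology.cobounded ℂ) (𝓝 0) := by
  obtain ⟨j, hj, hkj⟩ := exists_level hk
  have h1 : ContinuousAt (phaseTail Z k) 0 :=
    (hasDerivAt_phaseTail hj hkj (mem_ball_self (tailRadius_pos hj))).continuousAt
  have h2 : Tendsto (fun x : ℂ => phaseTail Z k (x + 1)⁻¹) (Bornology.cobounded ℂ) (𝓝 0) := by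
    have := h1.tendsto.comp tendsto_add_one_cobounded
    rwa [phaseTail_zero] at this
  have h3 := (tendsto_add_one_cobounded.const_mul (-(k / 2))).add h2
  rw [mul_zero, add_zero] at h3
  refine h3.congr fun x => ?_
  rw [normalPhaseC, leadingPhase]
  ring

/-! ### Solutions of the radial equation -/

/-- The potential in the variable `ξ`. -/
noncomputable def hyperbolicPotential (Z : ℝ) (μ k ξ : ℂ) : ℂ :=
  k ^ 2 * Complex.cosh ξ ^ 2 + Z * Complex.cosh ξ - μ

section RadialSolutions

variable {Z : ℝ} {μ k : ℂ}

theorem isOpen_radialDomain : IsOpen radialDomain :=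
  Complex.isOpen_slitPlane.preimage (by fun_prop)

theorem isPreconnected_radialDomain : IsPreconnected radialDomain := by
  have h : radialDomain = (fun x => x - 1) '' Complex.slitPlane := by
    ext x
    simp only [radialDomain, mem_image]
    exact ⟨fun h => ⟨x + 1, h, by ring⟩, by rintro ⟨y, hy, rfl⟩; simpa using hy⟩
  rw [h]
  refine IsPreconnected.image ?_ _ (by fun_prop)
  exact (Complex.starConvex_one_slitPlane.isPathConnected
    Complex.one_mem_slitPlane).isConnected.isPreconnected

theorem zero_mem_radialDomain : (0 : ℂ) ∈ radialDomain := by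
  simp [radialDomain, Complex.one_mem_slitPlane]

/-- With `ξ = log(x+1)` one has `(x+1) d/dx = d/dξ`. The hyperbolic equation has entire
coefficients, so its solutions are entire and pull back to the whole slit plane. -/
theorem isRadialSolution_comp_log {v : ℂ → ℂ} (hv : Differentiable ℂ v)
    (hode : ∀ ξ, deriv (deriv v) ξ = -(hyperbolicPotential Z μ k ξ * v ξ)) :
    IsRadialSolution Z μ k (fun x => v (Complex.log (x + 1))) ∧
      ∀ x ∈ radialDomain, deriv (fun x => v (Complex.log (x + 1))) x =
        deriv v (Complex.log (x + 1)) / (x + 1) := by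
  have hlog : ∀ x ∈ radialDomain, HasDerivAt (fun x : ℂ => Complex.log (x + 1)) (x + 1)⁻¹ x :=
    fun x hx => ((Complex.hasDerivAt_log hx).comp_add_const x 1)
  have hd : ∀ x ∈ radialDomain, HasDerivAt (fun x => v (Complex.log (x + 1)))
      (deriv v (Complex.log (x + 1)) / (x + 1)) x := fun x hx =>
    ((hv _).hasDerivAt.comp x (hlog x hx))
  have hv' : Differentiable ℂ (deriv v) := fun z => hv.analyticAt z |>.deriv.differentiableAt
  refine ⟨⟨DifferentiableOn.analyticOnNhd
    (fun x hx => (hd x hx).differentiableAt.differentiableWithinAt) isOpen_radialDomain,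
    fun x hx => ?_⟩, fun x hx => (hd x hx).deriv⟩
  have h1 : (fun y => (y + 1) * deriv (fun x => v (Complex.log (x + 1))) y) =ᶠ[𝓝 x]
      fun y => deriv v (Complex.log (y + 1)) := by
    filter_upwards [isOpen_radialDomain.mem_nhds hx] with y hy
    rw [(hd y hy).deriv, mul_div_cancel₀ _ (Complex.slitPlane_ne_zero hy)]
  have h2 : HasDerivAt (fun y => deriv v (Complex.log (y + 1))) _ x :=
    (hv' _).hasDerivAt.comp x (hlog x hx)
  have hx0 : x + 1 ≠ 0 := Complex.slitPlane_ne_zero hx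
  rw [h1.deriv_eq, h2.deriv, hode]
  have hc : Complex.cosh (Complex.log (x + 1)) = ((x + 1) + (x + 1)⁻¹) / 2 := by
    rw [Complex.cosh, Complex.exp_neg, Complex.exp_log hx0]
  rw [hyperbolicPotential, hc, radialPotential]
  field_simp
  ring

theorem IsRadialSolution.hasDerivAt {u : ℂ → ℂ} (hu : IsRadialSolution Z μ k u) {x : ℂ}
    (hx : x ∈ radialDomain) : HasDerivAt u (deriv u x) x ∧
      HasDerivAt (fun y => (y + 1) * deriv u y) (-(radialPotential Z μ k x * u x)) x := by
  refine ⟨(hu.analytic x hx).differentiableAt.hasDerivAt, ?_⟩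
  have h1 : DifferentiableAt ℂ (fun y => (y + 1) * deriv u y) x :=
    DifferentiableAt.fun_mul (by fun_prop) (hu.analytic x hx).deriv.differentiableAt
  have h2 := hu.ode x hx
  have h3 := h1.hasDerivAt
  rwa [eq_neg_of_add_eq_zero_left h2] at h3

theorem IsRadialSolution.wronskian_eq {u v : ℂ → ℂ} (hu : IsRadialSolution Z μ k u)
    (hv : IsRadialSolution Z μ k v) {x y : ℂ} (hx : x ∈ radialDomain) (hy : y ∈ radialDomain) :
    wronskian u v x = wronskian u v y := by
  have hd : ∀ x ∈ radialDomain, HasDerivAt (wronskian u v) 0 x := fun x hx => by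
    have h1 := ((hu.hasDerivAt hx).1.fun_mul (hv.hasDerivAt hx).2).fun_sub
      ((hu.hasDerivAt hx).2.fun_mul (hv.hasDerivAt hx).1)
    have h2 : wronskian u v = fun y => u y * ((y + 1) * deriv v y) -
        (y + 1) * deriv u y * v y := by funext y; rw [wronskian]; ring
    rw [h2]
    exact h1.congr_deriv (by ring)
  exact isOpen_radialDomain.is_const_of_deriv_eq_zero isPreconnected_radialDomain
    (fun x hx => (hd x hx).differentiableAt.differentiableWithinAt)
    (fun x hx => (hd x hx).deriv) hx hy

/-- Cramer's rule: the coefficients are the constant Wronskians with the basis, evaluated at `0`. -/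
theorem IsRadialSolution.eq_basis {u c s : ℂ → ℂ} (hu : IsRadialSolution Z μ k u)
    (hc : IsRadialSolution Z μ k c) (hs : IsRadialSolution Z μ k s) (hc₀ : c 0 = 1)
    (hc₁ : deriv c 0 = 0) (hs₀ : s 0 = 0) (hs₁ : deriv s 0 = 1) {x : ℂ}
    (hx : x ∈ radialDomain) : u x = u 0 * c x + deriv u 0 * s x := by
  have h1 := hu.wronskian_eq hs hx zero_mem_radialDomain
  have h2 := hu.wronskian_eq hc hx zero_mem_radialDomain
  have h3 := hc.wronskian_eq hs hx zero_mem_radialDomain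
  simp only [wronskian, hc₀, hc₁, hs₀, hs₁] at h1 h2 h3
  linear_combination c x * h1 - s x * h2 - u x * h3

end RadialSolutions

/-- A complex l'Hôpital rule against a growing exponential. -/
theorem tendsto_mul_exp_neg {g g' e e' : ℝ → ℂ} {a L : ℂ} (ha : 0 < a.re)
    (hg : ∀ᶠ t in atTop, HasDerivAt g (g' t) t) (he : ∀ᶠ t in atTop, HasDerivAt e (e' t) t)
    (he' : Tendsto e' atTop (𝓝 a))
    (hlim : Tendsto (fun t => g' t * Complex.exp (-e t)) atTop (𝓝 (a * L))) :
    Tendsto (fun t => g t * Complex.exp (-e t)) atTop (𝓝 L) := by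
  -- Any rate strictly between `0` and `Re a` would serve: eventually `Re e'` exceeds it, so
  -- `exp(-Re e) → 0`.
  obtain ⟨c, hc⟩ : ∃ c, c = a.re / 2 := ⟨_, rfl⟩
  have hc0 : 0 < c := by linarith
  have hre : ∀ᶠ t in atTop, c < (e' t).re :=
    ((Complex.continuous_re.tendsto a).comp he').eventually (lt_mem_nhds (by linarith))
  have hred : ∀ {t}, HasDerivAt e (e' t) t → HasDerivAt (fun t => (e t).re) (e' t).re t :=
    fun h => (Complex.reCLM.hasFDerivAt.comp_hasDerivAt _ h)
  have hgrow : Tendsto (fun t => Real.exp (-(e t).re)) atTop (𝓝 0) := by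
    obtain ⟨T, hT⟩ := eventually_atTop.1 (he.and hre)
    have hmono : MonotoneOn (fun t => (e t).re - c * t) (Ici T) := by
      have hd : ∀ t ∈ Ici T, HasDerivAt (fun t => (e t).re - c * t) ((e' t).re - c * 1) t :=
        fun t ht => (hred (hT t ht).1).fun_sub ((hasDerivAt_id t).const_mul c)
      refine monotoneOn_of_deriv_nonneg (convex_Ici T)
        (fun t ht => (hd t ht).continuousAt.continuousWithinAt)
        (fun t ht => (hd t (interior_subset ht)).differentiableAt.differentiableWithinAt)
        fun t ht => ?_
      rw [(hd t (interior_subset ht)).deriv]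
      linarith [(hT t (interior_subset ht)).2]
    refine Real.tendsto_exp_atBot.comp (tendsto_neg_atTop_atBot.comp ?_)
    refine tendsto_atTop_mono' _ ?_ (tendsto_atTop_add_const_left _ ((e T).re - c * T)
      (tendsto_id.const_mul_atTop hc0))
    filter_upwards [eventually_ge_atTop T] with t ht
    have := hmono self_mem_Ici ht ht
    simp only [id] at this ⊢
    linarith
  have hrho : Tendsto (fun t => g' t * Complex.exp (-e t) - e' t * L) atTop (𝓝 0) := by
    simpa using hlim.sub (he'.mul_const L)
  rw [Metric.tendsto_atTop']
  intro ε hε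
  have h1 : ∀ᶠ t in atTop, ‖g' t * Complex.exp (-e t) - e' t * L‖ < ε / 2 * c := by
    have := hrho.norm
    rw [norm_zero] at this
    exact this.eventually (gt_mem_nhds (by positivity))
  obtain ⟨T, hT⟩ := eventually_atTop.1 ((hg.and he).and (hre.and h1))
  have hexp : ∀ t, Complex.exp (-e t) * Complex.exp (e t) = 1 := fun t => by
    rw [← Complex.exp_add, neg_add_cancel, Complex.exp_zero]
  -- Subtracting the expected `L exp(e)` leaves a derivative of size `o(1) exp(Re e)`. The boundary
  -- function `(ε/2) exp(Re e)` grows at least that fast, so it controls the difference up to a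
  -- constant, which the exponential then absorbs.
  have hD : ∀ t ≥ T, HasDerivAt (fun t => g t - L * Complex.exp (e t))
      ((g' t * Complex.exp (-e t) - e' t * L) * Complex.exp (e t)) t := fun t ht => by
    refine ((hT t ht).1.1.fun_sub ((hT t ht).1.2.cexp.const_mul L)).congr_deriv ?_
    linear_combination -g' t * hexp t
  have hB : ∀ t ≥ T, HasDerivAt (fun t => ‖g T - L * Complex.exp (e T)‖ +
      ε / 2 * Real.exp (e t).re) (ε / 2 * (Real.exp (e t).re * (e' t).re)) t := fun t ht =>
    (((hred (hT t ht).1.2).exp).const_mul (ε / 2)).const_add _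
  have hbd : ∀ t ≥ T, ‖g t - L * Complex.exp (e t)‖ ≤ ‖g T - L * Complex.exp (e T)‖ +
      ε / 2 * Real.exp (e t).re := fun t ht =>
    image_norm_le_of_norm_deriv_right_le_deriv_boundary'
      (B := fun t => ‖g T - L * Complex.exp (e T)‖ + ε / 2 * Real.exp (e t).re)
      (B' := fun t => ε / 2 * (Real.exp (e t).re * (e' t).re))
      (fun s hs => (hD s hs.1).continuousAt.continuousWithinAt)
      (fun s hs => (hD s hs.1).hasDerivWithinAt)
      (le_add_of_nonneg_right (by positivity))
      (fun s hs => (hB s hs.1).continuousAt.continuousWithinAt)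
      (fun s hs => (hB s hs.1).hasDerivWithinAt)
      (fun s hs => by
        have h2 := (hT s hs.1).2
        rw [norm_mul, Complex.norm_exp]
        have h3 : 0 < Real.exp (e s).re := Real.exp_pos _
        calc _ ≤ ε / 2 * c * Real.exp (e s).re := by gcongr; exact h2.2.le
          _ ≤ ε / 2 * (e' s).re * Real.exp (e s).re := by gcongr; exact h2.1.le
          _ = _ := by ring) (right_mem_Icc.2 ht)
  have h2 : ∀ᶠ t in atTop, ‖g T - L * Complex.exp (e T)‖ * Real.exp (-(e t).re) < ε / 2 := by
    have := hgrow.const_mul ‖g T - L * Complex.exp (e T)‖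
    rw [mul_zero] at this
    exact this.eventually (gt_mem_nhds (by positivity))
  obtain ⟨T', hT'⟩ := eventually_atTop.1 h2
  refine ⟨max T T', fun t ht => ?_⟩
  have htT : T ≤ t := (le_max_left _ _).trans ht.le
  have htT' : T' ≤ t := (le_max_right _ _).trans ht.le
  rw [dist_eq_norm]
  have h3 : g t * Complex.exp (-e t) - L = (g t - L * Complex.exp (e t)) * Complex.exp (-e t) := by
    linear_combination L * hexp t
  have h4 : Real.exp (e t).re * Real.exp (-(e t).re) = 1 := by
    rw [← Real.exp_add, add_neg_cancel, Real.exp_zero]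
  rw [h3, norm_mul, Complex.norm_exp, Complex.neg_re]
  calc _ ≤ (‖g T - L * Complex.exp (e T)‖ + ε / 2 * Real.exp (e t).re) *
        Real.exp (-(e t).re) := by gcongr; exact hbd t htT
    _ = ‖g T - L * Complex.exp (e T)‖ * Real.exp (-(e t).re) + ε / 2 := by
        linear_combination ε / 2 * h4
    _ < ε := by linarith [hT' t htT']

/-! ### The fundamental system -/

section Basis

theorem exists_hyperbolicSolution (Z : ℝ) (μ a b : ℂ) :
    ∃ v : ℂ → ℂ → ℂ, (∀ k, Differentiable ℂ (v k)) ∧ (∀ z, Differentiable ℂ fun k => v k z) ∧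
      (∀ r : ℝ, ∃ M : ℝ, ∀ k z : ℂ, ‖k‖ ≤ r → ‖z‖ ≤ r → ‖v k z‖ ≤ M) ∧
      (∀ k z, deriv (deriv (v k)) z = -(hyperbolicPotential Z μ k z * v k z)) ∧
      ∀ k, v k 0 = a ∧ deriv (v k) 0 = b := by
  refine exists_entire_solution (q := hyperbolicPotential Z μ) (fun k => ?_) (fun z => ?_)
    (fun r => ?_) a b
  · unfold hyperbolicPotential; fun_prop
  · unfold hyperbolicPotential; fun_prop
  · have hc : Continuous fun x : ℂ × ℂ => hyperbolicPotential Z μ x.1 x.2 := by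
      unfold hyperbolicPotential; fun_prop
    obtain ⟨M, hM⟩ := ((isCompact_closedBall (0 : ℂ) r).prod
      (isCompact_closedBall (0 : ℂ) r)).exists_bound_of_continuousOn hc.continuousOn
    exact ⟨M, fun k z hk hz => hM (k, z) ⟨by simpa using hk, by simpa using hz⟩⟩

/-- The solution of `v'' + (k² cosh² ξ + Z cosh ξ - μ) v = 0` with `v(0) = a`, `v'(0) = b`. -/
noncomputable def hyperbolicSolution (Z : ℝ) (μ a b : ℂ) : ℂ → ℂ → ℂ :=
  (exists_hyperbolicSolution Z μ a b).choose

variable {Z : ℝ} {μ a b k : ℂ}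

theorem differentiable_hyperbolicSolution : Differentiable ℂ (hyperbolicSolution Z μ a b k) :=
  (exists_hyperbolicSolution Z μ a b).choose_spec.1 k

theorem differentiable_hyperbolicSolution_param (z : ℂ) :
    Differentiable ℂ fun k => hyperbolicSolution Z μ a b k z :=
  (exists_hyperbolicSolution Z μ a b).choose_spec.2.1 z

theorem hyperbolicSolution_bounded (Z : ℝ) (μ a b : ℂ) (r : ℝ) : ∃ M : ℝ, ∀ k z : ℂ,
    ‖k‖ ≤ r → ‖z‖ ≤ r → ‖hyperbolicSolution Z μ a b k z‖ ≤ M :=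
  (exists_hyperbolicSolution Z μ a b).choose_spec.2.2.1 r

theorem deriv_deriv_hyperbolicSolution (z : ℂ) :
    deriv (deriv (hyperbolicSolution Z μ a b k)) z =
      -(hyperbolicPotential Z μ k z * hyperbolicSolution Z μ a b k z) :=
  (exists_hyperbolicSolution Z μ a b).choose_spec.2.2.2.1 k z

theorem hyperbolicSolution_zero : hyperbolicSolution Z μ a b k 0 = a :=
  ((exists_hyperbolicSolution Z μ a b).choose_spec.2.2.2.2 k).1

theorem deriv_hyperbolicSolution_zero : deriv (hyperbolicSolution Z μ a b k) 0 = b :=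
  ((exists_hyperbolicSolution Z μ a b).choose_spec.2.2.2.2 k).2

theorem hasDerivAt_hyperbolicSolution (z : ℂ) :
    HasDerivAt (hyperbolicSolution Z μ a b k) (deriv (hyperbolicSolution Z μ a b k) z) z :=
  (differentiable_hyperbolicSolution z).hasDerivAt

theorem hasDerivAt_deriv_hyperbolicSolution (z : ℂ) :
    HasDerivAt (deriv (hyperbolicSolution Z μ a b k))
      (-(hyperbolicPotential Z μ k z * hyperbolicSolution Z μ a b k z)) z := by
  rw [← deriv_deriv_hyperbolicSolution]
  exact (differentiable_hyperbolicSolution.analyticAt z).deriv.differentiableAt.hasDerivAt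

theorem hyperbolic_wronskian (z : ℂ) :
    hyperbolicSolution Z μ 1 0 k z * deriv (hyperbolicSolution Z μ 0 1 k) z -
      deriv (hyperbolicSolution Z μ 1 0 k) z * hyperbolicSolution Z μ 0 1 k z = 1 := by
  have hd : ∀ z, HasDerivAt (fun z => hyperbolicSolution Z μ 1 0 k z *
      deriv (hyperbolicSolution Z μ 0 1 k) z - deriv (hyperbolicSolution Z μ 1 0 k) z *
        hyperbolicSolution Z μ 0 1 k z) 0 z := fun z =>
    (((hasDerivAt_hyperbolicSolution z).fun_mul (hasDerivAt_deriv_hyperbolicSolution z)).fun_sub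
      ((hasDerivAt_deriv_hyperbolicSolution z).fun_mul
        (hasDerivAt_hyperbolicSolution z))).congr_deriv (by ring)
  have h := is_const_of_deriv_eq_zero (fun z => (hd z).differentiableAt) (fun z => (hd z).deriv) z 0
  simpa [hyperbolicSolution_zero, deriv_hyperbolicSolution_zero] using h

/-- The solution of the radial equation with `u(0) = a`, `u'(0) = b`. -/
noncomputable def radialSolution (Z : ℝ) (μ a b k x : ℂ) : ℂ :=
  hyperbolicSolution Z μ a b k (Complex.log (x + 1))

theorem isRadialSolution_radialSolution : IsRadialSolution Z μ k (radialSolution Z μ a b k) :=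
  (isRadialSolution_comp_log differentiable_hyperbolicSolution
    deriv_deriv_hyperbolicSolution).1

theorem radialSolution_zero : radialSolution Z μ a b k 0 = a := by
  simp [radialSolution, hyperbolicSolution_zero]

theorem deriv_radialSolution_zero : deriv (radialSolution Z μ a b k) 0 = b := by
  have := (isRadialSolution_comp_log (v := hyperbolicSolution Z μ a b k) (Z := Z) (μ := μ)
    (k := k) differentiable_hyperbolicSolution deriv_deriv_hyperbolicSolution).2 0
    zero_mem_radialDomain
  simpa [deriv_hyperbolicSolution_zero] using! this

theorem IsRadialSolution.eq_radialSolution {u : ℂ → ℂ} (hu : IsRadialSolution Z μ k u) {x : ℂ}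
    (hx : x ∈ radialDomain) : u x =
      u 0 * radialSolution Z μ 1 0 k x + deriv u 0 * radialSolution Z μ 0 1 k x :=
  hu.eq_basis isRadialSolution_radialSolution isRadialSolution_radialSolution radialSolution_zero
    deriv_radialSolution_zero radialSolution_zero deriv_radialSolution_zero hx

end Basis

/-! ### Growth and decay along rays -/

section Ray

/-- The point at distance `t` on the ray of argument `γ`. -/
noncomputable def rayPoint (γ t : ℝ) : ℂ := Complex.exp (Complex.I * γ) * t

variable {γ : ℝ}

theorem hasDerivAt_rayPoint (γ t : ℝ) : HasDerivAt (rayPoint γ) (Complex.exp (Complex.I * γ)) t :=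
  ((Complex.ofRealCLM.hasDerivAt (x := t)).const_mul (Complex.exp (Complex.I * γ))).congr_deriv
    (by simp)

theorem norm_rayPoint {t : ℝ} (ht : 0 < t) : ‖rayPoint γ t‖ = t := by
  rw [rayPoint, norm_mul, mul_comm Complex.I, Complex.norm_exp_ofReal_mul_I, one_mul,
    Complex.norm_real, Real.norm_eq_abs, abs_of_pos ht]

theorem log_exp_I_mul (hγ₁ : -Real.pi < γ) (hγ₂ : γ < Real.pi) :
    Complex.log (Complex.exp (Complex.I * γ)) = Complex.I * γ :=
  Complex.log_exp (by simpa using hγ₁) (by simpa using hγ₂.le)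

theorem exp_I_mul_mem_slitPlane (hγ₁ : -Real.pi < γ) (hγ₂ : γ < Real.pi) :
    Complex.exp (Complex.I * γ) ∈ Complex.slitPlane := by
  rw [Complex.mem_slitPlane_iff_arg, ← Complex.log_im, log_exp_I_mul hγ₁ hγ₂]
  exact ⟨by simpa using hγ₂.ne, Complex.exp_ne_zero _⟩

theorem rayPoint_mem_slitPlane (hγ₁ : -Real.pi < γ) (hγ₂ : γ < Real.pi) {t : ℝ} (ht : 0 < t) :
    rayPoint γ t ∈ Complex.slitPlane := by
  have h := exp_I_mul_mem_slitPlane hγ₁ hγ₂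
  rw [Complex.mem_slitPlane_iff] at h ⊢
  rw [rayPoint, Complex.re_mul_ofReal, Complex.im_mul_ofReal]
  exact h.imp (fun h => by positivity) (fun h => by positivity)

theorem rayPoint_mem_radialDomain (hγ₁ : -Real.pi < γ) (hγ₂ : γ < Real.pi) {t : ℝ} (ht : 0 < t) :
    rayPoint γ t ∈ radialDomain :=
  add_one_mem_slitPlane (rayPoint_mem_slitPlane hγ₁ hγ₂ ht)

theorem tendsto_rayPoint (γ : ℝ) : Tendsto (rayPoint γ) atTop (Bornology.cobounded ℂ) := by
  rw [← tendsto_norm_atTop_iff_cobounded]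
  refine tendsto_id.congr' ?_
  filter_upwards [eventually_gt_atTop 0] with t ht
  rw [norm_rayPoint ht]; rfl

theorem tendsto_log_rayPoint (hγ₁ : -Real.pi < γ) (hγ₂ : γ < Real.pi) :
    Tendsto (fun t : ℝ => Complex.log (rayPoint γ t + 1) - (Real.log t : ℝ)) atTop
      (𝓝 (Complex.I * γ)) := by
  have hE := exp_I_mul_mem_slitPlane hγ₁ hγ₂
  have h1 : Tendsto (fun t : ℝ => Complex.exp (Complex.I * γ) + ((t⁻¹ : ℝ) : ℂ)) atTop
      (𝓝 (Complex.exp (Complex.I * γ))) := by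
    have := (Complex.continuous_ofReal.tendsto 0).comp tendsto_inv_atTop_zero
    simpa using! this.const_add (Complex.exp (Complex.I * γ))
  have h2 := (continuousAt_clog hE).tendsto.comp h1
  rw [log_exp_I_mul hγ₁ hγ₂] at h2
  refine h2.congr' ?_
  filter_upwards [eventually_gt_atTop 0] with t ht
  have ht0 : (t : ℂ) ≠ 0 := by exact_mod_cast ht.ne'
  have h3 : rayPoint γ t + 1 = t * (Complex.exp (Complex.I * γ) + ((t⁻¹ : ℝ) : ℂ)) := by
    rw [rayPoint]; push_cast; field_simp
  have h4 : Complex.exp (Complex.I * γ) + ((t⁻¹ : ℝ) : ℂ) ≠ 0 := fun h0 => by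
    have := Complex.slitPlane_ne_zero (rayPoint_mem_radialDomain hγ₁ hγ₂ ht)
    rw [h3, h0, mul_zero] at this
    exact this rfl
  rw [h3, Complex.log_ofReal_mul ht h4, add_sub_cancel_left]
  rfl

variable {Z : ℝ} {μ p k : ℂ}

/-- `-2iΘ` is the exponent governing the quotient of a growing by a decaying solution. Its limiting
slope has real part `Im(p exp(iγ))`, the quantity whose positivity the l'Hôpital rule uses. -/
theorem exists_deriv_leadingPhase (hγ₁ : -Real.pi < γ) (hγ₂ : γ < Real.pi) :
    ∃ e' : ℝ → ℂ, (∀ᶠ t in atTop, HasDerivAt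
        (fun t => -(2 * Complex.I * leadingPhase Z p (rayPoint γ t))) (e' t) t) ∧
      Tendsto e' atTop (𝓝 (-(Complex.I * (p * Complex.exp (Complex.I * γ))))) := by
  refine ⟨fun t => -(2 * Complex.I * ((p / 2 + Z / (2 * p) * (rayPoint γ t + 1)⁻¹) *
    Complex.exp (Complex.I * γ))), ?_, ?_⟩
  · filter_upwards [eventually_gt_atTop 0] with t ht
    have h1 := (hasDerivAt_rayPoint γ t).add_const 1
    have h2 := (Complex.hasDerivAt_log (rayPoint_mem_radialDomain hγ₁ hγ₂ ht)).scomp t h1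
    have h3 := (((h1.const_mul p).div_const 2).fun_add (h2.const_mul (Z / (2 * p)))).const_mul
      (2 * Complex.I) |>.fun_neg
    refine h3.congr_deriv ?_
    simp only [smul_eq_mul]
    ring
  · have h1 := tendsto_add_one_cobounded.comp (tendsto_rayPoint γ)
    have h2 := ((((h1.const_mul (Z / (2 * p))).const_add (p / 2)).mul_const
      (Complex.exp (Complex.I * γ))).const_mul (2 * Complex.I)).neg
    have h3 : -(Complex.I * (p * Complex.exp (Complex.I * γ))) = -(2 * Complex.I *
        ((p / 2 + Z / (2 * p) * 0) * Complex.exp (Complex.I * γ))) := by ring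
    rw [h3]
    exact h2

theorem re_neg_I_mul (z : ℂ) : (-(Complex.I * z)).re = z.im := by simp

/-- A solution with decaying leading behaviour on a ray determines, through the Wronskian, the
growth of every other solution on this ray. -/
theorem tendsto_ray_of_decaying (hp : p ≠ 0) (hγ₁ : -Real.pi < γ) (hγ₂ : γ < Real.pi)
    (hpos : 0 < (p * Complex.exp (Complex.I * γ)).im) {u s : ℂ → ℂ}
    (hu : IsRadialSolution Z μ k u) (hs : IsRadialSolution Z μ k s) {n : ℂ} (hn : n ≠ 0)
    (hlim : Tendsto (fun t => u (rayPoint γ t) * Complex.exp (Complex.log (rayPoint γ t + 1) / 2 -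
      Complex.I * leadingPhase Z p (rayPoint γ t))) atTop (𝓝 n)) :
    Tendsto (fun t => s (rayPoint γ t) * Complex.exp (Complex.log (rayPoint γ t + 1) / 2 +
      Complex.I * leadingPhase Z p (rayPoint γ t))) atTop
        (𝓝 (wronskian u s 0 / (-(Complex.I * p) * n))) := by
  obtain ⟨e', he, he'⟩ := exists_deriv_leadingPhase (Z := Z) (p := p) hγ₁ hγ₂
  obtain ⟨E, hE⟩ : ∃ E, E = Complex.exp (Complex.I * γ) := ⟨_, rfl⟩
  have hE0 : E ≠ 0 := hE ▸ Complex.exp_ne_zero _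
  have hu0 : ∀ᶠ t in atTop, u (rayPoint γ t) ≠ 0 :=
    (hlim.eventually_ne hn).mono fun t ht h0 => ht (by rw [h0, zero_mul])
  -- The quotient rule and constancy of the Wronskian give `(s/u)' = W/((x+1)u²)`, and `(x+1)u² ~ n²
  -- exp(2iΘ)`. Dividing by the slope `-ip` of the exponent gives the limit; the direction factor
  -- `exp(iγ)` cancels.
  have key := tendsto_mul_exp_neg (a := -(Complex.I * (p * E)))
    (L := wronskian u s 0 / (-(Complex.I * p) * n ^ 2))
    (g := fun t => s (rayPoint γ t) / u (rayPoint γ t))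
    (g' := fun t => E * ((deriv s (rayPoint γ t) * u (rayPoint γ t) -
      s (rayPoint γ t) * deriv u (rayPoint γ t)) / u (rayPoint γ t) ^ 2))
    (by rw [re_neg_I_mul, hE]; exact hpos) ?_ he (by rw [hE]; exact he') ?_
  · have h1 := key.mul hlim
    have h2 : wronskian u s 0 / (-(Complex.I * p) * n ^ 2) * n =
        wronskian u s 0 / (-(Complex.I * p) * n) := by
      have := Complex.I_ne_zero
      field_simp
    rw [h2] at h1
    refine h1.congr' ?_
    filter_upwards [hu0] with t ht
    have h3 : Complex.exp (Complex.log (rayPoint γ t + 1) / 2 +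
        Complex.I * leadingPhase Z p (rayPoint γ t)) =
        Complex.exp (- -(2 * Complex.I * leadingPhase Z p (rayPoint γ t))) *
          Complex.exp (Complex.log (rayPoint γ t + 1) / 2 -
            Complex.I * leadingPhase Z p (rayPoint γ t)) := by
      rw [← Complex.exp_add]; ring_nf
    rw [h3]
    field_simp
  · filter_upwards [hu0, eventually_gt_atTop 0] with t hut ht
    have hd := rayPoint_mem_radialDomain hγ₁ hγ₂ ht
    have h1 := ((hs.hasDerivAt hd).1.fun_div (hu.hasDerivAt hd).1 hut).scomp t
      (hasDerivAt_rayPoint γ t)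
    rw [hE]
    exact h1
  · have h1 := (hlim.pow 2).inv₀ (pow_ne_zero 2 hn) |>.const_mul (E * wronskian u s 0)
    have h2 : -(Complex.I * (p * E)) * (wronskian u s 0 / (-(Complex.I * p) * n ^ 2)) =
        E * wronskian u s 0 * (n ^ 2)⁻¹ := by
      have := Complex.I_ne_zero
      field_simp
    rw [h2]
    refine h1.congr' ?_
    filter_upwards [hu0, eventually_gt_atTop 0] with t hut ht
    have hd := rayPoint_mem_radialDomain hγ₁ hγ₂ ht
    have hw0 := Complex.slitPlane_ne_zero hd
    have h3 : Complex.exp (Complex.log (rayPoint γ t + 1) / 2 -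
        Complex.I * leadingPhase Z p (rayPoint γ t)) ^ 2 *
          Complex.exp (- -(2 * Complex.I * leadingPhase Z p (rayPoint γ t))) =
            rayPoint γ t + 1 := by
      rw [← Complex.exp_nat_mul, ← Complex.exp_add]
      refine (congrArg Complex.exp ?_).trans (Complex.exp_log hw0)
      push_cast
      ring
    have h4 := Complex.exp_ne_zero (Complex.log (rayPoint γ t + 1) / 2 -
        Complex.I * leadingPhase Z p (rayPoint γ t))
    rw [hu.wronskian_eq hs zero_mem_radialDomain hd, wronskian]
    generalize Complex.exp (Complex.log (rayPoint γ t + 1) / 2 -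
        Complex.I * leadingPhase Z p (rayPoint γ t)) = q at h3 h4 ⊢
    rw [← h3]
    field_simp

/-- A nonzero Wronskian would force `s` to grow, by `tendsto_ray_of_decaying`. So the two solutions
are proportional, and the common nonzero limit makes the factor one. -/
theorem eq_of_decaying (hp : p ≠ 0) (hγ₁ : -Real.pi < γ) (hγ₂ : γ < Real.pi)
    (hpos : 0 < (p * Complex.exp (Complex.I * γ)).im) {u s : ℂ → ℂ}
    (hu : IsRadialSolution Z μ k u) (hs : IsRadialSolution Z μ k s) {n : ℂ} (hn : n ≠ 0)
    (hulim : Tendsto (fun t => u (rayPoint γ t) * Complex.exp (Complex.log (rayPoint γ t + 1) / 2 -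
      Complex.I * leadingPhase Z p (rayPoint γ t))) atTop (𝓝 n))
    (hslim : Tendsto (fun t => s (rayPoint γ t) * Complex.exp (Complex.log (rayPoint γ t + 1) / 2 -
      Complex.I * leadingPhase Z p (rayPoint γ t))) atTop (𝓝 n)) :
    u 0 = s 0 ∧ deriv u 0 = deriv s 0 ∧ ∀ x ∈ radialDomain, u x = s x := by
  obtain ⟨e', he, he'⟩ := exists_deriv_leadingPhase (Z := Z) (p := p) hγ₁ hγ₂
  -- Applied to the constant `1`, the rule says that `exp(2iΘ)` tends to zero along the ray.
  have h0 := tendsto_mul_exp_neg (g := fun _ => 1) (g' := fun _ => 0) (L := 0)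
    (by rw [re_neg_I_mul]; exact hpos) (Eventually.of_forall fun t => hasDerivAt_const _ _) he he'
    (by simp)
  have h1 := tendsto_ray_of_decaying hp hγ₁ hγ₂ hpos hu hs hn hulim
  have h2 : wronskian u s 0 / (-(Complex.I * p) * n) = 0 := by
    refine tendsto_nhds_unique h1 ?_
    have h3 := h0.mul hslim
    rw [zero_mul] at h3
    refine h3.congr fun t => ?_
    rw [one_mul, mul_left_comm, ← Complex.exp_add]
    ring_nf
  have hW : wronskian u s 0 = 0 := by
    refine (div_eq_zero_iff.1 h2).resolve_right (mul_ne_zero (neg_ne_zero.2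
      (mul_ne_zero Complex.I_ne_zero hp)) hn)
  simp only [wronskian, zero_add, one_mul] at hW
  have hray : ∀ᶠ t in atTop, rayPoint γ t ∈ radialDomain :=
    (eventually_gt_atTop 0).mono fun t ht => rayPoint_mem_radialDomain hγ₁ hγ₂ ht
  -- Vanishing of the Wronskian gives `u 0 * s = s 0 * u` and the same relation for the derivatives
  -- at `0`. Passing to the limit on the ray compares the coefficients without assuming any of them
  -- nonzero.
  have hcomb : ∀ α β : ℂ, (∀ x ∈ radialDomain, α * s x = β * u x) → α = β := fun α β h => by
    refine mul_right_cancel₀ hn (tendsto_nhds_unique_of_eventuallyEq (hslim.const_mul α)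
      (hulim.const_mul β) ?_)
    filter_upwards [hray] with t ht
    rw [← mul_assoc, ← mul_assoc, h _ ht]
  have e1 : u 0 = s 0 := hcomb _ _ fun x hx => by
    rw [hu.eq_radialSolution hx, hs.eq_radialSolution hx]
    linear_combination radialSolution Z μ 0 1 k x * hW
  have e2 : deriv u 0 = deriv s 0 := hcomb _ _ fun x hx => by
    rw [hu.eq_radialSolution hx, hs.eq_radialSolution hx]
    linear_combination -radialSolution Z μ 1 0 k x * hW
  exact ⟨e1, e2, fun x hx => by rw [hu.eq_radialSolution hx, hs.eq_radialSolution hx, e1, e2]⟩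

end Ray

/-! ### The Jost wave in the variable `z = exp κ (x + 1)` -/

/-- The exponent of the power in the Jost asymptotics, in the coordinate `κ = log k`. -/
noncomputable def jostExponent (Z : ℝ) (κ : ℂ) : ℂ := Z / (2 * Complex.exp κ)

/-- The short range remainder in the equation for the Jost amplitude. -/
noncomputable def jostRemainder (Z : ℝ) (μ κ z : ℂ) : ℂ :=
  (Complex.exp κ ^ 2 / 2 - μ + 1 / 4 - jostExponent Z κ ^ 2 - Complex.I * jostExponent Z κ) / z ^ 2
    + Z * Complex.exp κ / 2 / z ^ 3 + Complex.exp κ ^ 4 / 4 / z ^ 4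

/-- The Jost wave with amplitude `m`. -/
noncomputable def jostWave (Z : ℝ) (κ : ℂ) (m : ℂ → ℂ) (z : ℂ) : ℂ :=
  Complex.exp (Complex.I * z / 2 + (Complex.I * jostExponent Z κ - 1 / 2) * upperLog z) * m z

/-- The logarithmic derivative `z d/dz` of the Jost wave with amplitude `m`. -/
noncomputable def jostWaveDeriv (Z : ℝ) (κ : ℂ) (m : ℂ → ℂ) (z : ℂ) : ℂ :=
  Complex.exp (Complex.I * z / 2 + (Complex.I * jostExponent Z κ - 1 / 2) * upperLog z) *
    ((Complex.I * z / 2 + Complex.I * jostExponent Z κ - 1 / 2) * m z + z * deriv m z)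

section Wave

variable {Z : ℝ} {μ κ : ℂ} {m : ℂ → ℂ} {R : ℝ}

theorem continuous_jostExponent : Continuous (jostExponent Z) := by
  unfold jostExponent
  exact continuous_const.div (by fun_prop) fun κ => mul_ne_zero two_ne_zero (Complex.exp_ne_zero κ)

theorem differentiable_jostExponent : Differentiable ℂ (jostExponent Z) := by
  unfold jostExponent
  exact (differentiable_const _).div (by fun_prop) fun κ =>
    mul_ne_zero two_ne_zero (Complex.exp_ne_zero κ)

/-- In the variable `z` the quadratic term is independent of `κ` and the linear one has coefficient
`a`. The prefactor `exp(iz/2) z^(ia-1/2)` is designed to remove exactly these two. -/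
theorem hyperbolicPotential_upperLog {z : ℂ} (hz : z ≠ 0) :
    hyperbolicPotential Z μ (Complex.exp κ) (upperLog z - κ) =
      z ^ 2 / 4 + jostExponent Z κ * z + Complex.exp κ ^ 2 / 2 - μ +
        Z * Complex.exp κ / 2 / z + Complex.exp κ ^ 4 / 4 / z ^ 2 := by
  have hp := Complex.exp_ne_zero κ
  have hc : Complex.cosh (upperLog z - κ) = (z / Complex.exp κ + Complex.exp κ / z) / 2 := by
    rw [Complex.cosh, neg_sub, Complex.exp_sub, Complex.exp_sub, exp_upperLog hz]
  rw [hyperbolicPotential, hc, jostExponent]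
  field_simp
  ring

/-- The amplitude equation is equivalent to `(z d/dz)² w = -Q w` for the wave, where `z d/dz =
d/dξ`. The wave is kept as a first order system so that it can be paired with the entire solutions.
-/
theorem hasDerivAt_jostWave (hR : 0 < R) (hm : DifferentiableOn ℂ m (aboveWedge R))
    (hode : ∀ z ∈ aboveWedge R, deriv (deriv m) z =
      -(Complex.I + 2 * Complex.I * jostExponent Z κ / z) * deriv m z -
        jostRemainder Z μ κ z * m z) {z : ℂ} (hz : z ∈ aboveWedge R) :
    HasDerivAt (jostWave Z κ m) (jostWaveDeriv Z κ m z / z) z ∧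
      HasDerivAt (jostWaveDeriv Z κ m)
        (-(hyperbolicPotential Z μ (Complex.exp κ) (upperLog z - κ) * jostWave Z κ m z) / z) z := by
  have hz0 : z ≠ 0 := ne_zero_of_height_pos (hR.trans hz)
  have hU := (isOpen_aboveWedge R).mem_nhds hz
  have h1 : HasDerivAt m (deriv m z) z := (hm.differentiableAt hU).hasDerivAt
  have h2 : HasDerivAt (deriv m) (deriv (deriv m) z) z :=
    ((hm.deriv (isOpen_aboveWedge R)).differentiableAt hU).hasDerivAt
  have hid := hasDerivAt_id z
  have h3 : HasDerivAt (fun z => Complex.exp (Complex.I * z / 2 +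
      (Complex.I * jostExponent Z κ - 1 / 2) * upperLog z)) _ z :=
    (((hid.const_mul Complex.I).div_const 2).fun_add
      ((hasDerivAt_upperLog (hR.trans hz)).const_mul
        (Complex.I * jostExponent Z κ - 1 / 2))).cexp
  refine ⟨(h3.fun_mul h1).congr_deriv ?_, ?_⟩
  · rw [jostWaveDeriv]
    simp only [id]
    field_simp
    ring
  · have h4 := (((((hid.const_mul Complex.I).div_const 2).add_const
      (Complex.I * jostExponent Z κ)).sub_const (1 / 2)).fun_mul h1).fun_add (hid.fun_mul h2)
    refine (h3.fun_mul h4).congr_deriv ?_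
    rw [hode z hz, hyperbolicPotential_upperLog hz0, jostWave, jostRemainder]
    simp only [id]
    generalize Complex.exp (Complex.I * z / 2 +
      (Complex.I * jostExponent Z κ - 1 / 2) * upperLog z) = E
    field_simp
    ring_nf
    simp only [Complex.I_sq]
    ring

theorem isPreconnected_aboveWedge (R : ℝ) : IsPreconnected (aboveWedge R) := by
  have h : aboveWedge R = {z | R < z.im + z.re} ∪ {z | R < z.im - z.re} := by
    ext z
    show R < z.im + |z.re| ↔ R < z.im + z.re ∨ R < z.im - z.re
    rw [← sub_lt_iff_lt_add', lt_abs, sub_lt_iff_lt_add', sub_lt_iff_lt_add', ← sub_eq_add_neg]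
  rw [h]
  -- Two half-planes cover the region, and both contain `(R+1)i`.
  refine IsPreconnected.union ((R + 1 : ℝ) * Complex.I) ?_ ?_ (Convex.isPreconnected ?_)
    (Convex.isPreconnected ?_)
  · show R < _; simp
  · show R < _; simp
  · exact convex_halfSpace_gt (f := fun z : ℂ => z.im + z.re) (Complex.imLm + Complex.reLm).isLinear R
  · exact convex_halfSpace_gt (f := fun z : ℂ => z.im - z.re) (Complex.imLm - Complex.reLm).isLinear R

/-- On the region above the wedge, the Jost wave is a fixed combination of the fundamental
solutions. -/
theorem jostWave_eq (hR : 0 < R) (hm : DifferentiableOn ℂ m (aboveWedge R))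
    (hode : ∀ z ∈ aboveWedge R, deriv (deriv m) z =
      -(Complex.I + 2 * Complex.I * jostExponent Z κ / z) * deriv m z -
        jostRemainder Z μ κ z * m z) {z₀ z : ℂ} (hz₀ : z₀ ∈ aboveWedge R)
    (hz : z ∈ aboveWedge R) :
    jostWave Z κ m z =
      (jostWave Z κ m z₀ * deriv (hyperbolicSolution Z μ 0 1 (Complex.exp κ)) (upperLog z₀ - κ) -
        jostWaveDeriv Z κ m z₀ * hyperbolicSolution Z μ 0 1 (Complex.exp κ) (upperLog z₀ - κ)) *
          hyperbolicSolution Z μ 1 0 (Complex.exp κ) (upperLog z - κ) -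
      (jostWave Z κ m z₀ * deriv (hyperbolicSolution Z μ 1 0 (Complex.exp κ)) (upperLog z₀ - κ) -
        jostWaveDeriv Z κ m z₀ * hyperbolicSolution Z μ 1 0 (Complex.exp κ) (upperLog z₀ - κ)) *
          hyperbolicSolution Z μ 0 1 (Complex.exp κ) (upperLog z - κ) := by
  have hconst : ∀ a b : ℂ,
      jostWave Z κ m z * deriv (hyperbolicSolution Z μ a b (Complex.exp κ)) (upperLog z - κ) -
        jostWaveDeriv Z κ m z * hyperbolicSolution Z μ a b (Complex.exp κ) (upperLog z - κ) =
      jostWave Z κ m z₀ * deriv (hyperbolicSolution Z μ a b (Complex.exp κ)) (upperLog z₀ - κ) -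
        jostWaveDeriv Z κ m z₀ * hyperbolicSolution Z μ a b (Complex.exp κ) (upperLog z₀ - κ) := by
    intro a b
    have hd : ∀ z ∈ aboveWedge R, HasDerivAt (fun z => jostWave Z κ m z *
        deriv (hyperbolicSolution Z μ a b (Complex.exp κ)) (upperLog z - κ) -
        jostWaveDeriv Z κ m z * hyperbolicSolution Z μ a b (Complex.exp κ) (upperLog z - κ))
        0 z := fun z hz => by
      obtain ⟨h1, h2⟩ := hasDerivAt_jostWave hR hm hode hz
      have h3 := (hasDerivAt_upperLog (hR.trans hz)).sub_const κ
      have h4 := (hasDerivAt_hyperbolicSolution (Z := Z) (μ := μ) (a := a) (b := b)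
        (k := Complex.exp κ) (upperLog z - κ)).comp z h3
      have h5 := (hasDerivAt_deriv_hyperbolicSolution (Z := Z) (μ := μ) (a := a) (b := b)
        (k := Complex.exp κ) (upperLog z - κ)).comp z h3
      refine ((h1.fun_mul h5).fun_sub (h2.fun_mul h4)).congr_deriv ?_
      simp only [Function.comp]
      ring
    exact (isOpen_aboveWedge R).is_const_of_deriv_eq_zero (isPreconnected_aboveWedge R)
      (fun z hz => (hd z hz).differentiableAt.differentiableWithinAt)
      (fun z hz => (hd z hz).deriv) hz hz₀
  rw [← hconst, ← hconst]
  have hW := hyperbolic_wronskian (Z := Z) (μ := μ) (k := Complex.exp κ) (upperLog z - κ)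
  linear_combination -jostWave Z κ m z * hW

end Wave

/-! ### Local holomorphic families of Jost solutions -/

section LocalJost

variable {Z : ℝ} {μ : ℂ}

/-- Amplitudes of the Jost waves for `κ` near `κ₀`. -/
theorem exists_local_amplitude (Z : ℝ) (μ κ₀ : ℂ) :
    ∃ (R B : ℝ) (m : ℂ → ℂ → ℂ), 0 < R ∧
      (∀ κ ∈ ball κ₀ 1, DifferentiableOn ℂ (m κ) (aboveWedge R)) ∧
      (∀ z ∈ aboveWedge R, DifferentiableOn ℂ (fun κ => m κ z) (ball κ₀ 1)) ∧
      (∀ κ ∈ ball κ₀ 1, ∀ z ∈ aboveWedge R, ‖m κ z‖ ≤ 2) ∧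
      (∀ κ ∈ ball κ₀ 1, ∀ z ∈ aboveWedge R, ‖m κ z - 1‖ ≤ B / height z) ∧
      ∀ κ ∈ ball κ₀ 1, ∀ z ∈ aboveWedge R, deriv (deriv (m κ)) z =
        -(Complex.I + 2 * Complex.I * jostExponent Z κ / z) * deriv (m κ) z -
          jostRemainder Z μ κ z * m κ z := by
  have hbd : ∀ f : ℂ → ℂ, Continuous f → ∃ M : ℝ, 0 ≤ M ∧ ∀ κ ∈ ball κ₀ 1, ‖f κ‖ ≤ M :=
    fun f hf => by
    obtain ⟨M, hM⟩ := (isCompact_closedBall κ₀ 1).exists_bound_of_continuousOn hf.continuousOn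
    exact ⟨|M|, abs_nonneg M, fun κ hκ =>
      (hM κ (ball_subset_closedBall hκ)).trans (le_abs_self M)⟩
  have ha := continuous_jostExponent (Z := Z)
  obtain ⟨A₁, hA₁, h₁⟩ := hbd _ ha
  obtain ⟨A₂, hA₂, h₂⟩ := hbd (fun κ => Complex.exp κ ^ 2 / 2 - μ + 1 / 4 - jostExponent Z κ ^ 2 -
    Complex.I * jostExponent Z κ) (by fun_prop)
  obtain ⟨A₃, hA₃, h₃⟩ := hbd (fun κ => Z * Complex.exp κ / 2) (by fun_prop)
  obtain ⟨A₄, hA₄, h₄⟩ := hbd (fun κ => Complex.exp κ ^ 4 / 4) (by fun_prop)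
  -- The factor 4 comes from `height z ≤ 2‖z‖`, squared. `A₁` is included because the same `B` must
  -- also bound the exponent `a`.
  obtain ⟨B, hB⟩ : ∃ B, B = A₁ + 4 * (A₂ + A₃ + A₄) := ⟨_, rfl⟩
  have hB0 : 0 ≤ B := by rw [hB]; positivity
  -- `8B ≤ R` is the contraction condition. The extra 2 forces `‖z‖ ≥ 1`, so that the cubic and
  -- quartic terms are dominated by the quadratic one.
  obtain ⟨R, hR⟩ : ∃ R, R = 8 * B + 2 := ⟨_, rfl⟩
  have hR0 : 0 < R := by rw [hR]; positivity
  have hz0 : ∀ z ∈ aboveWedge R, z ≠ 0 := fun z hz => ne_zero_of_height_pos (hR0.trans hz)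
  have hda := differentiable_jostExponent (Z := Z)
  have hV₁ : ∀ κ ∈ ball κ₀ 1, DifferentiableOn ℂ (jostRemainder Z μ κ) (aboveWedge R) :=
    fun κ _ => by
    unfold jostRemainder
    refine DifferentiableOn.fun_add (DifferentiableOn.fun_add ?_ ?_) ?_ <;>
      exact (differentiableOn_const _).fun_div (by fun_prop) fun z hz => pow_ne_zero _ (hz0 z hz)
  have hV₂ : ∀ z ∈ aboveWedge R,
      DifferentiableOn ℂ (fun κ => jostRemainder Z μ κ z) (ball κ₀ 1) := fun z _ => by
    unfold jostRemainder
    refine Differentiable.differentiableOn ?_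
    fun_prop
  have hVb : ∀ κ ∈ ball κ₀ 1, ∀ z ∈ aboveWedge R,
      ‖jostRemainder Z μ κ z‖ ≤ B / height z ^ 2 := by
    intro κ hκ z hz
    have hh : R < height z := hz
    have hn := height_le_norm z
    have hh0 : 0 < height z := hR0.trans hh
    have hn1 : 1 ≤ ‖z‖ := by linarith
    have e : ∀ (w : ℂ) (M : ℝ) (i : ℕ), 2 ≤ i → 0 ≤ M → ‖w‖ ≤ M →
        ‖w / z ^ i‖ ≤ M * (4 / height z ^ 2) := fun w M i hi hM hw => by
      rw [norm_div, norm_pow]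
      have h5 : ‖z‖ ^ 2 ≤ ‖z‖ ^ i := pow_le_pow_right₀ hn1 hi
      have h6 : height z ^ 2 / 4 ≤ ‖z‖ ^ 2 := by nlinarith
      calc ‖w‖ / ‖z‖ ^ i ≤ M / (height z ^ 2 / 4) := by
            gcongr; exact h6.trans h5
        _ = _ := by field_simp
    have e2 := e _ _ 2 le_rfl hA₂ (h₂ κ hκ)
    have e3 := e _ _ 3 (by norm_num) hA₃ (h₃ κ hκ)
    have e4 := e _ _ 4 (by norm_num) hA₄ (h₄ κ hκ)
    unfold jostRemainder
    refine (norm_add₃_le.trans (add_le_add_three e2 e3 e4)).trans ?_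
    rw [hB, ← add_mul, ← add_mul, mul_div_assoc', div_le_div_iff_of_pos_right (by positivity)]
    linarith
  obtain ⟨m, hm1, hm2, hm3, hm4, hm5⟩ := exists_jost_amplitude isOpen_ball hB0 hR0
    (by linarith) (a := jostExponent Z) (V := jostRemainder Z μ)
    (fun κ hκ => (h₁ κ hκ).trans (by rw [hB]; linarith)) hda.differentiableOn hV₁ hV₂ hVb
  exact ⟨R, 4 * B, m, hR0, hm1, hm2, hm3, hm4, hm5⟩

theorem tendsto_height_ray {γ : ℝ} {κ : ℂ} (h₁ : 0 ≤ κ.im + γ) (h₂ : κ.im + γ ≤ Real.pi) :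
    Tendsto (fun t : ℝ => height (Complex.exp κ * (rayPoint γ t + 1))) atTop atTop := by
  have hlow : ∀ᶠ t : ℝ in atTop, Real.exp κ.re * t + -(2 * Real.exp κ.re) ≤
      height (Complex.exp κ * (rayPoint γ t + 1)) := by
    filter_upwards [eventually_gt_atTop 0] with t ht
    have h3 : Complex.exp κ * (rayPoint γ t + 1) =
        ((Real.exp κ.re * t : ℝ) : ℂ) * Complex.exp ((κ.im + γ : ℝ) * Complex.I) +
          Complex.exp κ := by
      have h4 : Complex.exp κ * Complex.exp (Complex.I * γ) =
          (Real.exp κ.re : ℝ) * Complex.exp ((κ.im + γ : ℝ) * Complex.I) := by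
        rw [Complex.ofReal_exp, ← Complex.exp_add, ← Complex.exp_add]
        congr 1
        conv_lhs => rw [← Complex.re_add_im κ]
        push_cast; ring
      rw [rayPoint, mul_add, mul_one, ← mul_assoc, h4]
      push_cast; ring
    have hr : 0 < Real.exp κ.re * t := by positivity
    have hs := Real.sin_nonneg_of_nonneg_of_le_pi h₁ h₂
    -- Its square is `1 + 2 sin |cos|`, and the sine is nonnegative on `[0, π]`. The rays `arg z =
    -- 0` and `arg z = π`, where the exponential only oscillates, are thus included.
    have h5 : 1 ≤ Real.sin (κ.im + γ) + |Real.cos (κ.im + γ)| := by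
      have := Real.sin_sq_add_cos_sq (κ.im + γ)
      have h6 := abs_nonneg (Real.cos (κ.im + γ))
      have h7 := sq_abs (Real.cos (κ.im + γ))
      nlinarith [mul_nonneg hs h6]
    have h8 := Complex.abs_re_le_norm (Complex.exp κ)
    have h9 := (neg_abs_le _).trans' (neg_le_neg (Complex.abs_im_le_norm (Complex.exp κ)))
    rw [Complex.norm_exp] at h8 h9
    rw [h3, height, Complex.add_re, Complex.add_im, Complex.re_ofReal_mul, Complex.im_ofReal_mul,
      Complex.exp_ofReal_mul_I_re, Complex.exp_ofReal_mul_I_im]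
    have h10 := abs_sub_abs_le_abs_add (Real.exp κ.re * t * Real.cos (κ.im + γ))
      (Complex.exp κ).re
    rw [abs_mul, abs_of_pos hr] at h10
    nlinarith [mul_le_mul_of_nonneg_left h5 hr.le]
  exact tendsto_atTop_mono' _ hlow (tendsto_atTop_add_const_right _ _
    (tendsto_id.const_mul_atTop (Real.exp_pos _)))

theorem eventually_upperLog_ray {γ : ℝ} {κ : ℂ} (hγ₁ : -Real.pi < γ) (hγ₂ : γ < Real.pi)
    (h₁ : 0 ≤ κ.im + γ) (h₂ : κ.im + γ ≤ Real.pi) :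
    ∀ᶠ t : ℝ in atTop, upperLog (Complex.exp κ * (rayPoint γ t + 1)) =
      κ + Complex.log (rayPoint γ t + 1) := by
  have h3 := (Complex.continuous_im.tendsto _).comp (tendsto_log_rayPoint hγ₁ hγ₂)
  have h4 : (Complex.I * γ).im = γ := by simp
  rw [h4] at h3
  have hpi := Real.pi_pos
  filter_upwards [eventually_gt_atTop 0, h3.eventually (lt_mem_nhds (by linarith : γ - 1 < γ)),
    h3.eventually (gt_mem_nhds (by linarith : γ < γ + 1))] with t ht h5 h6
  simp only [Function.comp, Complex.sub_im, Complex.ofReal_im, sub_zero] at h5 h6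
  have hw := Complex.slitPlane_ne_zero (rayPoint_mem_radialDomain hγ₁ hγ₂ ht)
  have h7 : Complex.exp κ * (rayPoint γ t + 1) =
      Complex.exp (κ + Complex.log (rayPoint γ t + 1)) := by
    rw [Complex.exp_add, Complex.exp_log hw]
  -- The imaginary part lies in `(-1, π + 1)`, and `1 < π/2` puts this inside the range where
  -- `upperLog` inverts `exp`.
  have := Real.pi_gt_three
  rw [h7, upperLog_exp] <;> rw [Complex.add_im] <;> linarith

/-- One wave lives over all directions `0 ≤ arg z ≤ π`, so the same coefficients serve every
admissible `γ`. They are Wronskians at a fixed base point and therefore holomorphic at `κ₀`. -/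
theorem exists_local_jost (Z : ℝ) (μ κ₀ : ℂ) : ∃ A B : ℂ → ℂ, DifferentiableAt ℂ A κ₀ ∧
    DifferentiableAt ℂ B κ₀ ∧ ∀ κ ∈ ball κ₀ 1, ∀ γ : ℝ, -Real.pi < γ → γ < Real.pi →
      0 ≤ κ.im + γ → κ.im + γ ≤ Real.pi →
      Tendsto (fun t => (A κ * radialSolution Z μ 1 0 (Complex.exp κ) (rayPoint γ t) +
        B κ * radialSolution Z μ 0 1 (Complex.exp κ) (rayPoint γ t)) *
          Complex.exp (Complex.log (rayPoint γ t + 1) / 2 -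
            Complex.I * leadingPhase Z (Complex.exp κ) (rayPoint γ t))) atTop (𝓝 1) := by
  obtain ⟨R, B, m, hR, hm1, hm2, hm3, hm4, hm5⟩ := exists_local_amplitude Z μ κ₀
  -- Any base point with room around it would do. Height `R + 2` leaves space for the disc of radius
  -- `1/2` used to differentiate in `κ`.
  obtain ⟨z₀, hz₀⟩ : ∃ z₀ : ℂ, z₀ = (R + 2 : ℝ) * Complex.I := ⟨_, rfl⟩
  have hz₀h : height z₀ = R + 2 := by rw [hz₀, height]; simp
  have hz₀R : z₀ ∈ aboveWedge R := by show R < height z₀; linarith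
  have hball : closedBall z₀ (1 / 2) ⊆ aboveWedge R := fun z hz => by
    rw [mem_closedBall_iff_norm] at hz
    have h1 := Complex.abs_im_le_norm (z - z₀)
    have h3 := neg_abs_le (z - z₀).im
    show R < height z
    have h4 : z₀.im = R + 2 := by rw [hz₀]; simp
    rw [Complex.sub_im] at h1 h3
    unfold height
    linarith [abs_nonneg z.re]
  have hκ₀ : κ₀ ∈ ball κ₀ 1 := mem_ball_self one_pos
  have hnb : ball κ₀ 1 ∈ 𝓝 κ₀ := isOpen_ball.mem_nhds hκ₀
  have hmd : DifferentiableAt ℂ (fun κ => m κ z₀) κ₀ := (hm2 z₀ hz₀R).differentiableAt hnb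
  have hmd' : DifferentiableAt ℂ (fun κ => deriv (m κ) z₀) κ₀ :=
    (differentiableAt_comp_graph (ψ := fun _ => z₀) (r := 1 / 2) (M := 2) (by norm_num)
      (fun z hz => (hm2 z (hball hz)).mono (ball_subset_ball (by norm_num)))
      (fun κ hκ => (hm1 κ (ball_subset_ball (by norm_num) hκ)).mono hball)
      (fun κ hκ z hz => hm3 κ (ball_subset_ball (by norm_num) hκ) z (hball hz))
      (Eventually.of_forall fun _ => differentiableAt_const _)).2
  -- The basis depends on `κ` both through `k` and through the evaluation point `upperLog z₀ - κ`,
  -- which is why composition with a graph is needed.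
  have hS : ∀ a b : ℂ,
      DifferentiableAt ℂ (fun κ => hyperbolicSolution Z μ a b (Complex.exp κ) (upperLog z₀ - κ))
        κ₀ ∧ DifferentiableAt ℂ (fun κ =>
          deriv (hyperbolicSolution Z μ a b (Complex.exp κ)) (upperLog z₀ - κ)) κ₀ := by
    intro a b
    obtain ⟨M, hM⟩ := hyperbolicSolution_bounded Z μ a b
      (Real.exp (‖κ₀‖ + 1) + (‖upperLog z₀ - κ₀‖ + 1))
    refine differentiableAt_comp_graph (F := fun κ z => hyperbolicSolution Z μ a b (Complex.exp κ) z)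
      (ψ := fun κ => upperLog z₀ - κ) (r := 1) (M := M) one_pos
      (fun z _ => ((differentiable_hyperbolicSolution_param z).comp
        Complex.differentiable_exp).differentiableOn)
      (fun κ _ => differentiable_hyperbolicSolution.differentiableOn) (fun κ hκ z hz => hM _ _ ?_ ?_)
      (Eventually.of_forall fun _ => by fun_prop)
    · rw [mem_ball_iff_norm] at hκ
      have h1 := norm_le_norm_add_norm_sub' κ κ₀
      have h2 := (Complex.norm_exp_le_exp_norm κ).trans
        (Real.exp_le_exp.2 (by linarith : ‖κ‖ ≤ ‖κ₀‖ + 1))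
      linarith [norm_nonneg (upperLog z₀ - κ₀)]
    · rw [mem_closedBall_iff_norm] at hz
      have h1 := norm_le_norm_add_norm_sub' z (upperLog z₀ - κ₀)
      linarith [Real.exp_pos (‖κ₀‖ + 1)]
  have ha := (differentiable_jostExponent (Z := Z)) κ₀
  have hY : DifferentiableAt ℂ (fun κ => jostWave Z κ (m κ) z₀) κ₀ := by
    unfold jostWave; fun_prop
  have hY' : DifferentiableAt ℂ (fun κ => jostWaveDeriv Z κ (m κ) z₀) κ₀ := by
    unfold jostWaveDeriv; fun_prop
  have hN : DifferentiableAt ℂ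
      (fun κ => Complex.exp ((1 / 2 - Complex.I * jostExponent Z κ) * κ)) κ₀ := by fun_prop
  obtain ⟨hS1, hS2⟩ := hS 0 1
  obtain ⟨hC1, hC2⟩ := hS 1 0
  refine ⟨fun κ => Complex.exp ((1 / 2 - Complex.I * jostExponent Z κ) * κ) *
    (jostWave Z κ (m κ) z₀ *
      deriv (hyperbolicSolution Z μ 0 1 (Complex.exp κ)) (upperLog z₀ - κ) -
        jostWaveDeriv Z κ (m κ) z₀ *
          hyperbolicSolution Z μ 0 1 (Complex.exp κ) (upperLog z₀ - κ)),
    fun κ => -(Complex.exp ((1 / 2 - Complex.I * jostExponent Z κ) * κ) *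
    (jostWave Z κ (m κ) z₀ *
      deriv (hyperbolicSolution Z μ 1 0 (Complex.exp κ)) (upperLog z₀ - κ) -
        jostWaveDeriv Z κ (m κ) z₀ *
          hyperbolicSolution Z μ 1 0 (Complex.exp κ) (upperLog z₀ - κ))),
    hN.fun_mul ((hY.fun_mul hS2).fun_sub (hY'.fun_mul hS1)),
    (hN.fun_mul ((hY.fun_mul hC2).fun_sub (hY'.fun_mul hC1))).fun_neg, ?_⟩
  intro κ hκ γ hγ₁ hγ₂ h₁ h₂
  have hh := tendsto_height_ray h₁ h₂
  have hm : Tendsto (fun t => m κ (Complex.exp κ * (rayPoint γ t + 1))) atTop (𝓝 1) := by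
    rw [tendsto_iff_norm_sub_tendsto_zero]
    refine squeeze_zero' (Eventually.of_forall fun t => norm_nonneg _) ?_
      ((tendsto_const_nhds (x := B)).div_atTop hh)
    filter_upwards [hh.eventually_gt_atTop R] with t ht
    exact hm4 κ hκ _ ht
  refine hm.congr' ?_
  filter_upwards [hh.eventually_gt_atTop R, eventually_upperLog_ray hγ₁ hγ₂ h₁ h₂] with t ht hL
  have hjw := jostWave_eq (μ := μ) hR (hm1 κ hκ) (hm5 κ hκ) hz₀R ht
  rw [hL, add_sub_cancel_left] at hjw
  -- Since `upperLog z = κ + log(x+1)`, the power `z^(ia-1/2)` carries a factor depending only on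
  -- `κ`. The normalisation `exp((1/2 - ia)κ)` removes it, and the leading phase cancels the rest.
  have hN' : Complex.exp ((1 / 2 - Complex.I * jostExponent Z κ) * κ) *
      jostWave Z κ (m κ) (Complex.exp κ * (rayPoint γ t + 1)) *
        Complex.exp (Complex.log (rayPoint γ t + 1) / 2 -
            Complex.I * leadingPhase Z (Complex.exp κ) (rayPoint γ t)) =
      m κ (Complex.exp κ * (rayPoint γ t + 1)) := by
    rw [jostWave, hL, ← mul_assoc, ← Complex.exp_add, mul_right_comm, ← Complex.exp_add]
    have h0 : (1 / 2 - Complex.I * jostExponent Z κ) * κ +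
        (Complex.I * (Complex.exp κ * (rayPoint γ t + 1)) / 2 +
          (Complex.I * jostExponent Z κ - 1 / 2) * (κ + Complex.log (rayPoint γ t + 1))) +
        (Complex.log (rayPoint γ t + 1) / 2 -
            Complex.I * leadingPhase Z (Complex.exp κ) (rayPoint γ t)) = 0 := by
      rw [leadingPhase, jostExponent]; ring
    rw [h0, Complex.exp_zero, one_mul]
  rw [← hN', hjw]
  simp only [radialSolution]
  ring

end LocalJost

/-! ### Gluing the local families -/

section Family

variable {Z : ℝ} {μ k : ℂ}

theorem radialSolution_combination (a b : ℂ) :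
    IsRadialSolution Z μ k
      (fun x => a * radialSolution Z μ 1 0 k x + b * radialSolution Z μ 0 1 k x) ∧
    a * radialSolution Z μ 1 0 k 0 + b * radialSolution Z μ 0 1 k 0 = a ∧
    deriv (fun x => a * radialSolution Z μ 1 0 k x + b * radialSolution Z μ 0 1 k x) 0 = b := by
  have hC := fun z => (hasDerivAt_hyperbolicSolution (Z := Z) (μ := μ) (a := 1) (b := 0) (k := k) z)
  have hS := fun z => (hasDerivAt_hyperbolicSolution (Z := Z) (μ := μ) (a := 0) (b := 1) (k := k) z)
  have hd : ∀ z, HasDerivAt (fun z => a * hyperbolicSolution Z μ 1 0 k z +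
      b * hyperbolicSolution Z μ 0 1 k z) (a * deriv (hyperbolicSolution Z μ 1 0 k) z +
        b * deriv (hyperbolicSolution Z μ 0 1 k) z) z := fun z =>
    ((hC z).const_mul a).fun_add ((hS z).const_mul b)
  have h := isRadialSolution_comp_log (Z := Z) (μ := μ) (k := k)
    (fun z => (hd z).differentiableAt) (fun z => by
      rw [funext fun z => (hd z).deriv]
      refine (((hasDerivAt_deriv_hyperbolicSolution z).const_mul a).fun_add
        ((hasDerivAt_deriv_hyperbolicSolution z).const_mul b)).deriv.trans ?_
      ring)
  refine ⟨h.1, ?_, (h.2 0 zero_mem_radialDomain).trans ?_⟩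
  · rw [radialSolution_zero, radialSolution_zero]; ring
  · rw [(hd _).deriv]
    simp [deriv_hyperbolicSolution_zero]

theorem im_exp_mul_exp (κ : ℂ) (γ : ℝ) : (Complex.exp κ * Complex.exp (Complex.I * γ)).im =
    Real.exp κ.re * Real.sin (κ.im + γ) := by
  rw [← Complex.exp_add, Complex.exp_im]
  simp

/-- The Jost solutions, as an analytic family of combinations of the fundamental solutions. -/
theorem exists_jost_family (Z : ℝ) (μ : ℂ) : ∃ A B : ℂ → ℂ,
    ∀ κ : ℂ, -Real.pi < κ.im → κ.im < 2 * Real.pi →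
      DifferentiableAt ℂ A κ ∧ DifferentiableAt ℂ B κ ∧
      ∀ γ : ℝ, -Real.pi < γ → γ < Real.pi → 0 ≤ κ.im + γ → κ.im + γ ≤ Real.pi →
        Tendsto (fun t => (A κ * radialSolution Z μ 1 0 (Complex.exp κ) (rayPoint γ t) +
          B κ * radialSolution Z μ 0 1 (Complex.exp κ) (rayPoint γ t)) *
            Complex.exp (Complex.log (rayPoint γ t + 1) / 2 -
              Complex.I * leadingPhase Z (Complex.exp κ) (rayPoint γ t))) atTop (𝓝 1) := by
  choose A B hA hB hlim using exists_local_jost Z μ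
  -- The glued coefficient at `κ` is that of the family centred at `κ`. Near `κ₀` it agrees with the
  -- family centred at `κ₀` by uniqueness of the decaying solution, hence is holomorphic there.
  refine ⟨fun κ => A κ κ, fun κ => B κ κ, fun κ₀ h₁ h₂ => ?_⟩
  have hloc : ∀ᶠ κ in 𝓝 κ₀, A κ κ = A κ₀ κ ∧ B κ κ = B κ₀ κ := by
    filter_upwards [ball_mem_nhds κ₀ one_pos,
      Complex.continuous_im.continuousAt.eventually (lt_mem_nhds h₁),
      Complex.continuous_im.continuousAt.eventually (gt_mem_nhds h₂)] with κ hκ h₃ h₄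
    -- This affine choice sends `-π < Im κ < 2π` to `-π < γ < π` and makes `Im κ + γ = (π + Im
    -- κ)/3`, which lies in `(0, π)`. It supplies a decaying ray for every point of the strip.
    obtain ⟨γ, hγ⟩ : ∃ γ : ℝ, γ = (Real.pi - 2 * κ.im) / 3 := ⟨_, rfl⟩
    have g₁ : -Real.pi < γ := by linarith
    have g₂ : γ < Real.pi := by linarith
    have g₃ : 0 < κ.im + γ := by linarith
    have g₄ : κ.im + γ < Real.pi := by linarith
    have hpos : 0 < (Complex.exp κ * Complex.exp (Complex.I * γ)).im := by
      rw [im_exp_mul_exp]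
      exact mul_pos (Real.exp_pos _) (Real.sin_pos_of_pos_of_lt_pi g₃ g₄)
    obtain ⟨s₁, e₁, d₁⟩ := radialSolution_combination (Z := Z) (μ := μ) (k := Complex.exp κ)
      (A κ κ) (B κ κ)
    obtain ⟨s₂, e₂, d₂⟩ := radialSolution_combination (Z := Z) (μ := μ) (k := Complex.exp κ)
      (A κ₀ κ) (B κ₀ κ)
    obtain ⟨h5, h6, -⟩ := eq_of_decaying (Complex.exp_ne_zero κ) g₁ g₂ hpos s₁ s₂ one_ne_zero
      (hlim κ κ (mem_ball_self one_pos) γ g₁ g₂ g₃.le g₄.le)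
      (hlim κ₀ κ hκ γ g₁ g₂ g₃.le g₄.le)
    exact ⟨e₁.symm.trans (h5.trans e₂), d₁.symm.trans (h6.trans d₂)⟩
  exact ⟨(hA κ₀).congr_of_eventuallyEq (hloc.mono fun κ h => h.1),
    (hB κ₀).congr_of_eventuallyEq (hloc.mono fun κ h => h.2),
    hlim κ₀ κ₀ (mem_ball_self one_pos)⟩

end Family

/-! ### Reduction of both signs and normalisation by the phase -/

section Sign

variable {Z : ℝ} {μ k σ : ℂ}

theorem isRadialSolution_sign_mul (hσ : σ = 1 ∨ σ = -1) {u : ℂ → ℂ} :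
    IsRadialSolution Z μ (σ * k) u ↔ IsRadialSolution Z μ k u := by
  have h : radialPotential Z μ (σ * k) = radialPotential Z μ k := by
    funext x
    rcases hσ with rfl | rfl <;> simp [radialPotential]
  constructor <;> rintro ⟨h1, h2⟩
  · exact ⟨h1, by rwa [h] at h2⟩
  · exact ⟨h1, by rwa [h]⟩

theorem normalPhaseC_neg (x : ℂ) : normalPhaseC Z (-k) x = -normalPhaseC Z k x := by
  simp only [normalPhaseC, phaseTail_neg, mul_neg, div_neg]; ring

/-- Oddness in `k` makes `σ φ(·, σk)` independent of `σ`. Outgoing and incoming solutions thus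
become the same function of `κ`. -/
theorem phase_sign {c : ℂ → ℂ} (hc : ∀ k ≠ 0, c (-k) = -c k) (hσ : σ = 1 ∨ σ = -1) (hk : k ≠ 0)
    (x : ℂ) : σ * (c (σ * k) + normalPhaseC Z (σ * k) x) = c k + normalPhaseC Z k x := by
  rcases hσ with rfl | rfl
  · simp
  · rw [neg_one_mul k, hc k hk, normalPhaseC_neg]; ring

theorem tendsto_exp_normalPhaseC_sub (hk : k ≠ 0) (γ : ℝ) (b : ℂ) :
    Tendsto (fun t => Complex.exp (b * (normalPhaseC Z k (rayPoint γ t) -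
      leadingPhase Z k (rayPoint γ t)))) atTop (𝓝 1) := by
  have h1 := ((tendsto_normalPhaseC_sub (Z := Z) hk).comp (tendsto_rayPoint γ)).const_mul b
  rw [mul_zero] at h1
  have h2 := (Complex.continuous_exp.tendsto 0).comp h1
  rwa [Complex.exp_zero] at h2

theorem rayPoint_zero (t : ℝ) : rayPoint 0 t = t := by simp [rayPoint]

theorem ofReal_sqrt_eq_exp {y : ℝ} (hy : 0 < y) :
    ((√y : ℝ) : ℂ) = Complex.exp ((Real.log y : ℝ) / 2) := by
  have h : ((Real.log y : ℝ) : ℂ) / 2 = ((Real.log y / 2 : ℝ) : ℂ) := by push_cast; rfl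
  rw [h, ← Complex.ofReal_exp, ← Real.log_sqrt hy.le, Real.exp_log (Real.sqrt_pos.2 hy)]

/-- The normalisation of the Jost solutions through `φ`, expressed with the leading phase. -/
theorem tendsto_jost_iff {φ : ℝ → ℂ → ℂ} {c : ℂ → ℂ} (hc : ∀ k ≠ 0, c (-k) = -c k)
    (h : ∀ k ≠ 0, ∃ X : ℝ, ∀ ξ > X, φ ξ k = c k + normalPhase Z k ξ) (hσ : σ = 1 ∨ σ = -1)
    (hk : k ≠ 0) (u : ℂ → ℂ) :
    Tendsto (fun x : ℝ => (√(x + 1) : ℂ) *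
        Complex.exp (-(σ * Complex.I * φ (Real.log (x + 1)) (σ * k))) * u x) atTop (𝓝 1) ↔
      Tendsto (fun t => u (rayPoint 0 t) * Complex.exp (Complex.log (rayPoint 0 t + 1) / 2 -
        Complex.I * leadingPhase Z k (rayPoint 0 t))) atTop (𝓝 (Complex.exp (Complex.I * c k))) := by
  have hσk : σ * k ≠ 0 := by
    rcases hσ with rfl | rfl <;> simpa using hk
  obtain ⟨X, hX⟩ := h _ hσk
  have hev : ∀ᶠ x : ℝ in atTop, ∀ w : ℂ,
      (√(x + 1) : ℂ) * Complex.exp (-(σ * Complex.I * φ (Real.log (x + 1)) (σ * k))) * w =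
        w * Complex.exp (Complex.log (rayPoint 0 x + 1) / 2 -
          Complex.I * leadingPhase Z k (rayPoint 0 x)) *
        (Complex.exp (-Complex.I * (normalPhaseC Z k (rayPoint 0 x) -
          leadingPhase Z k (rayPoint 0 x))) * Complex.exp (-(Complex.I * c k))) := by
    filter_upwards [eventually_gt_atTop 0, eventually_gt_atTop (Real.exp X)] with x hx hxX w
    have h0 : 0 < x + 1 := by linarith
    rw [hX _ ((Real.lt_log_iff_exp_lt h0).2 (by linarith)),
      ← normalPhaseC_ofReal (by linarith), ofReal_sqrt_eq_exp h0, rayPoint_zero]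
    have h2 : σ * Complex.I * (c (σ * k) + normalPhaseC Z (σ * k) x) =
        Complex.I * (c k + normalPhaseC Z k x) := by
      rw [← phase_sign hc hσ hk]; ring
    have h3 : Complex.log ((x : ℂ) + 1) = ((Real.log (x + 1) : ℝ) : ℂ) := by
      rw [Complex.ofReal_log h0.le]; push_cast; rfl
    rw [h2, h3, ← Complex.exp_add, ← Complex.exp_add, mul_assoc, ← Complex.exp_add, mul_comm w]
    congr 2
    ring
  have hA := (tendsto_exp_normalPhaseC_sub (Z := Z) hk 0 (-Complex.I)).mul_const
    (Complex.exp (-(Complex.I * c k)))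
  rw [one_mul] at hA
  have hne : Complex.exp (Complex.I * c k) ≠ 0 := Complex.exp_ne_zero _
  have hinv : Complex.exp (Complex.I * c k) * Complex.exp (-(Complex.I * c k)) = 1 := by
    rw [← Complex.exp_add, add_neg_cancel, Complex.exp_zero]
  constructor
  · intro hu
    have h1 := hu.mul (hA.inv₀ (Complex.exp_ne_zero _))
    rw [one_mul, ← Complex.exp_neg, neg_neg] at h1
    refine h1.congr' ?_
    filter_upwards [hev] with x hx
    rw [hx, rayPoint_zero, mul_assoc, mul_inv_cancel₀, mul_one]
    exact mul_ne_zero (Complex.exp_ne_zero _) (Complex.exp_ne_zero _)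
  · intro hu
    have h1 := hu.mul hA
    rw [hinv] at h1
    refine h1.congr' ?_
    filter_upwards [hev] with x hx
    rw [hx, rayPoint_zero]

end Sign

/-! ### Uniqueness of the Jost solutions and the limit formula -/

theorem isOpen_jostDomain (α β : ℝ) : IsOpen (jostDomain α β) :=
  (isOpen_lt continuous_const Complex.continuous_im).inter
    (isOpen_lt Complex.continuous_im continuous_const)

theorem isPreconnected_jostDomain (α β : ℝ) : IsPreconnected (jostDomain α β) :=
  ((convex_halfSpace_im_gt (-β)).inter (convex_halfSpace_im_lt (Real.pi + α))).isPreconnected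

section Normalised

variable {Z : ℝ} {μ : ℂ} {φ : ℝ → ℂ → ℂ} {c : ℂ → ℂ} {α β : ℝ} {σ : ℂ}

/-- The Jost solutions normalised by a phase with constant `c`, in the fundamental system. -/
theorem exists_normalised_jost_family (Z : ℝ) (μ : ℂ) (hc : ∀ k ≠ 0, DifferentiableAt ℂ c k) :
    ∃ A B : ℂ → ℂ, ∀ κ : ℂ, -Real.pi < κ.im → κ.im < 2 * Real.pi →
      DifferentiableAt ℂ A κ ∧ DifferentiableAt ℂ B κ ∧
      ∀ γ : ℝ, -Real.pi < γ → γ < Real.pi → 0 ≤ κ.im + γ → κ.im + γ ≤ Real.pi →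
        Tendsto (fun t => (A κ * radialSolution Z μ 1 0 (Complex.exp κ) (rayPoint γ t) +
          B κ * radialSolution Z μ 0 1 (Complex.exp κ) (rayPoint γ t)) *
            Complex.exp (Complex.log (rayPoint γ t + 1) / 2 -
              Complex.I * leadingPhase Z (Complex.exp κ) (rayPoint γ t))) atTop
          (𝓝 (Complex.exp (Complex.I * c (Complex.exp κ)))) := by
  obtain ⟨A, B, hAB⟩ := exists_jost_family Z μ
  refine ⟨fun κ => Complex.exp (Complex.I * c (Complex.exp κ)) * A κ,
    fun κ => Complex.exp (Complex.I * c (Complex.exp κ)) * B κ, fun κ h₁ h₂ => ?_⟩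
  obtain ⟨hA, hB, hlim⟩ := hAB κ h₁ h₂
  have hn : DifferentiableAt ℂ (fun κ => Complex.exp (Complex.I * c (Complex.exp κ))) κ :=
    (((hc _ (Complex.exp_ne_zero κ)).comp κ Complex.differentiableAt_exp).const_mul _).cexp
  refine ⟨hn.mul hA, hn.mul hB, fun γ g₁ g₂ g₃ g₄ => ?_⟩
  have h := (hlim γ g₁ g₂ g₃ g₄).const_mul (Complex.exp (Complex.I * c (Complex.exp κ)))
  rw [mul_one] at h
  exact h.congr fun t => by ring

variable (hc : ∀ k ≠ 0, c (-k) = -c k)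
  (h : ∀ k ≠ 0, ∃ X : ℝ, ∀ ξ > X, φ ξ k = c k + normalPhase Z k ξ) (hσ : σ = 1 ∨ σ = -1)
  (hα : α < Real.pi) (hβ : β < Real.pi) {A B : ℂ → ℂ}
  (hAB : ∀ κ : ℂ, -Real.pi < κ.im → κ.im < 2 * Real.pi →
      DifferentiableAt ℂ A κ ∧ DifferentiableAt ℂ B κ ∧
      ∀ γ : ℝ, -Real.pi < γ → γ < Real.pi → 0 ≤ κ.im + γ → κ.im + γ ≤ Real.pi →
        Tendsto (fun t => (A κ * radialSolution Z μ 1 0 (Complex.exp κ) (rayPoint γ t) +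
          B κ * radialSolution Z μ 0 1 (Complex.exp κ) (rayPoint γ t)) *
            Complex.exp (Complex.log (rayPoint γ t + 1) / 2 -
              Complex.I * leadingPhase Z (Complex.exp κ) (rayPoint γ t))) atTop
          (𝓝 (Complex.exp (Complex.I * c (Complex.exp κ)))))

include hc h hσ hα hβ hAB

/-- For `0 ≤ Im κ ≤ π` the ray `γ = 0` is admissible, and `tendsto_jost_iff` translates the
normalisation. The bounds on `α` and `β` place the domain inside the strip `-π < Im κ < 2π`. -/
theorem isJostSolution_family : IsJostSolution Z μ φ α β σ fun κ x =>
    A κ * radialSolution Z μ 1 0 (Complex.exp κ) x +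
      B κ * radialSolution Z μ 0 1 (Complex.exp κ) x := by
  have hstrip : ∀ κ ∈ jostDomain α β, -Real.pi < κ.im ∧ κ.im < 2 * Real.pi :=
    fun κ hκ => ⟨by linarith [hκ.1], by linarith [hκ.2]⟩
  refine ⟨fun κ _ => (isRadialSolution_sign_mul hσ).2 (radialSolution_combination _ _).1,
    fun x _ => ?_, fun κ hκ h₁ h₂ => ?_⟩
  · refine DifferentiableOn.analyticOnNhd (fun κ hκ => ?_) (isOpen_jostDomain α β)
    obtain ⟨hA, hB, -⟩ := hAB κ (hstrip κ hκ).1 (hstrip κ hκ).2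
    have hr : ∀ a b : ℂ, DifferentiableAt ℂ (fun κ => radialSolution Z μ a b (Complex.exp κ) x) κ :=
      fun a b => ((differentiable_hyperbolicSolution_param (Z := Z) (μ := μ) (a := a) (b := b)
        (Complex.log (x + 1))).comp Complex.differentiable_exp) κ
    exact ((hA.mul (hr 1 0)).add (hB.mul (hr 0 1))).differentiableWithinAt
  · rw [tendsto_jost_iff hc h hσ (Complex.exp_ne_zero κ) fun x =>
      A κ * radialSolution Z μ 1 0 (Complex.exp κ) x +
        B κ * radialSolution Z μ 0 1 (Complex.exp κ) x]
    exact (hAB κ (hstrip κ hκ).1 (hstrip κ hκ).2).2.2 0 (by linarith [Real.pi_pos]) Real.pi_pos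
      (by linarith) (by linarith)

/-- The Jost solutions are unique. -/
theorem IsJostSolution.eq_family (hα₀ : 0 ≤ α) (hβ₀ : 0 ≤ β) {v : ℂ → ℂ → ℂ}
    (hv : IsJostSolution Z μ φ α β σ v) {κ x : ℂ} (hκ : κ ∈ jostDomain α β)
    (hx : x ∈ radialDomain) : v κ x = A κ * radialSolution Z μ 1 0 (Complex.exp κ) x +
      B κ * radialSolution Z μ 0 1 (Complex.exp κ) x := by
  have hw := isJostSolution_family hc h hσ hα hβ hAB
  have hpi := Real.pi_pos
  have hupper : ∀ κ : ℂ, 0 < κ.im → κ.im < Real.pi → v κ x =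
      A κ * radialSolution Z μ 1 0 (Complex.exp κ) x +
        B κ * radialSolution Z μ 0 1 (Complex.exp κ) x := fun κ h₁ h₂ => by
    have hκ : κ ∈ jostDomain α β := ⟨by linarith, by linarith⟩
    refine (eq_of_decaying (Complex.exp_ne_zero κ) (by linarith : -Real.pi < 0) hpi ?_ (hv.solution κ hκ) (hw.solution κ hκ) (Complex.exp_ne_zero _)
      ((tendsto_jost_iff hc h hσ (Complex.exp_ne_zero κ) (v κ)).1 (hv.asymptotics κ hκ h₁.le h₂.le))
      ((hAB κ (by linarith) (by linarith)).2.2 0 (by linarith) (by linarith) (by linarith)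
        (by linarith))).2.2 x hx
    rw [im_exp_mul_exp, add_zero]
    exact mul_pos (Real.exp_pos _) (Real.sin_pos_of_pos_of_lt_pi h₁ h₂)
  have him : (Complex.I * (Real.pi / 2)).im = Real.pi / 2 := by
    have : Complex.I * (Real.pi / 2) = Complex.I * ((Real.pi / 2 : ℝ) : ℂ) := by push_cast; rfl
    rw [this, Complex.I_mul_im, Complex.ofReal_re]
  -- Decay on the positive axis determines the solution only for `0 < Im κ < π`. The identity
  -- theorem in `κ`, started at `iπ/2`, carries the equality to the whole domain.
  refine (hv.analytic x hx).eqOn_of_preconnected_of_eventuallyEq (hw.analytic x hx)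
    (isPreconnected_jostDomain α β) (z₀ := Complex.I * (Real.pi / 2))
    ⟨by rw [him]; linarith, by rw [him]; linarith⟩ ?_ hκ
  filter_upwards [Complex.continuous_im.continuousAt.eventually
      (lt_mem_nhds (show (0 : ℝ) < _ by rw [him]; linarith)),
    Complex.continuous_im.continuousAt.eventually
      (gt_mem_nhds (show _ < Real.pi by rw [him]; linarith))] with κ h₁ h₂
  exact hupper κ h₁ h₂

/-- At `x = 0` the data of the regular solution leave only minus the derivative of the Jost
solution, which is its second coefficient in the basis. Analyticity of the Jost function is thereby
reduced to that of `B`. -/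
theorem IsJostSolution.wronskian_eq_neg (hα₀ : 0 ≤ α) (hβ₀ : 0 ≤ β) {v : ℂ → ℂ → ℂ}
    (hv : IsJostSolution Z μ φ α β σ v) {v₀ : ℂ → ℂ} {κ : ℂ} (hκ : κ ∈ jostDomain α β)
    (hv₀ : IsRegularSolution Z μ (σ * Complex.exp κ) v₀) {x : ℂ} (hx : x ∈ radialDomain) :
    wronskian (v κ) v₀ x = -B κ := by
  rw [(hv.solution κ hκ).wronskian_eq hv₀.solution hx zero_mem_radialDomain]
  have hev : v κ =ᶠ[𝓝 0] fun x => A κ * radialSolution Z μ 1 0 (Complex.exp κ) x +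
      B κ * radialSolution Z μ 0 1 (Complex.exp κ) x :=
    eventually_of_mem (isOpen_radialDomain.mem_nhds zero_mem_radialDomain) fun x hx =>
      hv.eq_family hc h hσ hα hβ hAB hα₀ hβ₀ hκ hx
  simp only [wronskian, hv₀.value_zero, hv₀.deriv_zero]
  rw [hev.deriv_eq, (radialSolution_combination (Z := Z) (μ := μ) (A κ) (B κ)).2.2]
  ring

/-- The limit formula for the Jost functions along a ray. -/
theorem IsJostSolution.tendsto_jostFunction (hα₀ : 0 ≤ α) (hβ₀ : 0 ≤ β) {Φ : ℂ → ℂ → ℂ}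
    (hΦ : IsPhaseContinuation φ Φ) {v : ℂ → ℂ → ℂ} (hv : IsJostSolution Z μ φ α β σ v)
    {s : ℂ → ℂ} {κ : ℂ} (hκ : κ ∈ jostDomain α β)
    (hs : IsRadialSolution Z μ (σ * Complex.exp κ) s) {γ : ℝ} (g₁ : -α < γ) (g₂ : γ < β)
    (g₃ : 0 < κ.im + γ) (g₄ : κ.im + γ < Real.pi) :
    Tendsto (fun x : ℝ => -σ * (Complex.I * (σ * Complex.exp κ)) *
      (Complex.exp (Complex.I * γ / 2) * (√x : ℂ) * Complex.exp (σ * Complex.I *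
        Φ (Complex.exp (Complex.I * γ) * x) (σ * Complex.exp κ)) *
          s (Complex.exp (Complex.I * γ) * x))) atTop (𝓝 (wronskian (v κ) s 0)) := by
  have g₅ : -Real.pi < γ := by linarith
  have g₆ : γ < Real.pi := by linarith
  have hp := Complex.exp_ne_zero κ
  have hσσ : σ * σ = 1 := by rcases hσ with rfl | rfl <;> norm_num
  have hσp : σ * Complex.exp κ ≠ 0 := mul_ne_zero (left_ne_zero_of_mul_eq_one hσσ) hp
  have hpos : 0 < (Complex.exp κ * Complex.exp (Complex.I * γ)).im := by
    rw [im_exp_mul_exp]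
    exact mul_pos (Real.exp_pos _) (Real.sin_pos_of_pos_of_lt_pi g₃ g₄)
  have hvlim : Tendsto (fun t => v κ (rayPoint γ t) *
      Complex.exp (Complex.log (rayPoint γ t + 1) / 2 -
        Complex.I * leadingPhase Z (Complex.exp κ) (rayPoint γ t))) atTop
      (𝓝 (Complex.exp (Complex.I * c (Complex.exp κ)))) := by
    refine ((hAB κ (by linarith [hκ.1]) (by linarith [hκ.2])).2.2 γ g₅ g₆ g₃.le g₄.le).congr' ?_
    filter_upwards [eventually_gt_atTop 0] with t ht
    rw [hv.eq_family hc h hσ hα hβ hAB hα₀ hβ₀ hκ (rayPoint_mem_radialDomain g₅ g₆ ht)]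
  have hslim := tendsto_ray_of_decaying hp g₅ g₆ hpos (hv.solution κ hκ) hs
    (Complex.exp_ne_zero _) hvlim
  have hphase := (tendsto_exp_normalPhaseC_sub (Z := Z) hp γ Complex.I).const_mul
    (Complex.exp (Complex.I * c (Complex.exp κ)))
  -- This replaces `√(x+1)` on the ray by `exp(iγ/2) √t`, the root that appears in the formula.
  have hroot : Tendsto (fun t : ℝ => Complex.exp (-(Complex.log (rayPoint γ t + 1) -
      (Real.log t : ℝ) - Complex.I * γ) / 2)) atTop (𝓝 1) := by
    have h1 := (((tendsto_log_rayPoint g₅ g₆).sub_const (Complex.I * γ)).neg.div_const 2).cexp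
    simpa using h1
  -- The phase correction restores `exp(ic)` and turns the leading phase into the full one. The
  -- constant `exp(ic)` cancels the amplitude of the decaying solution, and `-ik` cancels the
  -- remaining denominator.
  have hall := (((hslim.mul hphase).mul hroot).const_mul (-(Complex.I * Complex.exp κ)))
  have hval : -(Complex.I * Complex.exp κ) * (wronskian (v κ) s 0 /
      (-(Complex.I * Complex.exp κ) * Complex.exp (Complex.I * c (Complex.exp κ))) *
        (Complex.exp (Complex.I * c (Complex.exp κ)) * 1) * 1) = wronskian (v κ) s 0 := by
    have hI := Complex.I_ne_zero
    have hn := Complex.exp_ne_zero (Complex.I * c (Complex.exp κ))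
    field_simp
  rw [hval] at hall
  refine hall.congr' ?_
  obtain ⟨R, hR⟩ := hΦ.eq_normalPhaseC h hσp
  filter_upwards [eventually_gt_atTop 0, eventually_gt_atTop R] with t ht htR
  have hmem : rayPoint γ t ∈ slitExterior R :=
    ⟨rayPoint_mem_slitPlane g₅ g₆ ht, by rwa [norm_rayPoint ht]⟩
  change _ = -σ * (Complex.I * (σ * Complex.exp κ)) * (Complex.exp (Complex.I * γ / 2) * (√t : ℂ) *
    Complex.exp (σ * Complex.I * Φ (rayPoint γ t) (σ * Complex.exp κ)) * s (rayPoint γ t))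
  have h1 : σ * Complex.I * Φ (rayPoint γ t) (σ * Complex.exp κ) =
      Complex.I * (c (Complex.exp κ) + normalPhaseC Z (Complex.exp κ) (rayPoint γ t)) := by
    rw [hR _ hmem, ← phase_sign hc hσ hp]; ring
  have h2 : -σ * (Complex.I * (σ * Complex.exp κ)) = -(Complex.I * Complex.exp κ) := by
    linear_combination -(Complex.I * Complex.exp κ) * hσσ
  rw [h1, h2, ofReal_sqrt_eq_exp ht, ← Complex.exp_add, ← Complex.exp_add, ← Complex.exp_add,
    mul_assoc (s _), ← Complex.exp_add, mul_assoc (s _), ← Complex.exp_add, mul_comm (s _)]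
  congr 3
  ring

end Normalised

end TwoCenters

/-! ### The main theorem -/

theorem corollary4p10 (Z : ℝ) (μ : ℂ) (φ : ℝ → ℂ → ℂ) (hφ : TwoCenters.IsGlobalPhase Z μ φ)
    (α β : ℝ) (hα₀ : 0 ≤ α) (hα : α < Real.pi) (hβ₀ : 0 ≤ β) (hβ : β < Real.pi) :
    -- the objects exist
    (∃ Φ : ℂ → ℂ → ℂ, TwoCenters.IsPhaseContinuation φ Φ) ∧
    (∃ v₀ : ℂ → ℂ → ℂ, ∀ k : ℂ, k ≠ 0 → TwoCenters.IsRegularSolution Z μ k (v₀ k)) ∧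
    (∀ σ : ℂ, σ = 1 ∨ σ = -1 →
      ∃ v : ℂ → ℂ → ℂ, TwoCenters.IsJostSolution Z μ φ α β σ v) ∧
    -- the Jost functions are analytic and given by the limit formula
    ∀ Φ : ℂ → ℂ → ℂ, TwoCenters.IsPhaseContinuation φ Φ →
    ∀ v₀ : ℂ → ℂ → ℂ, (∀ k : ℂ, k ≠ 0 → TwoCenters.IsRegularSolution Z μ k (v₀ k)) →
    ∀ σ : ℂ, σ = 1 ∨ σ = -1 →
    ∀ v : ℂ → ℂ → ℂ, TwoCenters.IsJostSolution Z μ φ α β σ v →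
    ∃ f : ℂ → ℂ,
      (∀ κ ∈ TwoCenters.jostDomain α β, ∀ x ∈ TwoCenters.radialDomain,
        TwoCenters.wronskian (v κ) (v₀ (σ * Complex.exp κ)) x = f κ) ∧
      AnalyticOnNhd ℂ f (TwoCenters.jostDomain α β) ∧
      ∀ κ ∈ TwoCenters.jostDomain α β, ∀ γ : ℝ, -α < γ → γ < β →
        0 < κ.im + γ → κ.im + γ < Real.pi →
        Filter.Tendsto
          (fun x : ℝ => -σ * (Complex.I * (σ * Complex.exp κ)) *
            (Complex.exp (Complex.I * γ / 2) * (√x : ℂ)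
              * Complex.exp (σ * Complex.I
                  * Φ (Complex.exp (Complex.I * γ) * x) (σ * Complex.exp κ))
              * v₀ (σ * Complex.exp κ) (Complex.exp (Complex.I * γ) * x)))
          Filter.atTop (nhds (f κ)) := by
  obtain ⟨c, hcd, hc, h⟩ := TwoCenters.exists_phase_constant hφ
  obtain ⟨A, B, hAB⟩ := TwoCenters.exists_normalised_jost_family Z μ hcd
  refine ⟨⟨_, TwoCenters.isPhaseContinuation_normalPhaseC h⟩,
    ⟨fun k => TwoCenters.radialSolution Z μ 1 0 k, fun k _ =>
      ⟨TwoCenters.isRadialSolution_radialSolution, TwoCenters.radialSolution_zero,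
        TwoCenters.deriv_radialSolution_zero⟩⟩,
    fun σ hσ => ⟨_, TwoCenters.isJostSolution_family hc h hσ hα hβ hAB⟩,
    fun Φ hΦ v₀ hv₀ σ hσ v hv => ?_⟩
  have hreg : ∀ κ : ℂ, TwoCenters.IsRegularSolution Z μ (σ * Complex.exp κ)
      (v₀ (σ * Complex.exp κ)) := fun κ =>
    hv₀ _ (mul_ne_zero (by rcases hσ with rfl | rfl <;> norm_num) (Complex.exp_ne_zero κ))
  have hW := fun {κ} hκ {x} hx =>
    hv.wronskian_eq_neg hc h hσ hα hβ hAB hα₀ hβ₀ (κ := κ) hκ (hreg κ) (x := x) hx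
  refine ⟨fun κ => -B κ, fun κ hκ x hx => hW hκ hx, ?_, fun κ hκ γ g₁ g₂ g₃ g₄ => ?_⟩
  · exact DifferentiableOn.analyticOnNhd (fun κ hκ => (hAB κ (by linarith [hκ.1])
      (by linarith [hκ.2])).2.1.neg.differentiableWithinAt) (TwoCenters.isOpen_jostDomain α β)
  · change Tendsto _ _ (𝓝 (-B κ))
    rw [← hW hκ TwoCenters.zero_mem_radialDomain]
    exact hv.tendsto_jostFunction hc h hσ hα hβ hAB hα₀ hβ₀ hΦ hκ (hreg κ).solution g₁ g₂ g₃ g₄
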